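/- Fix $k$ and let $\Phi$ be a random $k$-CNF formula with $n$ variables and $m=\alpha n$ clauses, the clauses being independent and each uniform among the clauses consisting of $k$ literals on $k$ distinct variables. Put $\Delta=k^4\alpha$ and fix $\zeta\in(0,1/12)$. Call a variable of high degree if it occurs in at least $\Delta$ clauses. Starting from the set of high-degree variables, repeatedly add all variables of every clause that has at least $\zeta k$ variables in the current set, until the set no longer grows; the final set $\mathcal V_{\mathrm{bad}}$ consists of the bad variables, the clauses with at least $\zeta k$ bad variables are the bad clauses, and all other variables and clauses are good. For $\gamma>0$ with $3\gamma(1-\zeta)\le 1$, a good marking is a set $\mathcal M$ of good variables such that every good clause contains at least $2\gamma(1-\zeta)k$ marked good variables and at least $\gamma(1-\zeta)k$ unmarked good variables. Let $\mu$ be the uniform distribution on the satisfying assignments of $\Phi$ and $\mu_{\mathcal M}$ its marginal on $\mathcal M$. For $\Lambda\subseteq\mathcal M$ and $\tau\in\{0,1\}^\Lambda$ let $\Psi^\tau$ be the matrix indexed by $\mathcal M\setminus\Lambda$ with zero diagonal and entries $$\Psi^\tau(u,v)=\mu(X_v=1\mid X_u=1,X_\Lambda=\tau)-\mu(X_v=1\mid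 X_u=0,X_\Lambda=\tau)\qquad(u\ne v).$$ We say that $\mu_{\mathcal M}$ is $\eta$-spectrally independent if, for all $\Lambda\subseteq\mathcal M$ and $\tau\in\{0,1\}^\Lambda$, all eigenvalues of $\Psi^\tau$ are at most $\eta$ in absolute value. **Lemma.** For every $\zeta\in(0,1/12)$ there is a constant $C=C(\zeta)>0$ such that for every $\gamma>0$ with $3\gamma(1-\zeta)\le1$ there is $k_0=k_0(\zeta,\gamma)$ such that the following holds for every fixed $k\ge k_0$ and every sequence $m=m(n)$ with $$\alpha=\frac mn\le \frac1{k^3}\,2^{\frac{(1-\zeta)(1-12\zeta)}{4(1-12\zeta)+5}\gamma k}\quad\text{for all } n.$$ With probability tending to $1$ over $\Phi$ as $n\to\infty$, for every good marking $\mathcal M$ of $\Phi$, $\mu_{\mathcal M}$ gives positive probability to every element of $\{0,1\}^{\mathcal M}$ (so that all the conditional probabilities above are well defined) and $\mu_{\mathcal M}$ is $C\Delta k^2\log n$-spectrally independent. -/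

import Mathlib

open Filter Topology

namespace RandomCNF

/-- A `k`-clause on the variables `Fin n`: `k` literals (a variable together with the truth value
that satisfies it) on `k` distinct variables. -/
abbrev KClause (k n : ℕ) : Type :=
  {c : Finset (Fin n × Bool) // c.card = k ∧ (c.image Prod.fst).card = k}

/-- A `k`-CNF formula with `n` variables and `m` clauses (an ordered list of clauses, repetitions
allowed). -/
abbrev Formula (k n m : ℕ) : Type := Fin m → KClause k n

/-- Truth assignments. -/
abbrev Assignment (n : ℕ) : Type := Fin n → Bool

variable {k n m : ℕ}

/-- The probability that a random formula (`m` independent clauses, each uniform among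
all `k`-clauses on `n` variables) has the property `P`. -/
noncomputable def formulaProb (k n m : ℕ) (P : Formula k n m → Prop) : ℝ :=
  ({Φ : Formula k n m | P Φ}.ncard : ℝ) / (Nat.card (Formula k n m) : ℝ)

/-- The set of variables of a clause. -/
def vbl (c : KClause k n) : Set (Fin n) := {v | ∃ b : Bool, (v, b) ∈ c.1}

/-- The set of satisfying assignments. -/
def solutions (Φ : Formula k n m) : Set (Assignment n) :=
  {σ | ∀ j : Fin m, ∃ l ∈ (Φ j).1, σ l.1 = l.2}

/-! ### Bad variables and bad clauses -/

/-- The degree threshold `Δ = k ^ 4 * α`, where `α = m / n` is the clause density. -/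
noncomputable def degThreshold (k n m : ℕ) : ℝ := (k : ℝ) ^ 4 * ((m : ℝ) / (n : ℝ))

/-- The number of literal occurrences of `v`; since the variables of a clause are distinct, this
is the number of clauses that contain `v`. -/
noncomputable def degree (Φ : Formula k n m) (v : Fin n) : ℕ := {j : Fin m | v ∈ vbl (Φ j)}.ncard

/-- The variables of high degree. -/
def highDegree (Φ : Formula k n m) : Set (Fin n) :=
  {v | degThreshold k n m ≤ (degree Φ v : ℝ)}

/-- The (indices of) clauses with at least `ζ k` variables in `S`. -/
def heavyClauses (ζ : ℝ) (Φ : Formula k n m) (S : Set (Fin n)) : Set (Fin m) :=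
  {j | ζ * (k : ℝ) ≤ ((vbl (Φ j) ∩ S).ncard : ℝ)}

/-- The stages of the iterative process: start from the variables of high degree, and
repeatedly add all variables of the clauses having at least `ζ k` variables in the current set. -/
def badStage (ζ : ℝ) (Φ : Formula k n m) : ℕ → Set (Fin n)
  | 0 => highDegree Φ
  | i + 1 => badStage ζ Φ i ∪ ⋃ j ∈ heavyClauses ζ Φ (badStage ζ Φ i), vbl (Φ j)

/-- The bad variables. The stages increase, and are constant once two consecutive
ones agree, so their union is the final stage. -/
def badVars (ζ : ℝ) (Φ : Formula k n m) : Set (Fin n) := ⋃ i, badStage ζ Φ i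

/-- The good variables. -/
def goodVars (ζ : ℝ) (Φ : Formula k n m) : Set (Fin n) := (badVars ζ Φ)ᶜ

/-- The (indices of) bad clauses. -/
def badClauses (ζ : ℝ) (Φ : Formula k n m) : Set (Fin m) := heavyClauses ζ Φ (badVars ζ Φ)

/-- The (indices of) good clauses. -/
def goodClauses (ζ : ℝ) (Φ : Formula k n m) : Set (Fin m) := (badClauses ζ Φ)ᶜ

/-- A good marking: a set of good variables such that every good clause, after its bad
variables are deleted, has at least `2 γ (1 - ζ) k` marked and at least `γ (1 - ζ) k`
unmarked variables. -/
def IsGoodMarking (γ ζ : ℝ) (Φ : Formula k n m) (M : Finset (Fin n)) : Prop :=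
  (M : Set (Fin n)) ⊆ goodVars ζ Φ ∧
    ∀ j ∈ goodClauses ζ Φ,
      2 * γ * (1 - ζ) * (k : ℝ) ≤ ((vbl (Φ j) ∩ goodVars ζ Φ ∩ (M : Set (Fin n))).ncard : ℝ) ∧
      γ * (1 - ζ) * (k : ℝ) ≤ (((vbl (Φ j) ∩ goodVars ζ Φ) \ (M : Set (Fin n))).ncard : ℝ)

/-! ### The uniform distribution on solutions, influences, spectral independence -/

/-- The probability of the event `A` under the uniform distribution `μ` on solutions. -/
noncomputable def solProb (Φ : Formula k n m) (A : Set (Assignment n)) : ℝ :=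
  ((solutions Φ ∩ A).ncard : ℝ) / ((solutions Φ).ncard : ℝ)

/-- The conditional probability `μ (A | B)`. -/
noncomputable def condProb (Φ : Formula k n m) (A B : Set (Assignment n)) : ℝ :=
  solProb Φ (A ∩ B) / solProb Φ B

/-- The event `X_Λ = τ`, for the pinning of `Λ` given by the restriction of `τ` to `Λ`. -/
def pinned (Λ : Finset (Fin n)) (τ : Assignment n) : Set (Assignment n) :=
  {σ | ∀ v ∈ Λ, σ v = τ v}

/-- The pairwise influence matrix on `M \ Λ` under the pinning `τ` of `Λ`:
`Ψ u v = μ (X_v = 1 | X_u = 1, X_Λ = τ) - μ (X_v = 1 | X_u = 0, X_Λ = τ)` for `u ≠ v`,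
with zero diagonal. -/
noncomputable def influenceMatrix (Φ : Formula k n m) (M Λ : Finset (Fin n)) (τ : Assignment n) :
    Matrix {v // v ∈ M \ Λ} {v // v ∈ M \ Λ} ℝ :=
  Matrix.of fun u v =>
    if u = v then 0
    else
      condProb Φ {σ | σ v.1 = true} ({σ | σ u.1 = true} ∩ pinned Λ τ) -
        condProb Φ {σ | σ v.1 = true} ({σ | σ u.1 = false} ∩ pinned Λ τ)

/-- `μ_M` gives positive probability to every assignment of `M`; then all
conditional probabilities in the influence matrices are conditioned on events of
positive probability. -/
def HasFullSupport (Φ : Formula k n m) (M : Finset (Fin n)) : Prop :=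
  ∀ τ : Assignment n, 0 < solProb Φ (pinned M τ)

/-- The marginal `μ_M` is `η`-spectrally independent: under every pinning of a
subset of `M`, the eigenvalues of the influence matrix are at most `η`. The bound is put on the
absolute value, so that it does not depend on the sign convention for influences. -/
def IsSpectrallyIndependent (Φ : Formula k n m) (M : Finset (Fin n)) (η : ℝ) : Prop :=
  ∀ Λ ⊆ M, ∀ τ : Assignment n, ∀ lam : ℝ,
    Module.End.HasEigenvalue (Matrix.toLin' (influenceMatrix Φ M Λ τ)) lam → |lam| ≤ η

end RandomCNF

/-! The diagonal of the influence matrix is zero, so by Gershgorin it suffices to bound, for every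
pinning and every `u`, the total change of all marginals when the value at `u` is flipped.

Put `s = γ(1-ζ)k`. Every good clause has at least `s` unmarked good variables, and the local lemma
splits these variables into two parts `R` and `Z`, each with at least `s/4` variables in every good
clause (`exists_balanced`). The part `Z` is never pinned. Hence under any pinning of variables in `M
∪ R` the local lemma on `Z` still satisfies all good clauses, and an unpinned variable of `R` takes
each value with probability at most `1/2 + e`, where `e = 2 · 2^(-s/4) · Δ`
(`LocallySparse.marginal_le`). Bad clauses contain only bad variables and are satisfied separately,
through Hall's theorem.

Start from two pinnings that differ at `u` and reveal variables of `R` one at a time, in clauses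
that touch the region the discrepancy may have reached, coupling the two values optimally. When
nothing is left to reveal, the two conditional distributions agree outside that region
(`marginal_eq_of_not_reach`), so the change is at most the size of the region. A region of more than
`1 + kL` variables yields a connected set of `L` clauses in which each clause is bad, or was entered
through a revealed disagreement, or is good and failed: all its `R`-variables are revealed and no
revealed literal satisfies it in both copies. Every such set, with a record of these reasons,
carries a potential that equals 1 when the event occurs and does not grow in expectation when a
variable is revealed (`sum_pot_insert_le`). The initial potential therefore controls large regions
(`discrepancy_le_sum`).

Three properties of random formulas bound the initial potential for `L = ⌈log n⌉`: small sets of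
clauses have almost `k` distinct variables per clause (`Expands`), so almost every clause acts on
private variables; connected sets of `L` clauses are 99% good (`card_good_ge`); and there are at
most `n² (e k² α)^L` of them, where `e` is Euler's number. Since `α ≤ k⁻³ 2^(s/9)`, each clause
contributes a factor at most `exp (-3)` in total, so `n` times the potential is at most 1 and the
change is `O(k log n)`. The properties follow from first moment bounds and fail with probability
`O(1/n)`. If `Δ ≤ 1`, every variable that occurs is bad and the good variables have no influence at
all. -/

namespace RandomCNF

/-! ### The local lemma for counting measure -/

section LocalLemma

variable {Ω ι : Type*}

/-- The set of points that avoid all the events indexed by `T`. -/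
def avoid (A : ι → Set Ω) (T : Finset ι) : Set Ω := {σ | ∀ i ∈ T, σ ∉ A i}

lemma avoid_anti (A : ι → Set Ω) {S T : Finset ι} (h : S ⊆ T) : avoid A T ⊆ avoid A S :=
  fun _ hσ i hi => hσ i (h hi)

variable [Finite Ω] [DecidableEq ι]

/-- A union bound among the points that avoid `T`. It drives the induction of the local lemma and
the positivity statement, and it measures the cost of restoring clauses in `LocallySparse.coord_le`.
-/
lemma ncard_avoid_union_ge (A : ι → Set Ω) (S T : Finset ι) (c : ℝ)
    (h : ∀ i ∈ S, ((A i ∩ avoid A T).ncard : ℝ) ≤ c * (avoid A T).ncard) :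
    (1 - c * S.card) * (avoid A T).ncard ≤ ((avoid A (S ∪ T)).ncard : ℝ) := by
  have hsub : avoid A T ⊆ avoid A (S ∪ T) ∪ ⋃ i ∈ S, (A i ∩ avoid A T) := by
    intro σ hσ
    by_cases hS : ∃ i ∈ S, σ ∈ A i
    · obtain ⟨i, hi, hiσ⟩ := hS
      exact Or.inr (Set.mem_biUnion hi ⟨hiσ, hσ⟩)
    · push Not at hS
      left
      intro i hi
      rcases Finset.mem_union.1 hi with h1 | h1
      · exact hS i h1
      · exact hσ i h1
  have h1 : (avoid A T).ncard ≤ (avoid A (S ∪ T)).ncard + ∑ i ∈ S, (A i ∩ avoid A T).ncard :=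
    (Set.ncard_le_ncard hsub (Set.toFinite _)).trans ((Set.ncard_union_le _ _).trans
      (Nat.add_le_add_left (Finset.set_ncard_biUnion_le S _) _))
  have h2 : ((avoid A T).ncard : ℝ) ≤
      (avoid A (S ∪ T)).ncard + ∑ i ∈ S, ((A i ∩ avoid A T).ncard : ℝ) := by exact_mod_cast h1
  have h3 : ∑ i ∈ S, ((A i ∩ avoid A T).ncard : ℝ) ≤ S.card * (c * (avoid A T).ncard) := by
    rw [← nsmul_eq_mul]
    exact Finset.sum_le_card_nsmul _ _ _ h
  nlinarith

/-- The lopsided local lemma, for the counting measure on a finite set. -/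
theorem localLemma (A : ι → Set Ω) (N : ι → Finset ι) (J : Finset ι) {q d : ℝ} (hq : 0 ≤ q)
    (hN : ∀ j ∈ J, ((N j).card : ℝ) ≤ d) (hqd : 4 * q * d ≤ 1)
    (hA : ∀ j ∈ J, ∀ T : Finset ι, T ⊆ J → Disjoint T (N j) →
      ((A j ∩ avoid A T).ncard : ℝ) ≤ q * (avoid A T).ncard)
    (T : Finset ι) (hT : T ⊆ J) (j : ι) (hj : j ∈ J) :
    ((A j ∩ avoid A T).ncard : ℝ) ≤ 2 * q * (avoid A T).ncard := by
  induction hc : T.card using Nat.strong_induction_on generalizing T j with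
  | _ c ih =>
    have hTU : T ∩ N j ∪ T \ N j = T := by
      rw [Finset.union_comm]; exact Finset.sdiff_union_inter T (N j)
    have hlow : (1 / 2 : ℝ) * (avoid A (T \ N j)).ncard ≤ (avoid A T).ncard := by
      -- The induction hypothesis is available only if removing `N j` really shrinks `T`; otherwise
      -- nothing has to be compared.
      rcases (T ∩ N j).eq_empty_or_nonempty with he | hne
      · rw [he, Finset.empty_union] at hTU
        rw [hTU]
        have : (0 : ℝ) ≤ (avoid A T).ncard := Nat.cast_nonneg _
        linarith
      · have hlt : (T \ N j).card < c := by
          rw [← hc]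
          apply Finset.card_lt_card
          rw [Finset.ssubset_iff_subset_ne]
          refine ⟨Finset.sdiff_subset, fun he => ?_⟩
          obtain ⟨x, hx⟩ := hne
          rw [Finset.mem_inter] at hx
          have := hx.1
          rw [← he, Finset.mem_sdiff] at this
          exact this.2 hx.2
        have h1 := ncard_avoid_union_ge A (T ∩ N j) (T \ N j) (2 * q)
          (fun i hi => ih _ hlt (T \ N j) (Finset.sdiff_subset.trans hT) i
            (hT (Finset.mem_inter.1 hi).1) rfl)
        rw [hTU] at h1
        have h2 : ((T ∩ N j).card : ℝ) ≤ d :=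
          le_trans (by exact_mod_cast Finset.card_le_card Finset.inter_subset_right) (hN j hj)
        have h3 : (0 : ℝ) ≤ (avoid A (T \ N j)).ncard := Nat.cast_nonneg _
        have h4 : (1 / 2 : ℝ) ≤ 1 - 2 * q * (T ∩ N j).card := by nlinarith
        nlinarith
    have h5 : ((A j ∩ avoid A T).ncard : ℝ) ≤ (A j ∩ avoid A (T \ N j)).ncard := by
      exact_mod_cast Set.ncard_le_ncard
        (Set.inter_subset_inter_right _ (avoid_anti A Finset.sdiff_subset)) (Set.toFinite _)
    have h6 := hA j hj (T \ N j) (Finset.sdiff_subset.trans hT) Finset.sdiff_disjoint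
    nlinarith

/-- Adding the events one by one keeps at least the fraction `1 - c > 0` each time. -/
theorem localLemma_pos [Nonempty Ω] (A : ι → Set Ω) (J : Finset ι) {c : ℝ} (hc : c < 1)
    (hA : ∀ T ⊆ J, ∀ j ∈ J, ((A j ∩ avoid A T).ncard : ℝ) ≤ c * (avoid A T).ncard)
    (T : Finset ι) (hT : T ⊆ J) : 0 < (avoid A T).ncard := by
  induction T using Finset.induction_on with
  | empty =>
    have : avoid A ∅ = Set.univ := by ext; simp [avoid]
    rw [this]
    exact Set.ncard_pos (Set.toFinite _) |>.2 Set.univ_nonempty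
  | insert j T _ ih =>
    have hTJ : T ⊆ J := (Finset.subset_insert j T).trans hT
    have h0 := ih hTJ
    have h1 := ncard_avoid_union_ge A {j} T c (fun i hi => by
      rw [Finset.mem_singleton] at hi
      exact hA T hTJ i (hT (by rw [hi]; exact Finset.mem_insert_self j T)))
    rw [Finset.card_singleton, Nat.cast_one, mul_one, Finset.singleton_union] at h1
    have h2 : (0 : ℝ) < (avoid A T).ncard := by exact_mod_cast h0
    have h3 : (0 : ℝ) < (avoid A (insert j T)).ncard :=
      lt_of_lt_of_le (mul_pos (by linarith) h2) h1
    exact_mod_cast h3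

end LocalLemma

/-! ### Independence on the Boolean cube -/

section Cube

variable {V : Type*} [DecidableEq V]

/-- Exchange the coordinates outside `Z` of two points of the cube. -/
def swapOff (Z : Finset V) (p : (V → Bool) × (V → Bool)) : (V → Bool) × (V → Bool) :=
  (Z.piecewise p.1 p.2, Z.piecewise p.2 p.1)

lemma swapOff_involutive (Z : Finset V) : Function.Involutive (swapOff Z) := by
  rintro ⟨a, b⟩
  ext v <;> by_cases h : v ∈ Z <;> simp [swapOff, h]

/-- This single bijection on pairs gives the independence of disjoint coordinates, the decomposition
into fibres, and the recombination of two solutions at the end of the exploration. -/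
lemma ncard_swapOff_preimage (Z : Finset V) (S : Set ((V → Bool) × (V → Bool))) :
    (swapOff Z ⁻¹' S).ncard = S.ncard := by
  apply Set.ncard_preimage_of_injective_subset_range (swapOff_involutive Z).injective
  rw [(swapOff_involutive Z).surjective.range_eq]
  exact Set.subset_univ S

variable [Fintype V]

/-- Events that depend on disjoint sets of coordinates are independent. -/
lemma ncard_inter_mul (Z : Finset V) (A B : Set (V → Bool))
    (hA : ∀ σ σ' : V → Bool, (∀ v ∈ Z, σ v = σ' v) → σ ∈ A → σ' ∈ A)
    (hB : ∀ σ σ' : V → Bool, (∀ v ∉ Z, σ v = σ' v) → σ ∈ B → σ' ∈ B) :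
    (A ∩ B).ncard * 2 ^ Fintype.card V = A.ncard * B.ncard := by
  have h := ncard_swapOff_preimage Z ((A ∩ B) ×ˢ (Set.univ : Set (V → Bool)))
  have h2 : swapOff Z ⁻¹' ((A ∩ B) ×ˢ (Set.univ : Set (V → Bool))) = A ×ˢ B := by
    ext ⟨a, b⟩
    simp only [swapOff, Set.mem_preimage, Set.mem_prod, Set.mem_inter_iff, Set.mem_univ, and_true]
    constructor
    · rintro ⟨h1, h2⟩
      exact ⟨hA _ _ (fun v hv => by simp [hv]) h1, hB _ _ (fun v hv => by simp [hv]) h2⟩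
    · rintro ⟨h1, h2⟩
      exact ⟨hA _ _ (fun v hv => by simp [hv]) h1, hB _ _ (fun v hv => by simp [hv]) h2⟩
  rw [h2, Set.ncard_prod, Set.ncard_prod] at h
  rw [h, Set.ncard_univ, Nat.card_eq_fintype_card, Fintype.card_fun, Fintype.card_bool]

lemma ncard_subcube (Z : Finset V) (f : V → Bool) :
    {σ : V → Bool | ∀ v ∈ Z, σ v = f v}.ncard * 2 ^ Z.card = 2 ^ Fintype.card V := by
  have h1 : {σ : V → Bool | ∀ v ∈ Z, σ v = f v} =
      ((Fintype.piFinset fun v => if v ∈ Z then {f v} else Finset.univ : Finset (V → Bool)) :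
        Set (V → Bool)) := by
    ext σ
    simp only [Set.mem_ofPred_eq, Finset.mem_coe, Fintype.mem_piFinset]
    refine forall_congr' fun v => ?_
    by_cases h : v ∈ Z <;> simp [h]
  rw [h1, Set.ncard_coe_finset, Fintype.card_piFinset]
  have h2 : ∀ v, (if v ∈ Z then ({f v} : Finset Bool) else Finset.univ).card *
      (if v ∈ Z then 2 else 1) = 2 := by
    intro v; by_cases h : v ∈ Z <;> simp [h]
  have h3 : ∏ v : V, (if v ∈ Z then 2 else 1 : ℕ) = 2 ^ Z.card := by
    rw [Finset.prod_ite_mem, Finset.univ_inter, Finset.prod_const]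
  rw [← h3, ← Finset.prod_mul_distrib, Finset.prod_congr rfl (fun v _ => h2 v), Finset.prod_const,
    Finset.card_univ]

/-- The local lemma for events in the cube, each of which depends on few coordinates. -/
theorem localLemma_cube {ι : Type*} [DecidableEq ι] (A : ι → Set (V → Bool)) (Z : ι → Finset V)
    (J : Finset ι) {q d : ℝ} (hq : 0 ≤ q) (hqd : 4 * q * d ≤ 1)
    (hZ : ∀ j ∈ J, ∀ σ σ' : V → Bool, (∀ v ∈ Z j, σ v = σ' v) → σ ∈ A j → σ' ∈ A j)
    (hd : ∀ j ∈ J, ((J.filter fun i => ¬ Disjoint (Z i) (Z j)).card : ℝ) ≤ d)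
    (hA : ∀ j ∈ J, ((A j).ncard : ℝ) ≤ q * 2 ^ Fintype.card V)
    (T : Finset ι) (hT : T ⊆ J) (j : ι) (hj : j ∈ J) :
    ((A j ∩ avoid A T).ncard : ℝ) ≤ 2 * q * (avoid A T).ncard := by
  refine localLemma A (fun j => J.filter fun i => ¬ Disjoint (Z i) (Z j)) J hq hd hqd ?_ T hT j hj
  intro j hj T hT hdis
  have h := ncard_inter_mul (Z j) (A j) (avoid A T) (hZ j hj) (fun σ σ' hσ hav i hi hA' => by
    refine hav i hi (hZ i (hT hi) σ' σ (fun v hv => ?_) hA')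
    refine (hσ v fun hvj => ?_).symm
    refine Finset.disjoint_left.1 hdis hi (Finset.mem_filter.2 ⟨hT hi, ?_⟩)
    exact fun hd => Finset.disjoint_left.1 hd hv hvj)
  have hpos : (0 : ℝ) < 2 ^ Fintype.card V := by positivity
  have h' : ((A j ∩ avoid A T).ncard : ℝ) * 2 ^ Fintype.card V =
      (A j).ncard * (avoid A T).ncard := by exact_mod_cast h
  have h2 : ((A j).ncard : ℝ) * (avoid A T).ncard ≤
      q * 2 ^ Fintype.card V * (avoid A T).ncard :=
    mul_le_mul_of_nonneg_right (hA j hj) (Nat.cast_nonneg _)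
  rw [← h'] at h2
  nlinarith

end Cube

/-! ### Balanced splitting of a family of sets -/

section Balanced

variable {V : Type*} [DecidableEq V] [Fintype V]

/-- An exponential moment: a coordinate of `Z` contributes `1/2 + 1/2 · 1/3 = 2/3` on average. -/
lemma sum_third_pow (Z : Finset V) (b : Bool) :
    ∑ σ : V → Bool, (1 / 3 : ℝ) ^ (Z.filter fun v => σ v = b).card =
      2 ^ Fintype.card V * (2 / 3) ^ Z.card := by
  have h1 : ∀ σ : V → Bool, (1 / 3 : ℝ) ^ (Z.filter fun v => σ v = b).card =
      ∏ v, if v ∈ Z then (if σ v = b then (1 / 3 : ℝ) else 1) else 1 := by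
    intro σ
    rw [Finset.prod_ite_mem, Finset.univ_inter, Finset.prod_ite, Finset.prod_const,
      Finset.prod_const_one, mul_one]
  simp_rw [h1]
  have h2 := Finset.prod_univ_sum (fun _ : V => (Finset.univ : Finset Bool))
    (fun v c => if v ∈ Z then (if c = b then (1 / 3 : ℝ) else 1) else 1)
  rw [Fintype.piFinset_univ] at h2
  rw [← h2]
  have h3 : ∀ v : V, ∑ c : Bool, (if v ∈ Z then (if c = b then (1 / 3 : ℝ) else 1) else 1) =
      2 * (if v ∈ Z then 2 / 3 else 1) := by
    intro v
    by_cases h : v ∈ Z <;> cases b <;> simp [h] <;> norm_num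
  rw [Finset.prod_congr rfl (fun v _ => h3 v), Finset.prod_mul_distrib, Finset.prod_ite_mem,
    Finset.univ_inter, Finset.prod_const, Finset.prod_const, Finset.card_univ]

/-- As powers with exponent `s/12`, the claim is the numerical inequality `(2/3)^12 · 3^3 ≤ 1/4`. -/
lemma two_thirds_rpow_le {s : ℝ} (hs : 0 ≤ s) :
    (2 / 3 : ℝ) ^ s * 3 ^ (s / 4) ≤ 2 ^ (-(s / 6)) := by
  have h1 : (2 / 3 : ℝ) ^ s * 3 ^ (s / 4) = ((2 / 3 : ℝ) ^ (12 : ℕ) * 3 ^ (3 : ℕ)) ^ (s / 12) := by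
    rw [Real.mul_rpow (by positivity) (by positivity), ← Real.rpow_natCast, ← Real.rpow_natCast,
      ← Real.rpow_mul (by norm_num), ← Real.rpow_mul (by norm_num)]
    congr 2 <;> push_cast <;> ring
  have h2 : (2 : ℝ) ^ (-(s / 6)) = ((1 / 4 : ℝ)) ^ (s / 12) := by
    have : (1 / 4 : ℝ) = 2 ^ (-2 : ℝ) := by
      rw [Real.rpow_neg (by norm_num)]; norm_num
    rw [this, ← Real.rpow_mul (by norm_num)]
    congr 1; ring
  rw [h1, h2]
  exact Real.rpow_le_rpow (by positivity) (by norm_num) (by positivity)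

/-- Markov's inequality for the moment above: a point of the set has weight at least `(1/3)^(s/4)`,
while the mean weight is at most `(2/3)^s`. -/
lemma ncard_few_le (Z : Finset V) (b : Bool) {s : ℝ} (hs : 0 ≤ s) (hZ : s ≤ Z.card) :
    ({σ : V → Bool | ((Z.filter fun v => σ v = b).card : ℝ) < s / 4}.ncard : ℝ) ≤
      2 ^ (-(s / 6)) * 2 ^ Fintype.card V := by
  classical
  set F := Finset.univ.filter fun σ : V → Bool => ((Z.filter fun v => σ v = b).card : ℝ) < s / 4
  have hF : {σ : V → Bool | ((Z.filter fun v => σ v = b).card : ℝ) < s / 4} = (F : Set _) := by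
    ext; simp [F]
  rw [hF, Set.ncard_coe_finset]
  have h1 : (F.card : ℝ) * (1 / 3 : ℝ) ^ (s / 4) ≤ 2 ^ Fintype.card V * (2 / 3) ^ Z.card := by
    rw [← sum_third_pow Z b, ← nsmul_eq_mul]
    refine (Finset.card_nsmul_le_sum F
      (fun σ => (1 / 3 : ℝ) ^ (Z.filter fun v => σ v = b).card) _ ?_).trans
      (Finset.sum_le_univ_sum_of_nonneg fun _ => by positivity)
    intro σ hσ
    rw [← Real.rpow_natCast]
    exact Real.rpow_le_rpow_of_exponent_ge (by norm_num) (by norm_num)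
      (Finset.mem_filter.1 hσ).2.le
  have h2 : (2 / 3 : ℝ) ^ Z.card ≤ (2 / 3 : ℝ) ^ s := by
    rw [← Real.rpow_natCast]
    exact Real.rpow_le_rpow_of_exponent_ge (by norm_num) (by norm_num) hZ
  have h3 : (1 / 3 : ℝ) ^ (s / 4) * 3 ^ (s / 4) = 1 := by
    rw [← Real.mul_rpow (by norm_num) (by norm_num)]; norm_num
  have h4 := two_thirds_rpow_le hs
  have h5 : (0 : ℝ) < 3 ^ (s / 4) := by positivity
  calc (F.card : ℝ) = F.card * (1 / 3 : ℝ) ^ (s / 4) * 3 ^ (s / 4) := by rw [mul_assoc, h3, mul_one]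
    _ ≤ 2 ^ Fintype.card V * (2 / 3 : ℝ) ^ s * 3 ^ (s / 4) :=
        mul_le_mul_of_nonneg_right (h1.trans (by gcongr)) h5.le
    _ = ((2 / 3 : ℝ) ^ s * 3 ^ (s / 4)) * 2 ^ Fintype.card V := by ring
    _ ≤ _ := by gcongr

/-- A set that splits each of the given sets in a balanced way. -/
theorem exists_balanced {ι : Type*} [DecidableEq ι] (Z : ι → Finset V) (J : Finset ι) {s d : ℝ}
    (hs : 0 ≤ s) (hZ : ∀ j ∈ J, s ≤ (Z j).card)
    (hd : ∀ j ∈ J, ((J.filter fun i => ¬ Disjoint (Z i) (Z j)).card : ℝ) ≤ d)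
    (hsd : 8 * (2 : ℝ) ^ (-(s / 6)) * d ≤ 1) (hs1 : 4 * (2 : ℝ) ^ (-(s / 6)) < 1) :
    ∃ R : Finset V, ∀ j ∈ J, s / 4 ≤ (Z j ∩ R).card ∧ s / 4 ≤ (Z j \ R).card := by
  classical
  set A : ι → Set (V → Bool) := fun j =>
    {σ | (((Z j).filter fun v => σ v = true).card : ℝ) < s / 4} ∪
    {σ | (((Z j).filter fun v => σ v = false).card : ℝ) < s / 4} with hAdef
  have hA : ∀ j ∈ J, ((A j).ncard : ℝ) ≤ 2 * 2 ^ (-(s / 6)) * 2 ^ Fintype.card V := by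
    intro j hj
    have h1 := ncard_few_le (Z j) true hs (hZ j hj)
    have h2 := ncard_few_le (Z j) false hs (hZ j hj)
    have h3 : ((A j).ncard : ℝ) ≤
        ({σ : V → Bool | (((Z j).filter fun v => σ v = true).card : ℝ) < s / 4}.ncard : ℝ) +
        {σ : V → Bool | (((Z j).filter fun v => σ v = false).card : ℝ) < s / 4}.ncard := by
      exact_mod_cast Set.ncard_union_le _ _
    linarith
  have hdep : ∀ j ∈ J, ∀ σ σ' : V → Bool, (∀ v ∈ Z j, σ v = σ' v) → σ ∈ A j → σ' ∈ A j := by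
    intro j _ σ σ' h
    have : ∀ b, ((Z j).filter fun v => σ v = b) = ((Z j).filter fun v => σ' v = b) := fun b =>
      Finset.filter_congr fun v hv => by rw [h v hv]
    simp only [hAdef, Set.mem_union, Set.mem_ofPred_eq, this]
    exact id
  have hll := localLemma_cube A Z J (q := 2 * 2 ^ (-(s / 6))) (d := d) (by positivity)
    (by linarith) hdep hd hA
  have hpos := localLemma_pos A J (c := 2 * (2 * 2 ^ (-(s / 6)))) (by linarith) hll J
    Finset.Subset.rfl
  obtain ⟨σ, hσ⟩ := (Set.ncard_pos (Set.toFinite _)).1 hpos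
  refine ⟨Finset.univ.filter fun v => σ v = true, fun j hj => ?_⟩
  have h1 := hσ j hj
  simp only [hAdef, Set.mem_union, Set.mem_ofPred_eq, not_or, not_lt] at h1
  have e1 : Z j ∩ Finset.univ.filter (fun v => σ v = true) = (Z j).filter fun v => σ v = true := by
    ext; simp
  have e2 : Z j \ Finset.univ.filter (fun v => σ v = true) = (Z j).filter fun v => σ v = false := by
    ext; simp
  rw [e1, e2]
  exact h1

end Balanced

/-! ### Local uniformity of solutions -/

variable {k n m : ℕ}

/-- The variables of a clause, as a finite set. -/
def vars (c : KClause k n) : Finset (Fin n) := c.1.image Prod.fst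

lemma mem_vars {c : KClause k n} {v : Fin n} : v ∈ vars c ↔ v ∈ vbl c := by
  simp [vars, vbl]

lemma coe_vars (c : KClause k n) : (vars c : Set (Fin n)) = vbl c := by
  ext v; exact mem_vars

lemma card_vars (c : KClause k n) : (vars c).card = k := c.2.2

lemma fst_mem_vars {c : KClause k n} {l : Fin n × Bool} (hl : l ∈ c.1) : l.1 ∈ vars c :=
  Finset.mem_image_of_mem _ hl

/-- The clause `c` is satisfied by `σ`. -/
def Sat (σ : Assignment n) (c : KClause k n) : Prop := ∃ l ∈ c.1, σ l.1 = l.2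

lemma Sat.congr {σ σ' : Assignment n} {c : KClause k n} (h : ∀ v ∈ vars c, σ v = σ' v)
    (hs : Sat σ c) : Sat σ' c := by
  obtain ⟨l, hl, he⟩ := hs
  exact ⟨l, hl, by rw [← h _ (fst_mem_vars hl), he]⟩

/-- The assignments of `A` that, together with `ρ` outside `A`, violate the clause `c`. -/
def viol (A : Finset (Fin n)) (ρ : Assignment n) (c : KClause k n) : Set (Assignment n) :=
  {σ | ¬ Sat (A.piecewise σ ρ) c}

lemma viol_congr (A : Finset (Fin n)) (ρ : Assignment n) (c : KClause k n) (σ σ' : Assignment n)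
    (h : ∀ v ∈ vars c ∩ A, σ v = σ' v) (hσ : σ ∈ viol A ρ c) : σ' ∈ viol A ρ c := by
  refine fun hs => hσ (hs.congr fun v hv => ?_)
  by_cases hA : v ∈ A
  · simp [hA, h v (Finset.mem_inter.2 ⟨hv, hA⟩)]
  · simp [hA]

/-- A violated clause forces each of its variables in `A` to the value opposite to its literal;
those in `Z` alone already give the bound. -/
lemma ncard_viol_le (A : Finset (Fin n)) (ρ : Assignment n) (c : KClause k n)
    {Z : Finset (Fin n)} (hZ : Z ⊆ vars c ∩ A) :
    ((viol A ρ c).ncard : ℝ) ≤ (1 / 2) ^ Z.card * 2 ^ Fintype.card (Fin n) := by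
  have hex : ∀ v ∈ vars c, ∃ b, (v, b) ∈ c.1 := fun v hv => mem_vars.1 hv
  choose! f hf using hex
  have hsub : viol A ρ c ⊆ {σ | ∀ v ∈ Z, σ v = ! f v} := by
    intro σ hσ v hv
    have hv' := Finset.mem_inter.1 (hZ hv)
    by_contra hne
    refine hσ ⟨(v, f v), hf v hv'.1, ?_⟩
    have : σ v = f v := by
      cases h1 : σ v <;> cases h2 : f v <;> simp_all
    simp [hv'.2, this]
  have h1 := ncard_subcube Z fun v => ! f v
  have h2 : ({σ : Assignment n | ∀ v ∈ Z, σ v = ! f v}.ncard : ℝ) * 2 ^ Z.card =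
      2 ^ Fintype.card (Fin n) := by exact_mod_cast h1
  have h3 : ((viol A ρ c).ncard : ℝ) ≤ ({σ : Assignment n | ∀ v ∈ Z, σ v = ! f v}.ncard : ℝ) := by
    exact_mod_cast Set.ncard_le_ncard hsub (Set.toFinite _)
  rw [← h2, one_div, inv_pow]
  rw [mul_comm _ ((2 : ℝ) ^ Z.card), inv_mul_cancel_left₀ (by positivity)]
  exact h3

/-- The hypotheses of the local lemma for the clauses in `G`, on the free variables in `A`. -/
structure LocallySparse (Φ : Formula k n m) (G : Finset (Fin m)) (A Z : Finset (Fin n))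
    (q d : ℝ) : Prop where
  subset : Z ⊆ A
  nonneg : 0 ≤ q
  four_mul_le : 4 * q * d ≤ 1
  lt_one : 2 * q < 1
  prob_le : ∀ j ∈ G, (1 / 2 : ℝ) ^ (vars (Φ j) ∩ Z).card ≤ q
  degree_le : ∀ j ∈ G,
    ((G.filter fun i => ¬ Disjoint (vars (Φ i) ∩ A) (vars (Φ j) ∩ A)).card : ℝ) ≤ d

section Fiber

variable {Φ : Formula k n m} {G : Finset (Fin m)} {A Z : Finset (Fin n)} {q d : ℝ}

lemma LocallySparse.viol_le (h : LocallySparse Φ G A Z q d) (ρ : Assignment n)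
    (T : Finset (Fin m)) (hT : T ⊆ G) (j : Fin m) (hj : j ∈ G) :
    ((viol A ρ (Φ j) ∩ avoid (fun i => viol A ρ (Φ i)) T).ncard : ℝ) ≤
      2 * q * (avoid (fun i => viol A ρ (Φ i)) T).ncard := by
  refine localLemma_cube (fun i => viol A ρ (Φ i)) (fun i => vars (Φ i) ∩ A) G h.nonneg
    h.four_mul_le (fun j _ => viol_congr A ρ (Φ j)) h.degree_le ?_ T hT j hj
  intro j hj
  refine (ncard_viol_le A ρ (Φ j) (Z := vars (Φ j) ∩ Z)
    (Finset.inter_subset_inter_left h.subset)).trans ?_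
  exact mul_le_mul_of_nonneg_right (h.prob_le j hj) (by positivity)

lemma LocallySparse.exists_sat (h : LocallySparse Φ G A Z q d) (ρ : Assignment n) :
    ∃ σ : Assignment n, ∀ j ∈ G, Sat (A.piecewise σ ρ) (Φ j) := by
  have hpos := localLemma_pos (fun i => viol A ρ (Φ i)) G (c := 2 * q) h.lt_one
    (fun T hT j hj => h.viol_le ρ T hT j hj) G Finset.Subset.rfl
  obtain ⟨σ, hσ⟩ := (Set.ncard_pos (Set.toFinite _)).1 hpos
  exact ⟨σ, fun j hj => not_not.1 (hσ j hj)⟩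

lemma ncard_coord (w : Fin n) (b : Bool) :
    ({σ : Assignment n | σ w = b}.ncard : ℝ) = 1 / 2 * 2 ^ Fintype.card (Fin n) := by
  have h := ncard_subcube {w} fun _ : Fin n => b
  simp only [Finset.mem_singleton, forall_eq, Finset.card_singleton, pow_one] at h
  have h' : ({σ : Assignment n | σ w = b}.ncard : ℝ) * 2 = 2 ^ Fintype.card (Fin n) := by
    exact_mod_cast h
  linarith

/-- Without the at most `d'` clauses that contain `w`, the value at `w` is an exactly fair coin.
Restoring these clauses keeps at least the fraction `1 - 2 q d'` of the assignments. -/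
lemma LocallySparse.coord_le (h : LocallySparse Φ G A Z q d) (ρ : Assignment n) (w : Fin n)
    (b : Bool) {d' : ℝ} (hd' : ((G.filter fun i => w ∈ vars (Φ i)).card : ℝ) ≤ d')
    (hq : 2 * q * d' ≤ 1) :
    (1 - 2 * q * d') *
      (({σ | σ w = b} ∩ {σ | ∀ j ∈ G, Sat (A.piecewise σ ρ) (Φ j)}).ncard : ℝ) ≤
      1 / 2 * ({σ | ∀ j ∈ G, Sat (A.piecewise σ ρ) (Φ j)}.ncard : ℝ) := by
  have he : {σ | ∀ j ∈ G, Sat (A.piecewise σ ρ) (Φ j)} = avoid (fun i => viol A ρ (Φ i)) G := by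
    ext σ
    exact forall₂_congr fun j _ => not_not.symm
  set B := fun T => avoid (fun i => viol A ρ (Φ i)) T
  set S := G.filter fun i => w ∈ vars (Φ i)
  set T := G.filter fun i => w ∉ vars (Φ i)
  have hST : S ∪ T = G := Finset.filter_union_filter_not_eq _ G
  rw [he]
  have h1 := ncard_avoid_union_ge (fun i => viol A ρ (Φ i)) S T (2 * q) (fun i hi =>
    h.viol_le ρ T (Finset.filter_subset _ _) i (Finset.mem_filter.1 hi).1)
  rw [hST] at h1
  have h2 : (({σ | σ w = b} ∩ B G).ncard : ℝ) ≤ ({σ | σ w = b} ∩ B T).ncard := by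
    exact_mod_cast Set.ncard_le_ncard
      (Set.inter_subset_inter_right _ (avoid_anti _ (Finset.filter_subset _ _))) (Set.toFinite _)
  have h3 : (({σ : Assignment n | σ w = b} ∩ B T).ncard : ℝ) = 1 / 2 * (B T).ncard := by
    have h4 := ncard_inter_mul {w} {σ : Assignment n | σ w = b} (B T)
      (fun σ σ' hσ hb => by
        have := hσ w (Finset.mem_singleton_self w)
        simp only [Set.mem_ofPred_eq] at hb ⊢
        rw [← this, hb])
      (fun σ σ' hσ hav i hi hv => by
        refine hav i hi (viol_congr A ρ (Φ i) σ' σ (fun v hv => (hσ v ?_).symm) hv)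
        intro hvw
        rw [Finset.mem_singleton] at hvw
        rw [hvw] at hv
        exact (Finset.mem_filter.1 hi).2 (Finset.mem_inter.1 hv).1)
    have h5 : (({σ : Assignment n | σ w = b} ∩ B T).ncard : ℝ) * 2 ^ Fintype.card (Fin n) =
      ({σ : Assignment n | σ w = b}.ncard : ℝ) * (B T).ncard := by exact_mod_cast h4
    rw [ncard_coord] at h5
    have hpos : (0 : ℝ) < 2 ^ Fintype.card (Fin n) := by positivity
    apply mul_right_cancel₀ hpos.ne'
    rw [h5]; ring
  have h6 : (1 - 2 * q * d') * ((B T).ncard : ℝ) ≤ (1 - 2 * q * S.card) * (B T).ncard := by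
    have := h.nonneg
    gcongr
  have h7 : (1 - 2 * q * d') * (({σ | σ w = b} ∩ B G).ncard : ℝ) ≤
      (1 - 2 * q * d') * (1 / 2 * (B T).ncard) :=
    mul_le_mul_of_nonneg_left (h2.trans h3.le) (by linarith)
  change (1 - 2 * q * d') * (({σ | σ w = b} ∩ B G).ncard : ℝ) ≤ 1 / 2 * ((B G).ncard : ℝ)
  linarith

end Fiber

lemma ncard_eq_sum_fibers {α β : Type*} [Fintype α] [Fintype β] (P : Set (α × β)) :
    P.ncard = ∑ b, {a | (a, b) ∈ P}.ncard := by
  classical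
  rw [Set.ncard_eq_toFinset_card', Finset.card_eq_sum_card_fiberwise (f := Prod.snd)
    (t := Finset.univ) (fun _ _ => Finset.mem_coe.2 (Finset.mem_univ _))]
  refine Finset.sum_congr rfl fun b _ => ?_
  rw [Set.ncard_eq_toFinset_card']
  refine Finset.card_bij' (fun p _ => p.1) (fun a _ => (a, b)) ?_ ?_ ?_ ?_
  · rintro ⟨a, b'⟩ h; simp at h ⊢; rw [← h.2]; exact h.1
  · intro a h; simp at h ⊢; exact h
  · rintro ⟨a, b'⟩ h; simp at h ⊢; exact h.2.symm
  · intro a _; rfl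

/-- A uniform assignment may be drawn independently inside and outside `A`; `ρ` is the part outside.
-/
lemma two_pow_mul_ncard (A : Finset (Fin n)) (S : Set (Assignment n)) :
    S.ncard * 2 ^ Fintype.card (Fin n) =
      ∑ ρ : Assignment n, {σ : Assignment n | A.piecewise σ ρ ∈ S}.ncard := by
  have h := ncard_swapOff_preimage A (S ×ˢ (Set.univ : Set (Assignment n)))
  rw [Set.ncard_prod, Set.ncard_univ, Nat.card_eq_fintype_card, Fintype.card_fun,
    Fintype.card_bool] at h
  rw [← h, ncard_eq_sum_fibers]
  refine Finset.sum_congr rfl fun ρ _ => ?_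
  congr 1
  ext σ
  simp [swapOff]

/-- The solutions that agree with `x` on `D`. -/
def solPin (Φ : Formula k n m) (D : Finset (Fin n)) (x : Assignment n) : Set (Assignment n) :=
  solutions Φ ∩ pinned D x

section Marginal

variable {Φ : Formula k n m} {G : Finset (Fin m)} {A Z D : Finset (Fin n)} {q d : ℝ}

/-- Clauses outside `G` do not meet `A`, so they stay satisfied while the local lemma repairs the
others by changes inside `A`, which leave `D` untouched. -/
theorem LocallySparse.solPin_nonempty (h : LocallySparse Φ G A Z q d) (hD : Disjoint D A)
    (hG : ∀ j ∉ G, Disjoint (vars (Φ j)) A) (x : Assignment n)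
    (hx : ∀ j ∉ G, Sat x (Φ j)) : (solPin Φ D x).Nonempty := by
  obtain ⟨σ, hσ⟩ := h.exists_sat x
  refine ⟨A.piecewise σ x, fun j => ?_, fun v hv => ?_⟩
  · by_cases hj : j ∈ G
    · exact hσ j hj
    · refine (hx j hj).congr fun v hv => ?_
      simp [Finset.disjoint_left.1 (hG j hj) hv]
  · simp [Finset.disjoint_left.1 hD hv]

/-- Local uniformity: the marginals of free variables are nearly uniform. -/
theorem LocallySparse.marginal_le (h : LocallySparse Φ G A Z q d) (hD : Disjoint D A)
    (hG : ∀ j ∉ G, Disjoint (vars (Φ j)) A) (x : Assignment n) {w : Fin n} (hw : w ∈ A)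
    (b : Bool) {d' : ℝ} (hd' : ((G.filter fun i => w ∈ vars (Φ i)).card : ℝ) ≤ d')
    (hq : 2 * q * d' ≤ 1) :
    (1 - 2 * q * d') * ((solPin Φ D x ∩ {σ | σ w = b}).ncard : ℝ) ≤
      1 / 2 * (solPin Φ D x).ncard := by
  have hpos : (0 : ℝ) < 2 ^ Fintype.card (Fin n) := by positivity
  refine le_of_mul_le_mul_right ?_ hpos
  rw [mul_assoc (1 - _), mul_assoc (1 / 2)]
  have e1 : ((solPin Φ D x ∩ {σ | σ w = b}).ncard : ℝ) * 2 ^ Fintype.card (Fin n) =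
      ∑ ρ : Assignment n,
        ({σ : Assignment n | A.piecewise σ ρ ∈ solPin Φ D x ∩ {σ | σ w = b}}.ncard : ℝ) := by
    exact_mod_cast two_pow_mul_ncard A (solPin Φ D x ∩ {σ | σ w = b})
  have e2 : ((solPin Φ D x).ncard : ℝ) * 2 ^ Fintype.card (Fin n) =
      ∑ ρ : Assignment n, ({σ : Assignment n | A.piecewise σ ρ ∈ solPin Φ D x}.ncard : ℝ) := by
    exact_mod_cast two_pow_mul_ncard A (solPin Φ D x)
  rw [e1, e2, Finset.mul_sum, Finset.mul_sum]
  refine Finset.sum_le_sum fun ρ _ => ?_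
  -- A fibre is empty unless `ρ` satisfies the clauses outside `G` and respects the pinning; then it
  -- is a local lemma instance on `A`.
  by_cases hρ : (∀ j ∉ G, Sat ρ (Φ j)) ∧ ρ ∈ pinned D x
  · have f1 : {σ : Assignment n | A.piecewise σ ρ ∈ solPin Φ D x} =
        {σ | ∀ j ∈ G, Sat (A.piecewise σ ρ) (Φ j)} := by
      ext σ
      refine ⟨fun hσ j _ => hσ.1 j, fun hσ => ⟨fun j => ?_, fun v hv => ?_⟩⟩
      · by_cases hj : j ∈ G
        · exact hσ j hj
        · refine (hρ.1 j hj).congr fun v hv => ?_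
          simp [Finset.disjoint_left.1 (hG j hj) hv]
      · simp [Finset.disjoint_left.1 hD hv, hρ.2 v hv]
    have f2 : {σ : Assignment n | A.piecewise σ ρ ∈ solPin Φ D x ∩ {σ | σ w = b}} =
        {σ | σ w = b} ∩ {σ | ∀ j ∈ G, Sat (A.piecewise σ ρ) (Φ j)} := by
      rw [← f1]
      ext σ
      simp only [Set.mem_ofPred_eq, Set.mem_inter_iff, Finset.piecewise_eq_of_mem _ _ _ hw]
      exact and_comm
    rw [f1, f2]
    exact h.coord_le ρ w b hd' hq
  · have f1 : {σ : Assignment n | A.piecewise σ ρ ∈ solPin Φ D x} = ∅ := by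
      rw [Set.eq_empty_iff_forall_notMem]
      intro σ hσ
      refine hρ ⟨fun j hj => ?_, fun v hv => ?_⟩
      · refine Sat.congr (fun v hv => ?_) (hσ.1 j)
        simp [Finset.disjoint_left.1 (hG j hj) hv]
      · have := hσ.2 v hv
        simpa [Finset.disjoint_left.1 hD hv] using this
    have f2 : {σ : Assignment n | A.piecewise σ ρ ∈ solPin Φ D x ∩ {σ | σ w = b}} = ∅ :=
      Set.subset_eq_empty (fun σ hσ => hσ.1) f1
    rw [f1, f2]
    simp

end Marginal

/-! ### Exploration of discrepancies and the coupling -/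

/-- The variables that occur in the clauses with index in `S`. -/
def varsOf (Φ : Formula k n m) (S : Finset (Fin m)) : Finset (Fin n) :=
  S.biUnion fun j => vars (Φ j)

lemma mem_varsOf {Φ : Formula k n m} {S : Finset (Fin m)} {v : Fin n} :
    v ∈ varsOf Φ S ↔ ∃ j ∈ S, v ∈ vars (Φ j) := Finset.mem_biUnion

lemma varsOf_insert (Φ : Formula k n m) (S : Finset (Fin m)) (j : Fin m) :
    varsOf Φ (insert j S) = vars (Φ j) ∪ varsOf Φ S := Finset.biUnion_insert

lemma card_varsOf_le (Φ : Formula k n m) (S : Finset (Fin m)) :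
    (varsOf Φ S).card ≤ k * S.card := by
  rw [mul_comm]
  exact Finset.card_biUnion_le_card_mul _ _ _ fun j _ => (card_vars (Φ j)).le

/-- Sets of clauses that are connected by shared variables. -/
inductive Conn (Φ : Formula k n m) : Finset (Fin m) → Prop
  | single (j : Fin m) : Conn Φ {j}
  | insert (S : Finset (Fin m)) (j : Fin m) : Conn Φ S → j ∉ S →
      ¬ Disjoint (vars (Φ j)) (varsOf Φ S) → Conn Φ (insert j S)

/-- The clause `j` is satisfied on `D` in the same way by `x` and `y`. -/
def AgreeSat (Φ : Formula k n m) (D : Finset (Fin n)) (x y : Assignment n) (j : Fin m) : Prop :=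
  ∃ l ∈ (Φ j).1, l.1 ∈ D ∧ x l.1 = l.2 ∧ y l.1 = l.2

/-- The clause `j` cannot be used to stop the spread of discrepancies. -/
def Failed (Φ : Formula k n m) (G : Finset (Fin m)) (R D : Finset (Fin n)) (x y : Assignment n)
    (j : Fin m) : Prop :=
  j ∉ G ∨ (vars (Φ j) ∩ R ⊆ D ∧ ¬ AgreeSat Φ D x y j)

/-- The variables to which a discrepancy at `u` may have spread. -/
inductive Reach (Φ : Formula k n m) (G : Finset (Fin m)) (R : Finset (Fin n)) (u : Fin n)
    (D : Finset (Fin n)) (x y : Assignment n) : Fin n → Prop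
  | base : Reach Φ G R u D x y u
  | disc (j : Fin m) (v w : Fin n) : Reach Φ G R u D x y v → v ∈ vars (Φ j) → w ∈ vars (Φ j) →
      w ∈ D → x w ≠ y w → Reach Φ G R u D x y w
  | fail (j : Fin m) (v w : Fin n) : Reach Φ G R u D x y v → v ∈ vars (Φ j) →
      Failed Φ G R D x y j → w ∈ vars (Φ j) → Reach Φ G R u D x y w

section Coupling

variable {Φ : Formula k n m} {G : Finset (Fin m)} {R D : Finset (Fin n)} {u : Fin n}
  {x y : Assignment n}

lemma AgreeSat.insert {j : Fin m} (h : AgreeSat Φ D x y j) {w : Fin n} (hw : w ∉ D) (b b' : Bool) :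
    AgreeSat Φ (insert w D) (Function.update x w b) (Function.update y w b') j := by
  obtain ⟨l, hl, hD, h1, h2⟩ := h
  have hne : l.1 ≠ w := fun he => hw (he ▸ hD)
  exact ⟨l, hl, Finset.mem_insert_of_mem hD, by simp [hne, h1], by simp [hne, h2]⟩

lemma agreeSat_insert_iff {j : Fin m} {w : Fin n} (hw : w ∉ D) (hj : w ∉ vars (Φ j)) (b b' : Bool) :
    AgreeSat Φ (insert w D) (Function.update x w b) (Function.update y w b') j ↔
      AgreeSat Φ D x y j := by
  refine ⟨?_, fun h => h.insert hw b b'⟩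
  rintro ⟨l, hl, hD, h1, h2⟩
  have hne : l.1 ≠ w := fun he => hj (he ▸ fst_mem_vars hl)
  rw [Function.update_of_ne hne] at h1 h2
  exact ⟨l, hl, (Finset.mem_insert.1 hD).resolve_left hne, h1, h2⟩

/-- A good clause that has failed has no unrevealed variable in `R`, so a later revelation cannot
rescue it. Hence the reached set only grows. -/
lemma Failed.insert {j : Fin m} (h : Failed Φ G R D x y j) {w : Fin n} (hw : w ∉ D) (hR : w ∈ R)
    (b b' : Bool) :
    Failed Φ G R (insert w D) (Function.update x w b) (Function.update y w b') j := by
  rcases h with h | ⟨h1, h2⟩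
  · exact Or.inl h
  · refine Or.inr ⟨h1.trans (Finset.subset_insert w D), ?_⟩
    rwa [agreeSat_insert_iff hw fun hj => hw (h1 (Finset.mem_inter.2 ⟨hj, hR⟩))]

lemma Reach.insert {v : Fin n} (h : Reach Φ G R u D x y v) {w : Fin n} (hw : w ∉ D) (hR : w ∈ R)
    (b b' : Bool) :
    Reach Φ G R u (insert w D) (Function.update x w b) (Function.update y w b') v := by
  induction h with
  | base => exact Reach.base
  | disc j v w' _ hv hw' hD hne ih =>
    have hww : w' ≠ w := fun he => hw (he ▸ hD)
    exact Reach.disc j v w' ih hv hw' (Finset.mem_insert_of_mem hD) (by simpa [hww] using hne)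
  | fail j v w' _ hv hf hw' ih => exact Reach.fail j v w' ih hv (hf.insert hw hR b b') hw'

/-- The only possible new disagreement is at `w`, which shares the clause `j` with a variable
already reached. -/
lemma reach_inv_insert (hinv : ∀ w ∈ D, x w ≠ y w → Reach Φ G R u D x y w) {j : Fin m} {v w : Fin n}
    (hv : Reach Φ G R u D x y v) (hvj : v ∈ vars (Φ j)) (hwj : w ∈ vars (Φ j)) (hw : w ∉ D)
    (hR : w ∈ R) (b b' : Bool) :
    ∀ w' ∈ insert w D, Function.update x w b w' ≠ Function.update y w b' w' →
      Reach Φ G R u (insert w D) (Function.update x w b) (Function.update y w b') w' := by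
  intro w' hw' hne
  rcases Finset.mem_insert.1 hw' with rfl | h
  · exact Reach.disc j v w' (hv.insert hw hR b b') hvj hwj hw' hne
  · have hww : w' ≠ w := fun he => hw (he ▸ h)
    exact (hinv w' h (by simpa [hww] using hne)).insert hw hR b b'

/-- When no clause is left to explore, the marginals agree outside the reached variables. -/
theorem marginal_eq_of_not_reach (hinv : ∀ w ∈ D, x w ≠ y w → Reach Φ G R u D x y w)
    (hterm : ∀ j ∈ G, ∀ v ∈ vars (Φ j), Reach Φ G R u D x y v → vars (Φ j) ∩ R ⊆ D ∨
      AgreeSat Φ D x y j)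
    {v : Fin n} (hv : ¬ Reach Φ G R u D x y v) (b : Bool) :
    (solPin Φ D x ∩ {σ | σ v = b}).ncard * (solPin Φ D y).ncard =
      (solPin Φ D x).ncard * (solPin Φ D y ∩ {σ | σ v = b}).ncard := by
  classical
  set I : Finset (Fin n) := Finset.univ.filter fun v => Reach Φ G R u D x y v with hI
  have hmem : ∀ v, v ∈ I ↔ Reach Φ G R u D x y v := fun v => by simp [hI]
  -- Gluing `σ₁` on `I` to `σ₂` off `I` violates no clause: a clause that meets `I` lies inside `I`
  -- or is satisfied on `D`. The pinnings agree off `I`.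
  have key : ∀ (x' y' : Assignment n), (∀ w ∈ D, w ∉ I → x' w = y' w) →
      (∀ j w, w ∈ vars (Φ j) → w ∈ I → (∀ v ∈ vars (Φ j), v ∈ I) ∨
        ∃ l ∈ (Φ j).1, l.1 ∈ D ∧ x' l.1 = l.2) →
      ∀ σ₁ ∈ solPin Φ D x', ∀ σ₂ ∈ solPin Φ D y', I.piecewise σ₁ σ₂ ∈ solPin Φ D x' := by
    intro x' y' hxy hcl σ₁ h1 σ₂ h2
    have hpin : I.piecewise σ₁ σ₂ ∈ pinned D x' := by
      intro w hw
      by_cases hwI : w ∈ I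
      · simpa [hwI] using h1.2 w hw
      · simpa [hwI, hxy w hw hwI] using h2.2 w hw
    refine ⟨fun j => ?_, hpin⟩
    by_cases ht : ∃ w ∈ vars (Φ j), w ∈ I
    · obtain ⟨w, hw, hwI⟩ := ht
      rcases hcl j w hw hwI with h | ⟨l, hl, hlD, hx⟩
      · exact Sat.congr (fun v hv => by simp [h v hv]) (h1.1 j)
      · exact ⟨l, hl, (hpin l.1 hlD).trans hx⟩
    · push Not at ht
      exact Sat.congr (fun v hv => by simp [ht v hv]) (h2.1 j)
  have hcl : ∀ j w, w ∈ vars (Φ j) → w ∈ I → (∀ v ∈ vars (Φ j), v ∈ I) ∨ AgreeSat Φ D x y j := by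
    intro j w hw hwI
    rw [hmem] at hwI
    by_cases hs : AgreeSat Φ D x y j
    · exact Or.inr hs
    · left
      have hf : Failed Φ G R D x y j := by
        by_cases hj : j ∈ G
        · exact Or.inr ⟨(hterm j hj w hw hwI).resolve_right hs, hs⟩
        · exact Or.inl hj
      exact fun v hv => (hmem v).2 (Reach.fail j w v hwI hw hf hv)
  have hagree : ∀ w ∈ D, w ∉ I → x w = y w := by
    intro w hw hwI
    by_contra hne
    exact hwI ((hmem w).2 (hinv w hw hne))
  have kx := key x y hagree (fun j w hw hwI => (hcl j w hw hwI).imp id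
    fun ⟨l, hl, hD, h1, _⟩ => ⟨l, hl, hD, h1⟩)
  have ky := key y x (fun w hw hwI => (hagree w hw hwI).symm)
    (fun j w hw hwI => (hcl j w hw hwI).imp id fun ⟨l, hl, hD, _, h2⟩ => ⟨l, hl, hD, h2⟩)
  have hvI : v ∉ I := fun h => hv ((hmem v).1 h)
  have h := ncard_swapOff_preimage I ((solPin Φ D x ∩ {σ | σ v = b}) ×ˢ solPin Φ D y)
  -- Exchanging the values off `I` preserves both pinned solution sets. As `v ∉ I`, it moves the
  -- event at `v` from the first copy to the second.
  have h2 : swapOff I ⁻¹' ((solPin Φ D x ∩ {σ | σ v = b}) ×ˢ solPin Φ D y) =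
      solPin Φ D x ×ˢ (solPin Φ D y ∩ {σ | σ v = b}) := by
    have hfwd : ∀ p ∈ solPin Φ D x ×ˢ solPin Φ D y, swapOff I p ∈ solPin Φ D x ×ˢ solPin Φ D y :=
      fun p hp => ⟨kx p.1 hp.1 p.2 hp.2, ky p.2 hp.2 p.1 hp.1⟩
    ext p
    constructor
    · rintro ⟨⟨h1, h2⟩, h3⟩
      have h4 := hfwd (swapOff I p) ⟨h1, h3⟩
      rw [swapOff_involutive I p] at h4
      refine ⟨h4.1, h4.2, ?_⟩
      simpa [swapOff, hvI] using h2
    · rintro ⟨h1, h2, h3⟩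
      have h4 := hfwd p ⟨h1, h2⟩
      refine ⟨⟨h4.1, ?_⟩, h4.2⟩
      simpa [swapOff, hvI] using h3
  rw [h2, Set.ncard_prod, Set.ncard_prod] at h
  exact h.symm

/-- The conditional marginal of `v` given the values of `x` on `D`. -/
noncomputable def marg (Φ : Formula k n m) (D : Finset (Fin n)) (x : Assignment n) (v : Fin n)
    (b : Bool) : ℝ :=
  ((solPin Φ D x ∩ {σ | σ v = b}).ncard : ℝ) / (solPin Φ D x).ncard

lemma marg_nonneg (Φ : Formula k n m) (D : Finset (Fin n)) (x : Assignment n) (v : Fin n)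
    (b : Bool) : 0 ≤ marg Φ D x v b := by unfold marg; positivity

lemma ncard_add_ncard (S : Set (Assignment n)) (v : Fin n) :
    (S ∩ {σ | σ v = true}).ncard + (S ∩ {σ | σ v = false}).ncard = S.ncard := by
  rw [← Set.ncard_inter_add_ncard_sdiff_eq_ncard S {σ | σ v = true} (Set.toFinite _)]
  congr 2
  ext σ
  simp [Set.mem_sdiff]

lemma marg_le_one (Φ : Formula k n m) (D : Finset (Fin n)) (x : Assignment n) (v : Fin n)
    (b : Bool) : marg Φ D x v b ≤ 1 := by
  refine div_le_one_of_le₀ ?_ (Nat.cast_nonneg _)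
  exact_mod_cast Set.ncard_le_ncard Set.inter_subset_left (Set.toFinite _)

lemma marg_add (hpos : (solPin Φ D x).Nonempty) (v : Fin n) :
    marg Φ D x v true + marg Φ D x v false = 1 := by
  have h : (0 : ℝ) < (solPin Φ D x).ncard := by
    exact_mod_cast (Set.ncard_pos (Set.toFinite _)).2 hpos
  unfold marg
  rw [← add_div, div_eq_one_iff_eq h.ne']
  exact_mod_cast ncard_add_ncard (solPin Φ D x) v

lemma solPin_insert {w : Fin n} (hw : w ∉ D) (b : Bool) :
    solPin Φ (insert w D) (Function.update x w b) = solPin Φ D x ∩ {σ | σ w = b} := by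
  ext σ
  simp only [solPin, pinned, Set.mem_inter_iff, Set.mem_ofPred_eq, Finset.forall_mem_insert,
    Function.update_self]
  have : (∀ v ∈ D, σ v = Function.update x w b v) ↔ ∀ v ∈ D, σ v = x v :=
    forall₂_congr fun v hv => by
      rw [Function.update_of_ne (fun he : v = w => hw (he ▸ hv))]
  rw [this]
  tauto

lemma marg_eq_sum {w : Fin n} (hw : w ∉ D) (hpos : ∀ b, (solPin Φ (insert w D)
    (Function.update x w b)).Nonempty) (v : Fin n) :
    marg Φ D x v true = ∑ b : Bool, marg Φ D x w b *
      marg Φ (insert w D) (Function.update x w b) v true := by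
  have hb : ∀ b, marg Φ D x w b * marg Φ (insert w D) (Function.update x w b) v true =
      ((solPin Φ D x ∩ {σ | σ v = true} ∩ {σ | σ w = b}).ncard : ℝ) / (solPin Φ D x).ncard := by
    intro b
    have h := hpos b
    unfold marg
    rw [solPin_insert hw] at h ⊢
    have h0 : ((solPin Φ D x ∩ {σ | σ w = b}).ncard : ℝ) ≠ 0 := by
      exact_mod_cast ((Set.ncard_pos (Set.toFinite _)).2 h).ne'
    rw [Set.inter_right_comm, div_mul_div_comm, mul_comm, mul_div_mul_right _ _ h0]
  rw [Fintype.sum_bool, hb, hb, ← add_div]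
  unfold marg
  congr 1
  exact_mod_cast (ncard_add_ncard _ w).symm

/-- A coupling of two distributions on `Bool`, as a matrix. -/
structure IsCoupling (q : Bool → Bool → ℝ) (ε p : ℝ) : Prop where
  nonneg : ∀ b b', 0 ≤ q b b'
  sum_eq : ∑ b, ∑ b', q b b' = 1
  disagree_le : q true false + q false true ≤ ε
  miss_le : ∀ c, 1 - q c c ≤ p

/-- The optimal coupling: mass `min a a'` on `(true, true)` and `1 - max a a'` on `(false, false)`.
Disagreement has mass `|a - a'| ≤ 2e`, and each agreement has mass at least `1/2 - e`. -/
lemma exists_coupling {a a' e : ℝ} (h0 : 0 ≤ a) (h1 : a ≤ 1) (h0' : 0 ≤ a') (h1' : a' ≤ 1)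
    (ha : a ≤ 1 / 2 + e) (hb : 1 - a ≤ 1 / 2 + e) (ha' : a' ≤ 1 / 2 + e)
    (hb' : 1 - a' ≤ 1 / 2 + e) :
    ∃ q : Bool → Bool → ℝ, IsCoupling q (2 * e) (1 / 2 + e) ∧
      q true true + q true false = a ∧ q false true + q false false = 1 - a ∧
      q true true + q false true = a' ∧ q true false + q false false = 1 - a' := by
  refine ⟨fun b b' => match b, b' with
    | true, true => min a a' | true, false => a - min a a'
    | false, true => a' - min a a' | false, false => 1 - max a a', ⟨?_, ?_, ?_, ?_⟩, ?_⟩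
  · rintro (_ | _) (_ | _) <;> simp [h0, h0', h1, h1']
  · simp only [Fintype.sum_bool]
    have := min_add_max a a'
    linarith
  · rcases le_total a a' with h | h <;> simp [h] <;> linarith
  · rintro (_ | _) <;> rcases le_total a a' with h | h <;> simp [h] <;> linarith
  · have := min_add_max a a'
    refine ⟨?_, ?_, ?_, ?_⟩ <;> simp only <;> linarith

/-- The total discrepancy of the marginals under two pinnings. -/
noncomputable def discrepancy (Φ : Formula k n m) (D : Finset (Fin n)) (x y : Assignment n) : ℝ :=
  ∑ v, |marg Φ D x v true - marg Φ D y v true|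

/-- Bound on the discrepancy by a potential that does not increase in expectation when
variables are revealed. -/
theorem discrepancy_le (D₀ : Finset (Fin n)) (P : Finset (Fin n) → Assignment n → Assignment n → ℝ)
    {e K : ℝ}
    (hpos : ∀ D x, D₀ ⊆ D → D ⊆ D₀ ∪ R → (solPin Φ D x).Nonempty)
    (hmarg : ∀ D x w b, D₀ ⊆ D → D ⊆ D₀ ∪ R → w ∈ R → w ∉ D → marg Φ D x w b ≤ 1 / 2 + e)
    (hP : ∀ D x y, 0 ≤ P D x y) (hK : 0 ≤ K)
    (hstep : ∀ D x y w (q : Bool → Bool → ℝ), w ∈ R → w ∉ D → IsCoupling q (2 * e) (1 / 2 + e) →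
      ∑ b, ∑ b', q b b' * P (insert w D) (Function.update x w b) (Function.update y w b') ≤ P D x y)
    (hend : ∀ D x y, (∀ w ∈ D, x w ≠ y w → w = u ∨ w ∈ R) → ({v | Reach Φ G R u D x y v}.ncard : ℝ) ≤ K ∨ 1 ≤ P D x y)
    (D : Finset (Fin n)) (x y : Assignment n) (hD : D₀ ⊆ D) (hD' : D ⊆ D₀ ∪ R)
    (hxy : ∀ w ∈ D, x w ≠ y w → w = u ∨ w ∈ R)
    (hinv : ∀ w ∈ D, x w ≠ y w → Reach Φ G R u D x y w) :
    discrepancy Φ D x y ≤ K + n * P D x y := by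
  classical
  induction hc : (D₀ ∪ R \ D).card using Nat.strong_induction_on generalizing D x y with
  | _ c ih =>
  by_cases hterm : ∀ j ∈ G, ∀ v ∈ vars (Φ j), Reach Φ G R u D x y v → vars (Φ j) ∩ R ⊆ D ∨
      AgreeSat Φ D x y j
  · have hle : ∀ v, |marg Φ D x v true - marg Φ D y v true| ≤ 1 := fun v => by
      have h1 := marg_nonneg Φ D x v true
      have h2 := marg_le_one Φ D x v true
      have h3 := marg_nonneg Φ D y v true
      have h4 := marg_le_one Φ D y v true
      rw [abs_le]
      constructor <;> linarith
    have hz : ∀ v, ¬ Reach Φ G R u D x y v → |marg Φ D x v true - marg Φ D y v true| = 0 := by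
      intro v hv
      have h := marginal_eq_of_not_reach hinv hterm hv true
      have h1 : ((solPin Φ D x).ncard : ℝ) ≠ 0 := by
        exact_mod_cast ((Set.ncard_pos (Set.toFinite _)).2 (hpos D x hD hD')).ne'
      have h2 : ((solPin Φ D y).ncard : ℝ) ≠ 0 := by
        exact_mod_cast ((Set.ncard_pos (Set.toFinite _)).2 (hpos D y hD hD')).ne'
      rw [abs_eq_zero, sub_eq_zero, marg, marg, div_eq_div_iff h1 h2]
      rw [mul_comm (((solPin Φ D y ∩ _).ncard : ℝ))]
      exact_mod_cast h
    -- A discrepancy never exceeds `n`, so a large reached set is paid for by `n` times a potential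
    -- of at least 1.
    rcases hend D x y hxy with h | h
    · have h1 : discrepancy Φ D x y ≤ ({v | Reach Φ G R u D x y v}.ncard : ℝ) := by
        unfold discrepancy
        rw [Set.ncard_eq_toFinset_card', Finset.card_eq_sum_ones, Nat.cast_sum]
        rw [← Finset.sum_subset (Finset.subset_univ {v | Reach Φ G R u D x y v}.toFinset)]
        · exact Finset.sum_le_sum fun v _ => by simpa using hle v
        · intro v _ hv
          exact hz v (by simpa using hv)
      have h2 : 0 ≤ n * P D x y := mul_nonneg (Nat.cast_nonneg _) (hP D x y)
      linarith
    · have h1 : discrepancy Φ D x y ≤ n := by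
        unfold discrepancy
        refine (Finset.sum_le_sum fun v _ => hle v).trans ?_
        simp
      have h2 : (n : ℝ) * 1 ≤ n * P D x y := mul_le_mul_of_nonneg_left h (Nat.cast_nonneg _)
      linarith
  · push Not at hterm
    -- The next variable is an unrevealed variable of `R` in a good clause that touches the reached
    -- set and is not yet satisfied in both copies.
    obtain ⟨j, _, v, hvj, hv, hnot, _⟩ := hterm
    obtain ⟨w, hw, hwD⟩ := Finset.not_subset.1 hnot
    obtain ⟨hwj, hwR⟩ := Finset.mem_inter.1 hw
    have hDw : D₀ ⊆ insert w D := hD.trans (Finset.subset_insert w D)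
    have hDw' : insert w D ⊆ D₀ ∪ R :=
      Finset.insert_subset (Finset.mem_union_right _ hwR) hD'
    have hlt : (D₀ ∪ R \ insert w D).card < c := by
      rw [← hc]
      apply Finset.card_lt_card
      rw [Finset.ssubset_iff_of_subset (Finset.union_subset_union_right
        (Finset.sdiff_subset_sdiff Finset.Subset.rfl (Finset.subset_insert w D)))]
      exact ⟨w, Finset.mem_union_right _ (Finset.mem_sdiff.2 ⟨hwR, hwD⟩), by
        simp only [Finset.mem_union, Finset.mem_sdiff, Finset.mem_insert, true_or, not_true,
          and_false, or_false]
        exact fun h => hwD (hD h)⟩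
    have hx1 := marg_add (hpos D x hD hD') w
    have hy1 := marg_add (hpos D y hD hD') w
    have m1 := hmarg D x w true hD hD' hwR hwD
    have m2 := hmarg D x w false hD hD' hwR hwD
    have m3 := hmarg D y w true hD hD' hwR hwD
    have m4 := hmarg D y w false hD hD' hwR hwD
    obtain ⟨q, hq, q1, q2, q3, q4⟩ := exists_coupling (marg_nonneg Φ D x w true)
      (marg_le_one Φ D x w true) (marg_nonneg Φ D y w true) (marg_le_one Φ D y w true)
      m1 (by linarith) m3 (by linarith)
    have hx2 : marg Φ D x w false = 1 - marg Φ D x w true := by linarith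
    have hy2 : marg Φ D y w false = 1 - marg Φ D y w true := by linarith
    have hdec : ∀ v', |marg Φ D x v' true - marg Φ D y v' true| ≤
        ∑ b, ∑ b', q b b' * |marg Φ (insert w D) (Function.update x w b) v' true -
          marg Φ (insert w D) (Function.update y w b') v' true| := by
      intro v'
      have e1 := marg_eq_sum (x := x) hwD (fun b => hpos _ _ hDw hDw') v'
      have e2 := marg_eq_sum (x := y) hwD (fun b => hpos _ _ hDw hDw') v'
      have e3 : marg Φ D x v' true - marg Φ D y v' true =
          ∑ b, ∑ b', q b b' * (marg Φ (insert w D) (Function.update x w b) v' true -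
          marg Φ (insert w D) (Function.update y w b') v' true) := by
        rw [e1, e2]
        simp only [Fintype.sum_bool]
        rw [hx2, hy2, ← q1, ← q3]
        rw [← q1] at q2
        rw [← q3] at q4
        linear_combination (-marg Φ (insert w D) (Function.update x w false) v' true) * q2 +
          (marg Φ (insert w D) (Function.update y w false) v' true) * q4
      rw [e3]
      refine (Finset.abs_sum_le_sum_abs _ _).trans (Finset.sum_le_sum fun b _ => ?_)
      refine (Finset.abs_sum_le_sum_abs _ _).trans (Finset.sum_le_sum fun b' _ => ?_)
      rw [abs_mul, abs_of_nonneg (hq.nonneg b b')]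
    have hsum : discrepancy Φ D x y ≤ ∑ b, ∑ b', q b b' *
        discrepancy Φ (insert w D) (Function.update x w b) (Function.update y w b') := by
      unfold discrepancy
      refine (Finset.sum_le_sum fun v' _ => hdec v').trans (le_of_eq ?_)
      rw [Finset.sum_comm]
      refine Finset.sum_congr rfl fun b _ => ?_
      rw [Finset.sum_comm]
      refine Finset.sum_congr rfl fun b' _ => ?_
      rw [Finset.mul_sum]
    have hih : ∀ b b', discrepancy Φ (insert w D) (Function.update x w b) (Function.update y w b') ≤
        K + n * P (insert w D) (Function.update x w b) (Function.update y w b') := fun b b' =>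
      ih _ hlt _ _ _ hDw hDw' (fun w' hw' hne => by
        rcases Finset.mem_insert.1 hw' with rfl | h
        · exact Or.inr hwR
        · have hww : w' ≠ w := fun he => hwD (he ▸ h)
          exact hxy w' h (by simpa [hww] using hne)) (reach_inv_insert hinv hv hvj hwj hwD hwR b b') rfl
    have hs := hstep D x y w q hwR hwD hq
    calc discrepancy Φ D x y ≤ _ := hsum
      _ ≤ ∑ b, ∑ b', q b b' *
          (K + n * P (insert w D) (Function.update x w b) (Function.update y w b')) :=
        Finset.sum_le_sum fun b _ => Finset.sum_le_sum fun b' _ =>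
          mul_le_mul_of_nonneg_left (hih b b') (hq.nonneg b b')
      _ = K * ∑ b, ∑ b', q b b' + n * ∑ b, ∑ b', q b b' *
          P (insert w D) (Function.update x w b) (Function.update y w b') := by
        simp only [Fintype.sum_bool]; ring
      _ ≤ K + n * P D x y := by
        rw [hq.sum_eq, mul_one]
        gcongr

end Coupling

/-! ### The potential of labelled connected sets -/

/-- The variables of the clause `j` in `R` that are in no other clause of `S`. -/
def privVars (Φ : Formula k n m) (R : Finset (Fin n)) (S : Finset (Fin m)) (j : Fin m) :
    Finset (Fin n) := (vars (Φ j) ∩ R) \ varsOf Φ (S.erase j)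

lemma notMem_vars_of_mem_privVars {Φ : Formula k n m} {R : Finset (Fin n)} {S : Finset (Fin m)}
    {j i : Fin m} {w : Fin n} (hw : w ∈ privVars Φ R S j) (hi : i ∈ S) (hij : i ≠ j) :
    w ∉ vars (Φ i) := fun h =>
  (Finset.mem_sdiff.1 hw).2 (mem_varsOf.2 ⟨i, Finset.mem_erase.2 ⟨hij, hi⟩, h⟩)

open scoped Classical in
/-- The contribution of the clause `j` to the potential of a labelled set `S` of clauses. -/
noncomputable def fac (Φ : Formula k n m) (G : Finset (Fin m)) (R : Finset (Fin n)) (ε p : ℝ)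
    (S : Finset (Fin m)) (D : Finset (Fin n)) (x y : Assignment n) (j : Fin m) :
    Option (Fin n) → ℝ
  | some w => if w ∈ D then (if x w ≠ y w then 1 else 0) else ε
  | none => if j ∈ G then
      (if AgreeSat Φ D x y j then 0 else p ^ (privVars Φ R S j \ D).card) else 1

/-- The potential of a labelled set of clauses. -/
noncomputable def pot (Φ : Formula k n m) (G : Finset (Fin m)) (R : Finset (Fin n)) (ε p : ℝ)
    (S : Finset (Fin m)) (g : Fin m → Option (Fin n)) (D : Finset (Fin n)) (x y : Assignment n) :
    ℝ := ∏ j ∈ S, fac Φ G R ε p S D x y j (g j)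

open Classical in
/-- The admissible labels of a set of clauses: a clause may be labelled by one of its variables
in `R`, and different clauses have different variables as labels. -/
noncomputable def labels (Φ : Formula k n m) (R : Finset (Fin n)) (S : Finset (Fin m)) :
    Finset (Fin m → Option (Fin n)) :=
  (Fintype.piFinset fun j => if j ∈ S then insert none ((vars (Φ j) ∩ R).image some) else {none}
    ).filter fun g => ∀ i j w, g i = some w → g j = some w → i = j

section Potential

variable {Φ : Formula k n m} {G : Finset (Fin m)} {R D : Finset (Fin n)} {u : Fin n}
  {x y : Assignment n} {ε p : ℝ} {S : Finset (Fin m)} {g : Fin m → Option (Fin n)}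

lemma mem_labels : g ∈ labels Φ R S ↔
    (∀ j w, g j = some w → j ∈ S ∧ w ∈ vars (Φ j) ∧ w ∈ R) ∧
      ∀ i j w, g i = some w → g j = some w → i = j := by
  unfold labels
  rw [Finset.mem_filter, Fintype.mem_piFinset]
  refine and_congr_left fun _ => ⟨fun h j w hg => ?_, fun h j => ?_⟩
  · have hj := h j
    rw [hg] at hj
    by_cases hS : j ∈ S
    · simp only [hS, if_true, Finset.mem_insert, reduceCtorEq, Finset.mem_image, Finset.mem_inter,
        Option.some.injEq, exists_eq_right, false_or] at hj
      exact ⟨hS, hj⟩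
    · simp [hS] at hj
  · cases hg : g j with
    | none => by_cases hS : j ∈ S <;> simp [hS]
    | some w =>
      obtain ⟨hS, h1, h2⟩ := h j w hg
      simp [hS, h1, h2]

lemma fac_nonneg (hε : 0 ≤ ε) (hp : 0 ≤ p) (j : Fin m) (a : Option (Fin n)) :
    0 ≤ fac Φ G R ε p S D x y j a := by
  cases a <;> unfold fac <;> split_ifs <;> positivity

lemma pot_nonneg (hε : 0 ≤ ε) (hp : 0 ≤ p) : 0 ≤ pot Φ G R ε p S g D x y :=
  Finset.prod_nonneg fun _ _ => fac_nonneg hε hp _ _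

/-- The clause `j` with label `a` is sensitive to the value of `w`. -/
def Sensitive (Φ : Formula k n m) (R : Finset (Fin n)) (S : Finset (Fin m)) (w : Fin n)
    (j : Fin m) (a : Option (Fin n)) : Prop :=
  a = some w ∨ (a = none ∧ w ∈ privVars Φ R S j)

/-- For an insensitive clause the number of unrevealed private variables is unchanged; the factor
can only drop to 0, when the new value satisfies the clause in both copies. -/
lemma fac_insert_le {w : Fin n} (hw : w ∉ D) {j : Fin m} {a : Option (Fin n)}
    (h : ¬ Sensitive Φ R S w j a) (hp : 0 ≤ p) (b b' : Bool) :
    fac Φ G R ε p S (insert w D) (Function.update x w b) (Function.update y w b') j a ≤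
      fac Φ G R ε p S D x y j a := by
  cases a with
  | some w' =>
    have hne : w' ≠ w := fun he => h (Or.inl (by rw [he]))
    simp [fac, hne]
  | none =>
    have hpr : w ∉ privVars Φ R S j := fun hw => h (Or.inr ⟨rfl, hw⟩)
    unfold fac
    by_cases hG : j ∈ G
    · rw [if_pos hG, if_pos hG]
      by_cases h1 : AgreeSat Φ D x y j
      · rw [if_pos h1, if_pos (h1.insert hw b b')]
      · rw [if_neg h1]
        have : privVars Φ R S j \ insert w D = privVars Φ R S j \ D := by
          rw [Finset.sdiff_insert, Finset.erase_eq_of_notMem]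
          exact fun h => hpr (Finset.mem_sdiff.1 h).1
        rw [this]
        split_ifs
        · positivity
        · exact le_rfl
    · rw [if_neg hG, if_neg hG]

-- For a label `w`, the weight `ε` becomes the probability of a disagreement. For a good unlabelled
-- clause, the two copies agree on the satisfying value with probability at least `1 - p`, which
-- kills the factor; otherwise the exponent drops by one.
open scoped Classical in
lemma sum_fac_insert_le {w : Fin n} (hw : w ∉ D) {j : Fin m} {a : Option (Fin n)}
    (h : Sensitive Φ R S w j a) (hp : 0 ≤ p) {q : Bool → Bool → ℝ} (hq : IsCoupling q ε p) :
    ∑ b, ∑ b', q b b' * fac Φ G R ε p S (insert w D) (Function.update x w b)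
      (Function.update y w b') j a ≤ fac Φ G R ε p S D x y j a := by
  rcases h with rfl | ⟨rfl, hpr⟩
  · simp only [fac, Finset.mem_insert_self, if_true, Function.update_self, hw, if_false,
      Fintype.sum_bool]
    simpa using hq.disagree_le
  · unfold fac
    by_cases hG : j ∈ G
    swap
    · simpa [hG] using hq.sum_eq.le
    simp only [hG, if_true]
    by_cases h1 : AgreeSat Φ D x y j
    · simp [h1, h1.insert hw]
    · rw [if_neg h1]
      have hwj : w ∈ vars (Φ j) := (Finset.mem_inter.1 (Finset.mem_sdiff.1 hpr).1).1
      obtain ⟨c, hc⟩ : ∃ c, (w, c) ∈ (Φ j).1 := mem_vars.1 hwj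
      have hsat : AgreeSat Φ (insert w D) (Function.update x w c) (Function.update y w c) j :=
        ⟨(w, c), hc, by simp, by simp, by simp⟩
      have hcard : (privVars Φ R S j \ D).card = (privVars Φ R S j \ insert w D).card + 1 := by
        rw [Finset.sdiff_insert, Finset.card_erase_add_one]
        exact Finset.mem_sdiff.2 ⟨hpr, hw⟩
      rw [hcard, pow_succ]
      set t := p ^ (privVars Φ R S j \ insert w D).card
      have ht : 0 ≤ t := by positivity
      have hterm : ∀ b b', q b b' * (if AgreeSat Φ (insert w D) (Function.update x w b)
          (Function.update y w b') j then 0 else t) ≤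
          t * (q b b' - if b = c ∧ b' = c then q c c else 0) := by
        intro b b'
        by_cases hb : b = c ∧ b' = c
        · obtain ⟨rfl, rfl⟩ := hb
          simp [hsat]
        · rw [if_neg hb, sub_zero, mul_comm]
          have := hq.nonneg b b'
          split_ifs
          · simp only [zero_mul]; positivity
          · exact le_rfl
      refine (Finset.sum_le_sum fun b _ => Finset.sum_le_sum fun b' _ => hterm b b').trans ?_
      have h2 : ∑ b, ∑ b', t * (q b b' - if b = c ∧ b' = c then q c c else 0) =
          t * (1 - q c c) := by
        rw [← hq.sum_eq]
        cases c <;> simp only [Fintype.sum_bool] <;> simp <;> ring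
      rw [h2]
      exact mul_le_mul_of_nonneg_left (hq.miss_le c) ht

/-- At most one clause is sensitive to `w`: labels are distinct, a label lies in its own clause, and
a private variable lies in no other clause of `S`. So only one factor has to be averaged. -/
lemma sum_pot_insert_le (hε : 0 ≤ ε) (hp : 0 ≤ p) (hg : g ∈ labels Φ R S) {w : Fin n} (hw : w ∉ D)
    {q : Bool → Bool → ℝ} (hq : IsCoupling q ε p) :
    ∑ b, ∑ b', q b b' * pot Φ G R ε p S g (insert w D) (Function.update x w b)
      (Function.update y w b') ≤ pot Φ G R ε p S g D x y := by
  rw [mem_labels] at hg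
  by_cases hsens : ∃ j ∈ S, Sensitive Φ R S w j (g j)
  · obtain ⟨j, hj, hs⟩ := hsens
    have hother : ∀ i ∈ S.erase j, ¬ Sensitive Φ R S w i (g i) := by
      intro i hi hs'
      obtain ⟨hij, hiS⟩ := Finset.mem_erase.1 hi
      rcases hs with hs | ⟨hs, hs2⟩ <;> rcases hs' with hs' | ⟨hs', hs2'⟩
      · exact hij (hg.2 i j w hs' hs)
      · exact notMem_vars_of_mem_privVars hs2' hj hij.symm (hg.1 j w hs).2.1
      · exact notMem_vars_of_mem_privVars hs2 hiS hij (hg.1 i w hs').2.1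
      · exact notMem_vars_of_mem_privVars hs2 hiS hij
          (Finset.mem_inter.1 (Finset.mem_sdiff.1 hs2').1).1
    have hle : ∀ b b', pot Φ G R ε p S g (insert w D) (Function.update x w b)
        (Function.update y w b') ≤ fac Φ G R ε p S (insert w D) (Function.update x w b)
        (Function.update y w b') j (g j) * ∏ i ∈ S.erase j, fac Φ G R ε p S D x y i (g i) := by
      intro b b'
      unfold pot
      rw [← Finset.mul_prod_erase S _ hj]
      refine mul_le_mul_of_nonneg_left ?_ (fac_nonneg hε hp _ _)
      exact Finset.prod_le_prod (fun i _ => fac_nonneg hε hp _ _)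
        fun i hi => fac_insert_le hw (hother i hi) hp b b'
    have hpr : 0 ≤ ∏ i ∈ S.erase j, fac Φ G R ε p S D x y i (g i) :=
      Finset.prod_nonneg fun _ _ => fac_nonneg hε hp _ _
    calc _ ≤ ∑ b, ∑ b', q b b' * (fac Φ G R ε p S (insert w D) (Function.update x w b)
        (Function.update y w b') j (g j) * ∏ i ∈ S.erase j, fac Φ G R ε p S D x y i (g i)) :=
          Finset.sum_le_sum fun b _ => Finset.sum_le_sum fun b' _ =>
            mul_le_mul_of_nonneg_left (hle b b') (hq.nonneg b b')
      _ = (∑ b, ∑ b', q b b' * fac Φ G R ε p S (insert w D) (Function.update x w b)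
        (Function.update y w b') j (g j)) * ∏ i ∈ S.erase j, fac Φ G R ε p S D x y i (g i) := by
          simp only [Fintype.sum_bool]; ring
      _ ≤ fac Φ G R ε p S D x y j (g j) * ∏ i ∈ S.erase j, fac Φ G R ε p S D x y i (g i) :=
          mul_le_mul_of_nonneg_right (sum_fac_insert_le hw hs hp hq) hpr
      _ = _ := Finset.mul_prod_erase S (fun i => fac Φ G R ε p S D x y i (g i)) hj
  · push Not at hsens
    calc _ ≤ ∑ b, ∑ b', q b b' * pot Φ G R ε p S g D x y :=
          Finset.sum_le_sum fun b _ => Finset.sum_le_sum fun b' _ =>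
            mul_le_mul_of_nonneg_left (Finset.prod_le_prod (fun i _ => fac_nonneg hε hp _ _)
              fun i hi => fac_insert_le hw (hsens i hi) hp b b') (hq.nonneg b b')
      _ = (∑ b, ∑ b', q b b') * pot Φ G R ε p S g D x y := by
          simp only [Fintype.sum_bool]; ring
      _ = _ := by rw [hq.sum_eq, one_mul]

/-- Labelled sets of clauses that witness the spread of discrepancies. -/
inductive Grow (Φ : Formula k n m) (G : Finset (Fin m)) (R : Finset (Fin n)) (u : Fin n)
    (D : Finset (Fin n)) (x y : Assignment n) : Finset (Fin m) → (Fin m → Option (Fin n)) → Prop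
  | empty : Grow Φ G R u D x y ∅ fun _ => none
  | full (S : Finset (Fin m)) (g : Fin m → Option (Fin n)) (j : Fin m) :
      Grow Φ G R u D x y S g → j ∉ S → ¬ Disjoint (vars (Φ j)) (insert u (varsOf Φ S)) →
      Failed Φ G R D x y j → Grow Φ G R u D x y (insert j S) g
  | disc (S : Finset (Fin m)) (g : Fin m → Option (Fin n)) (j : Fin m) (w : Fin n) :
      Grow Φ G R u D x y S g → j ∉ S → ¬ Disjoint (vars (Φ j)) (insert u (varsOf Φ S)) →
      w ∈ vars (Φ j) → w ∈ D → x w ≠ y w → w ∉ insert u (varsOf Φ S) →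
      Grow Φ G R u D x y (insert j S) (Function.update g j (some w))

lemma Grow.conn (h : Grow Φ G R u D x y S g) : S = ∅ ∨ (Conn Φ S ∧ u ∈ varsOf Φ S) := by
  have step : ∀ (S : Finset (Fin m)) (j : Fin m), (S = ∅ ∨ (Conn Φ S ∧ u ∈ varsOf Φ S)) → j ∉ S →
      ¬ Disjoint (vars (Φ j)) (insert u (varsOf Φ S)) →
      Conn Φ (insert j S) ∧ u ∈ varsOf Φ (insert j S) := by
    intro S j h hj hd
    rcases h with rfl | ⟨h1, h2⟩
    · refine ⟨Conn.single j, ?_⟩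
      simpa [varsOf] using hd
    · rw [Finset.insert_eq_of_mem h2] at hd
      exact ⟨Conn.insert S j h1 hj hd, by
        rw [varsOf_insert]; exact Finset.mem_union_right _ h2⟩
  induction h with
  | empty => exact Or.inl rfl
  | full S g j _ hj hd _ ih => exact Or.inr (step S j ih hj hd)
  | disc S g j w _ hj hd _ _ _ _ ih => exact Or.inr (step S j ih hj hd)

lemma Grow.eq_none (h : Grow Φ G R u D x y S g) {j : Fin m} (hj : j ∉ S) : g j = none := by
  induction h with
  | empty => rfl
  | full S g i _ _ _ _ ih => exact ih fun h => hj (Finset.mem_insert_of_mem h)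
  | disc S g i w _ _ _ _ _ _ _ ih =>
    have hne : j ≠ i := fun he => hj (he ▸ Finset.mem_insert_self i S)
    rw [Function.update_of_ne hne]
    exact ih fun h => hj (Finset.mem_insert_of_mem h)

lemma Grow.of_some (h : Grow Φ G R u D x y S g) {j : Fin m} {w : Fin n} (hg : g j = some w) :
    j ∈ S ∧ w ∈ vars (Φ j) ∧ w ∈ D ∧ x w ≠ y w ∧ w ≠ u := by
  induction h with
  | empty => cases hg
  | full S g i _ _ _ _ ih => exact ⟨Finset.mem_insert_of_mem (ih hg).1, (ih hg).2⟩
  | disc S g i w' _ _ _ h1 h2 h3 h4 ih =>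
    by_cases hji : j = i
    · subst hji
      rw [Function.update_self, Option.some.injEq] at hg
      subst hg
      exact ⟨Finset.mem_insert_self _ _, h1, h2, h3, fun he => h4 (by simp [he])⟩
    · rw [Function.update_of_ne hji] at hg
      exact ⟨Finset.mem_insert_of_mem (ih hg).1, (ih hg).2⟩

/-- A new label lies outside `varsOf Φ S`, while all earlier labels lie inside it. -/
lemma Grow.inj (h : Grow Φ G R u D x y S g) {i j : Fin m} {w : Fin n} (hi : g i = some w)
    (hj : g j = some w) : i = j := by
  induction h with
  | empty => cases hi
  | full S g i _ _ _ _ ih => exact ih hi hj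
  | disc S g c w' hG hc _ h1 h2 h3 h4 ih =>
    have hnew : ∀ i, g i = some w' → False := by
      intro i hi
      obtain ⟨h5, h6, _⟩ := hG.of_some hi
      exact h4 (Finset.mem_insert_of_mem (mem_varsOf.2 ⟨i, h5, h6⟩))
    by_cases hic : i = c <;> by_cases hjc : j = c
    · rw [hic, hjc]
    · subst hic
      rw [Function.update_self, Option.some.injEq] at hi
      rw [Function.update_of_ne hjc] at hj
      subst hi
      exact (hnew j hj).elim
    · subst hjc
      rw [Function.update_self, Option.some.injEq] at hj
      rw [Function.update_of_ne hic] at hi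
      subst hj
      exact (hnew i hi).elim
    · rw [Function.update_of_ne hic] at hi
      rw [Function.update_of_ne hjc] at hj
      exact ih hi hj

lemma Grow.failed (h : Grow Φ G R u D x y S g) {j : Fin m} (hj : j ∈ S) (hg : g j = none) :
    Failed Φ G R D x y j := by
  induction h with
  | empty => simp at hj
  | full S g i _ _ _ hf ih =>
    rcases Finset.mem_insert.1 hj with rfl | hj
    · exact hf
    · exact ih hj hg
  | disc S g i w _ _ _ _ _ _ _ ih =>
    have hne : j ≠ i := by
      rintro rfl
      simp at hg
    rw [Function.update_of_ne hne] at hg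
    exact ih ((Finset.mem_insert.1 hj).resolve_left hne) hg

lemma Grow.mem_labels (h : Grow Φ G R u D x y S g)
    (hxy : ∀ w ∈ D, x w ≠ y w → w = u ∨ w ∈ R) : g ∈ labels Φ R S := by
  rw [RandomCNF.mem_labels]
  refine ⟨fun j w hg => ?_, fun i j w hi hj => h.inj hi hj⟩
  obtain ⟨h1, h2, h3, h4, h5⟩ := h.of_some hg
  exact ⟨h1, h2, (hxy w h3 h4).resolve_left h5⟩

/-- Every factor is 1: labels are revealed disagreements, and a failed good clause has no unrevealed
private variable, so its exponent is 0. -/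
lemma Grow.one_le_pot (h : Grow Φ G R u D x y S g) : 1 ≤ pot Φ G R ε p S g D x y := by
  refine le_of_eq (Finset.prod_eq_one fun j hj => ?_).symm
  cases hg : g j with
  | some w =>
    obtain ⟨_, _, h3, h4, _⟩ := h.of_some hg
    simp [fac, h3, h4]
  | none =>
    by_cases hG : j ∈ G
    · rcases h.failed hj hg with hf | ⟨hf1, hf2⟩
      · exact (hf hG).elim
      · have : privVars Φ R S j \ D = ∅ :=
          Finset.sdiff_eq_empty_iff_subset.2 (Finset.sdiff_subset.trans hf1)
        simp [fac, hG, hf2, this]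
    · simp [fac, hG]

/-- If no clause can be added, `insert u (varsOf Φ S)` is closed under both rules that generate
`Reach`. -/
lemma Grow.extend (h : Grow Φ G R u D x y S g) {v : Fin n} (hv : Reach Φ G R u D x y v)
    (hvS : v ∉ insert u (varsOf Φ S)) :
    ∃ S' g', Grow Φ G R u D x y S' g' ∧ S'.card = S.card + 1 := by
  by_contra hno
  push Not at hno
  refine hvS ?_
  clear hvS
  have hnd : ∀ {v : Fin n} {j : Fin m}, v ∈ insert u (varsOf Φ S) → v ∈ vars (Φ j) →
      ¬ Disjoint (vars (Φ j)) (insert u (varsOf Φ S)) := fun h1 h2 hd =>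
    Finset.disjoint_left.1 hd h2 h1
  induction hv with
  | base => exact Finset.mem_insert_self _ _
  | disc j v w _ hv hw hD hne ih =>
    by_contra hwS
    have hj : j ∉ S := fun hj => hwS (Finset.mem_insert_of_mem (mem_varsOf.2 ⟨j, hj, hw⟩))
    exact hno _ _ (Grow.disc S g j w h hj (hnd ih hv) hw hD hne hwS) (Finset.card_insert_of_notMem hj)
  | fail j v w _ hv hf hw ih =>
    by_cases hj : j ∈ S
    · exact Finset.mem_insert_of_mem (mem_varsOf.2 ⟨j, hj, hw⟩)
    · exact (hno _ _ (Grow.full S g j h hj (hnd ih hv) hf) (Finset.card_insert_of_notMem hj)).elim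

theorem exists_grow_or_reach_small (L : ℕ) :
    (∃ S g, Grow Φ G R u D x y S g ∧ S.card = L) ∨
      {v | Reach Φ G R u D x y v}.ncard ≤ 1 + k * L := by
  induction L with
  | zero => exact Or.inl ⟨∅, _, Grow.empty, rfl⟩
  | succ L ih =>
    rcases ih with ⟨S, g, h, hc⟩ | h
    · by_cases hall : ∀ v, Reach Φ G R u D x y v → v ∈ insert u (varsOf Φ S)
      · right
        calc {v | Reach Φ G R u D x y v}.ncard ≤ ((insert u (varsOf Φ S) : Finset (Fin n)) :
              Set (Fin n)).ncard := Set.ncard_le_ncard (fun v hv => hall v hv) (Set.toFinite _)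
          _ = (insert u (varsOf Φ S)).card := Set.ncard_coe_finset _
          _ ≤ (varsOf Φ S).card + 1 := Finset.card_insert_le _ _
          _ ≤ k * S.card + 1 := by gcongr; exact card_varsOf_le Φ S
          _ ≤ 1 + k * (L + 1) := by rw [hc, mul_add]; omega
      · push Not at hall
        obtain ⟨v, hv, hvS⟩ := hall
        obtain ⟨S', g', h', hc'⟩ := h.extend hv hvS
        exact Or.inl ⟨S', g', h', by rw [hc', hc]⟩
    · right
      rw [mul_add]; omega

/-- Summing the initial potential over the labels. -/
lemma sum_pot_le {D₀ : Finset (Fin n)} (hε : 0 ≤ ε) (hp : 0 ≤ p) (hR : Disjoint D₀ R)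
    (hbad : ∀ j ∉ G, vars (Φ j) ∩ R = ∅) (S : Finset (Fin m)) :
    ∑ g ∈ labels Φ R S, pot Φ G R ε p S g D₀ x y ≤
      ∏ j ∈ S ∩ G, (k * ε + p ^ (privVars Φ R S j).card) := by
  classical
  set h : Fin m → Option (Fin n) → ℝ := fun j a => if j ∈ S then
    (match a with
      | some _ => ε
      | none => if j ∈ G then p ^ (privVars Φ R S j).card else 1) else 1 with hh
  have h0 : ∀ j a, 0 ≤ h j a := by
    intro j a
    rw [hh]
    cases a <;> simp only <;> split_ifs <;> positivity
  have h1 : ∀ g ∈ labels Φ R S, pot Φ G R ε p S g D₀ x y ≤ ∏ j, h j (g j) := by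
    intro g hg
    rw [mem_labels] at hg
    have : ∏ j, h j (g j) = ∏ j ∈ S, h j (g j) := by
      refine (Finset.prod_subset (Finset.subset_univ S) fun j _ hj => ?_).symm
      simp [hh, hj]
    rw [this]
    refine Finset.prod_le_prod (fun _ _ => fac_nonneg hε hp _ _) fun j hj => ?_
    cases hgj : g j with
    | some w =>
      have hw : w ∉ D₀ := fun hw => Finset.disjoint_left.1 hR hw (hg.1 j w hgj).2.2
      simp [fac, hh, hj, hw]
    | none =>
      simp only [fac, hh, hj, if_true]
      by_cases hG : j ∈ G
      · simp only [hG, if_true]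
        have : privVars Φ R S j \ D₀ = privVars Φ R S j := by
          rw [Finset.sdiff_eq_self_iff_disjoint]
          exact (Finset.disjoint_of_subset_right
            (Finset.sdiff_subset.trans Finset.inter_subset_right) hR).symm
        rw [this]
        split_ifs
        · positivity
        · exact le_rfl
      · simp [hG]
  calc ∑ g ∈ labels Φ R S, pot Φ G R ε p S g D₀ x y
      ≤ ∑ g ∈ labels Φ R S, ∏ j, h j (g j) := Finset.sum_le_sum h1
    -- Dropping the distinctness of labels makes the sum factor over clauses.
    _ ≤ ∑ g ∈ Fintype.piFinset fun j =>
        if j ∈ S then insert none ((vars (Φ j) ∩ R).image some) else {none}, ∏ j, h j (g j) :=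
      Finset.sum_le_sum_of_subset_of_nonneg (Finset.filter_subset _ _)
        fun _ _ _ => Finset.prod_nonneg fun _ _ => h0 _ _
    _ = ∏ j, ∑ a ∈ (if j ∈ S then insert none ((vars (Φ j) ∩ R).image some) else {none}),
        h j a := (Finset.prod_univ_sum _ _).symm
    _ ≤ ∏ j, (if j ∈ S ∩ G then (k * ε + p ^ (privVars Φ R S j).card) else 1) := by
      refine Finset.prod_le_prod (fun _ _ => Finset.sum_nonneg fun _ _ => h0 _ _) fun j _ => ?_
      by_cases hj : j ∈ S
      · rw [if_pos hj, Finset.sum_insert (by simp), Finset.sum_image (by simp)]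
        by_cases hG : j ∈ G
        · rw [if_pos (Finset.mem_inter.2 ⟨hj, hG⟩)]
          simp only [hh, hj, hG, if_true, Finset.sum_const, nsmul_eq_mul]
          have : ((vars (Φ j) ∩ R).card : ℝ) ≤ k := by
            exact_mod_cast (Finset.card_le_card Finset.inter_subset_left).trans
              (card_vars (Φ j)).le
          nlinarith
        -- A bad clause has no variable in `R`, so its only label is `none`, of weight 1.
        · have : j ∉ S ∩ G := fun h => hG (Finset.mem_inter.1 h).2
          rw [if_neg this, hbad j hG]
          simp [hh, hG]
      · have : j ∉ S ∩ G := fun h => hj (Finset.mem_inter.1 h).1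
        rw [if_neg hj, if_neg this]
        simp [hh, hj]
    _ = _ := by rw [Finset.prod_ite_mem, Finset.univ_inter]

/-- The connected sets of `L` clauses. -/
noncomputable def connSets (Φ : Formula k n m) (L : ℕ) : Finset (Finset (Fin m)) := by
  classical exact Finset.univ.filter fun S => Conn Φ S ∧ S.card = L

lemma mem_connSets {L : ℕ} : S ∈ connSets Φ L ↔ Conn Φ S ∧ S.card = L := by
  simp [connSets]

/-- Bound on the discrepancy caused by a single variable, in terms of connected sets. -/
theorem discrepancy_le_sum {D₀ : Finset (Fin n)} {e : ℝ} (he : 0 ≤ e) (L : ℕ) (hL : L ≠ 0)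
    (hR : Disjoint D₀ R) (hbad : ∀ j ∉ G, vars (Φ j) ∩ R = ∅)
    (hpos : ∀ D x, D₀ ⊆ D → D ⊆ D₀ ∪ R → (solPin Φ D x).Nonempty)
    (hmarg : ∀ D x w b, D₀ ⊆ D → D ⊆ D₀ ∪ R → w ∈ R → w ∉ D → marg Φ D x w b ≤ 1 / 2 + e)
    (hxy : ∀ w ∈ D₀, x w ≠ y w → w = u) :
    discrepancy Φ D₀ x y ≤ (1 + k * L) + n * ∑ S ∈ connSets Φ L,
      ∏ j ∈ S ∩ G, (k * (2 * e) + (1 / 2 + e) ^ (privVars Φ R S j).card) := by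
  have h := discrepancy_le (Φ := Φ) (G := G) (R := R) (u := u) D₀
    (fun D x y => ∑ S ∈ connSets Φ L, ∑ g ∈ labels Φ R S,
      pot Φ G R (2 * e) (1 / 2 + e) S g D x y) (e := e) (K := 1 + k * L) hpos hmarg
    (fun D x y => Finset.sum_nonneg fun S _ => Finset.sum_nonneg fun g _ =>
      pot_nonneg (by positivity) (by positivity)) (by positivity) ?_ ?_ D₀ x y Finset.Subset.rfl
    Finset.subset_union_left (fun w hw hne => Or.inl (hxy w hw hne))
    (fun w hw hne => by rw [hxy w hw hne]; exact Reach.base)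
  · refine h.trans ?_
    gcongr with S hS
    exact sum_pot_le (by positivity) (by positivity) hR hbad S
  · intro D x y w q _ hw hq
    simp only [Finset.mul_sum]
    have e1 : ∀ F : Bool → Bool → Finset (Fin m) → (Fin m → Option (Fin n)) → ℝ,
        ∑ b, ∑ b', ∑ S ∈ connSets Φ L, ∑ g ∈ labels Φ R S, F b b' S g =
        ∑ S ∈ connSets Φ L, ∑ g ∈ labels Φ R S, ∑ b, ∑ b', F b b' S g := by
      intro F
      simp only [Fintype.sum_bool, Finset.sum_add_distrib]
    rw [e1]
    exact Finset.sum_le_sum fun S _ => Finset.sum_le_sum fun g hg =>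
      sum_pot_insert_le (by positivity) (by positivity) hg hw hq
  · intro D x y hxy'
    rcases exists_grow_or_reach_small (Φ := Φ) (G := G) (R := R) (u := u) (D := D) (x := x)
      (y := y) L with ⟨S, g, hG, hc⟩ | hsmall
    · right
      have hS : S ∈ connSets Φ L := by
        rcases hG.conn with rfl | hconn
        · exact (hL (by simpa using hc.symm)).elim
        · exact mem_connSets.2 ⟨hconn.1, hc⟩
      have hp : ∀ S g, 0 ≤ pot Φ G R (2 * e) (1 / 2 + e) S g D x y := fun S g =>
        pot_nonneg (by positivity) (by positivity)
      calc (1 : ℝ) ≤ pot Φ G R (2 * e) (1 / 2 + e) S g D x y := hG.one_le_pot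
        _ ≤ ∑ g ∈ labels Φ R S, pot Φ G R (2 * e) (1 / 2 + e) S g D x y :=
          Finset.single_le_sum (f := fun g => pot Φ G R (2 * e) (1 / 2 + e) S g D x y)
            (fun g _ => hp S g) (hG.mem_labels hxy')
        _ ≤ _ := Finset.single_le_sum (f := fun S => ∑ g ∈ labels Φ R S,
            pot Φ G R (2 * e) (1 / 2 + e) S g D x y)
            (fun S _ => Finset.sum_nonneg fun g _ => hp S g) hS
    · left
      exact_mod_cast hsmall

end Potential

/-! ### Bad clauses, expansion and Hall's condition -/

section Bad

variable {ζ : ℝ} {Φ : Formula k n m}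

lemma badStage_mono (ζ : ℝ) (Φ : Formula k n m) : Monotone (badStage ζ Φ) :=
  monotone_nat_of_le_succ fun _ => Set.subset_union_left

lemma badStage_subset (ζ : ℝ) (Φ : Formula k n m) (i : ℕ) : badStage ζ Φ i ⊆ badVars ζ Φ :=
  Set.subset_iUnion (badStage ζ Φ) i

lemma heavyClauses_mono (ζ : ℝ) (Φ : Formula k n m) {S T : Set (Fin n)} (h : S ⊆ T) :
    heavyClauses ζ Φ S ⊆ heavyClauses ζ Φ T := by
  intro j hj
  refine le_trans (b := ((vbl (Φ j) ∩ S).ncard : ℝ)) hj ?_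
  exact_mod_cast Set.ncard_le_ncard (Set.inter_subset_inter_right _ h) (Set.toFinite _)

lemma exists_badStage_eq (ζ : ℝ) (Φ : Formula k n m) : ∃ i, badVars ζ Φ ⊆ badStage ζ Φ i := by
  have h : ∀ v ∈ badVars ζ Φ, ∃ i, v ∈ badStage ζ Φ i := fun v hv => Set.mem_iUnion.1 hv
  choose! f hf using h
  refine ⟨Finset.univ.sup f, fun v hv => badStage_mono ζ Φ ?_ (hf v hv)⟩
  exact Finset.le_sup (Finset.mem_univ v)

/-- The process stops at a finite stage, so a clause that is heavy for the final set is absorbed.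
Thus good and bad clauses interact only through bad variables, which lie outside every good marking.
-/
lemma vbl_subset_badVars {j : Fin m} (hj : j ∈ badClauses ζ Φ) : vbl (Φ j) ⊆ badVars ζ Φ := by
  obtain ⟨i, hi⟩ := exists_badStage_eq ζ Φ
  have h1 : j ∈ heavyClauses ζ Φ (badStage ζ Φ i) := heavyClauses_mono ζ Φ hi hj
  intro v hv
  exact badStage_subset ζ Φ (i + 1) (Or.inr (Set.mem_biUnion h1 hv))

lemma mem_goodClauses {j : Fin m} : j ∈ goodClauses ζ Φ ↔ j ∉ badClauses ζ Φ := Iff.rfl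

lemma degree_lt_of_mem_goodVars {v : Fin n} (hv : v ∈ goodVars ζ Φ) :
    (degree Φ v : ℝ) < degThreshold k n m := by
  by_contra h
  exact hv (badStage_subset ζ Φ 0 (not_lt.1 h))

lemma degree_eq_card (Φ : Formula k n m) (v : Fin n) :
    degree Φ v = (Finset.univ.filter fun j => v ∈ vars (Φ j)).card := by
  unfold degree
  rw [← Set.ncard_coe_finset]
  congr 1
  ext j
  simp [mem_vars]

open scoped Classical in
/-- The indices of the good clauses, as a finite set. -/
noncomputable def goodIdx (ζ : ℝ) (Φ : Formula k n m) : Finset (Fin m) :=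
  Finset.univ.filter fun j => j ∈ goodClauses ζ Φ

open scoped Classical in
/-- The indices of the bad clauses, as a finite set. -/
noncomputable def badIdx (ζ : ℝ) (Φ : Formula k n m) : Finset (Fin m) :=
  Finset.univ.filter fun j => j ∈ badClauses ζ Φ

open scoped Classical in
/-- The high degree variables, as a finite set. -/
noncomputable def highVars (Φ : Formula k n m) : Finset (Fin n) :=
  Finset.univ.filter fun v => v ∈ highDegree Φ

lemma mem_goodIdx {j : Fin m} : j ∈ goodIdx ζ Φ ↔ j ∈ goodClauses ζ Φ := by simp [goodIdx]

lemma mem_badIdx {j : Fin m} : j ∈ badIdx ζ Φ ↔ j ∈ badClauses ζ Φ := by simp [badIdx]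

lemma mem_highVars {v : Fin n} : v ∈ highVars Φ ↔ v ∈ highDegree Φ := by simp [highVars]

lemma notMem_goodIdx {j : Fin m} : j ∉ goodIdx ζ Φ ↔ j ∈ badIdx ζ Φ := by
  rw [mem_goodIdx, mem_badIdx, mem_goodClauses, not_not]

/-- Sets of clauses that are generated by the process that adds clauses with at least `c`
variables in the current set of variables. -/
inductive Gen (Φ : Formula k n m) (H : Finset (Fin n)) (c : ℝ) (𝒜 : Finset (Fin m)) :
    Finset (Fin m) → Prop
  | empty : Gen Φ H c 𝒜 ∅
  | insert (S : Finset (Fin m)) (j : Fin m) : Gen Φ H c 𝒜 S → j ∉ S → j ∈ 𝒜 →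
      c ≤ (vars (Φ j) ∩ (H ∪ varsOf Φ S)).card → Gen Φ H c 𝒜 (insert j S)

/-- Each added clause already has `c` variables in the current set and brings at most `k - c` new
ones. -/
lemma Gen.card_le {H : Finset (Fin n)} {c : ℝ} {𝒜 S : Finset (Fin m)} (h : Gen Φ H c 𝒜 S) :
    ((H ∪ varsOf Φ S).card : ℝ) ≤ H.card + (k - c) * S.card := by
  induction h with
  | empty => simp [varsOf]
  | insert S j _ hj _ hc ih =>
    rw [Finset.card_insert_of_notMem hj, varsOf_insert]
    have e1 : H ∪ (vars (Φ j) ∪ varsOf Φ S) =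
        (H ∪ varsOf Φ S) ∪ (vars (Φ j) \ (H ∪ varsOf Φ S)) := by
      rw [Finset.union_sdiff_self_eq_union]
      ext; simp only [Finset.mem_union]; tauto
    have e2 : ((vars (Φ j) \ (H ∪ varsOf Φ S)).card : ℝ) =
        k - (vars (Φ j) ∩ (H ∪ varsOf Φ S)).card := by
      have := Finset.card_sdiff_add_card_inter (vars (Φ j)) (H ∪ varsOf Φ S)
      rw [card_vars] at this
      rw [eq_sub_iff_add_eq]
      exact_mod_cast this
    have e3 := Finset.card_union_le (H ∪ varsOf Φ S) (vars (Φ j) \ (H ∪ varsOf Φ S))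
    have e4 : (((H ∪ varsOf Φ S) ∪ (vars (Φ j) \ (H ∪ varsOf Φ S))).card : ℝ) ≤
        (H ∪ varsOf Φ S).card + (vars (Φ j) \ (H ∪ varsOf Φ S)).card := by exact_mod_cast e3
    rw [e1]
    push_cast
    linarith

lemma Gen.subset {H : Finset (Fin n)} {c : ℝ} {𝒜 S : Finset (Fin m)} (h : Gen Φ H c 𝒜 S) :
    S ⊆ 𝒜 := by
  induction h with
  | empty => exact Finset.empty_subset _
  | insert S j _ _ hj _ ih => exact Finset.insert_subset hj ih

/-- Greedy generation, cut off at `B` clauses so that the generated set remains within the range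
where expansion applies. -/
lemma exists_gen (Φ : Formula k n m) (H : Finset (Fin n)) (c : ℝ) (𝒜 : Finset (Fin m)) (B : ℕ) :
    (∃ S, Gen Φ H c 𝒜 S ∧ S.card = B) ∨ (∃ S, Gen Φ H c 𝒜 S ∧ S.card < B ∧
      ∀ j ∈ 𝒜, c ≤ (vars (Φ j) ∩ (H ∪ varsOf Φ S)).card → j ∈ S) := by
  induction B with
  | zero => exact Or.inl ⟨∅, Gen.empty, rfl⟩
  | succ B ih =>
    rcases ih with ⟨S, h, hc⟩ | ⟨S, h, hc, hs⟩
    · by_cases hall : ∀ j ∈ 𝒜, c ≤ (vars (Φ j) ∩ (H ∪ varsOf Φ S)).card → j ∈ S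
      · exact Or.inr ⟨S, h, by omega, hall⟩
      · push Not at hall
        obtain ⟨j, hj, hc', hjS⟩ := hall
        exact Or.inl ⟨insert j S, Gen.insert S j h hjS hj hc', by
          rw [Finset.card_insert_of_notMem hjS, hc]⟩
    · exact Or.inr ⟨S, h, by omega, hs⟩

/-- `Φ` has no small set of clauses with few variables. -/
def Expands (Φ : Formula k n m) (κ E : ℝ) : Prop :=
  ∀ S : Finset (Fin m), (S.card : ℝ) ≤ E → (1 - κ) * k * S.card ≤ (varsOf Φ S).card

/-- Expansion demands `(1 - κ) k` variables per clause while generation supplies only `(1 - ζ) k`;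
the difference must come from `H`. -/
lemma Gen.card_le_of_expands {κ E : ℝ} (hE : Expands Φ κ E) {H : Finset (Fin n)}
    {𝒜 S : Finset (Fin m)} (h : Gen Φ H (ζ * k) 𝒜 S) (hS : (S.card : ℝ) ≤ E) :
    (ζ - κ) * k * S.card ≤ H.card := by
  have h1 := h.card_le
  have h2 := hE S hS
  have h3 : ((varsOf Φ S).card : ℝ) ≤ (H ∪ varsOf Φ S).card := by
    exact_mod_cast Finset.card_le_card Finset.subset_union_right
  nlinarith

lemma vbl_inter_ncard_le {j : Fin m} {B : Set (Fin n)} {W : Finset (Fin n)}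
    (h : ∀ v ∈ vars (Φ j), v ∈ B → v ∈ W) :
    ((vbl (Φ j) ∩ B).ncard : ℝ) ≤ (vars (Φ j) ∩ W).card := by
  rw [← Set.ncard_coe_finset]
  refine Nat.cast_le.2 (Set.ncard_le_ncard ?_ (Set.toFinite _))
  rintro v ⟨hv, hB⟩
  have hv' := mem_vars.2 hv
  exact Finset.mem_coe.2 (Finset.mem_inter.2 ⟨hv', h v hv' hB⟩)

/-- A saturated generated set contains all bad clauses of a closed set of clauses. -/
lemma badIdx_inter_subset {𝒜 S : Finset (Fin m)}
    (hclosed : ∀ j ∈ badIdx ζ Φ, ¬ Disjoint (vars (Φ j)) (varsOf Φ 𝒜) → j ∈ 𝒜)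
    (hsat : ∀ j ∈ 𝒜, ζ * k ≤
      (vars (Φ j) ∩ ((highVars Φ ∩ varsOf Φ 𝒜) ∪ varsOf Φ S)).card → j ∈ S) :
    badIdx ζ Φ ∩ 𝒜 ⊆ S := by
  have hst : ∀ i, ∀ v ∈ badStage ζ Φ i, v ∈ varsOf Φ 𝒜 →
      v ∈ (highVars Φ ∩ varsOf Φ 𝒜) ∪ varsOf Φ S := by
    intro i
    induction i with
    | zero =>
      intro v hv hA
      exact Finset.mem_union_left _ (Finset.mem_inter.2 ⟨mem_highVars.2 hv, hA⟩)
    | succ i ih =>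
      intro v hv hA
      rcases hv with hv | hv
      · exact ih v hv hA
      · obtain ⟨j, hj, hvj⟩ := Set.mem_iUnion₂.1 hv
        have hvj' := mem_vars.2 hvj
        have hbad : j ∈ badIdx ζ Φ :=
          mem_badIdx.2 (heavyClauses_mono ζ Φ (badStage_subset ζ Φ i) hj)
        have hjA : j ∈ 𝒜 := hclosed j hbad fun hd => Finset.disjoint_left.1 hd hvj' hA
        have hjS : j ∈ S := hsat j hjA (le_trans (b := ((vbl (Φ j) ∩ badStage ζ Φ i).ncard : ℝ)) hj
          (vbl_inter_ncard_le fun w hw hB => ih w hB (mem_varsOf.2 ⟨j, hjA, hw⟩)))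
        exact Finset.mem_union_right _ (mem_varsOf.2 ⟨j, hjS, hvj'⟩)
  obtain ⟨i, hi⟩ := exists_badStage_eq ζ Φ
  intro j hj
  obtain ⟨hbad, hjA⟩ := Finset.mem_inter.1 hj
  exact hsat j hjA (le_trans (b := ((vbl (Φ j) ∩ badVars ζ Φ).ncard : ℝ)) (mem_badIdx.1 hbad)
    (vbl_inter_ncard_le fun w hw hB => hst i w (hi hB) (mem_varsOf.2 ⟨j, hjA, hw⟩)))

lemma card_badIdx_lt {κ E : ℝ} (hE : Expands Φ κ E) {B : ℕ} (hB : (B : ℝ) ≤ E)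
    (hH : ((highVars Φ).card : ℝ) < (ζ - κ) * k * B) : (badIdx ζ Φ).card < B := by
  have hHle : ((highVars Φ ∩ varsOf Φ Finset.univ).card : ℝ) ≤ (highVars Φ).card := by
    exact_mod_cast Finset.card_le_card Finset.inter_subset_left
  rcases exists_gen Φ (highVars Φ ∩ varsOf Φ Finset.univ) (ζ * k) Finset.univ B with
    ⟨S, h, hc⟩ | ⟨S, _, hc, hs⟩
  · have := h.card_le_of_expands hE (by rw [hc]; exact hB)
    rw [hc] at this
    linarith
  · have := badIdx_inter_subset (ζ := ζ) (fun j _ _ => Finset.mem_univ j) hs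
    rw [Finset.inter_univ] at this
    exact (Finset.card_le_card this).trans_lt hc

/-- Since `𝒜` contains every bad clause that touches its variables, the bad process restricted to
`𝒜` is started by the high-degree variables inside `𝒜` alone. -/
lemma card_badIdx_inter_le {κ E : ℝ} (hE : Expands Φ κ E) (hζ : κ ≤ ζ) {𝒜 : Finset (Fin m)}
    (h𝒜 : (𝒜.card : ℝ) ≤ E)
    (hclosed : ∀ j ∈ badIdx ζ Φ, ¬ Disjoint (vars (Φ j)) (varsOf Φ 𝒜) → j ∈ 𝒜) :
    (ζ - κ) * k * (badIdx ζ Φ ∩ 𝒜).card ≤ (highVars Φ ∩ varsOf Φ 𝒜).card := by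
  rcases exists_gen Φ (highVars Φ ∩ varsOf Φ 𝒜) (ζ * k) 𝒜 (𝒜.card + 1) with
    ⟨S, h, hc⟩ | ⟨S, h, _, hs⟩
  · have := Finset.card_le_card h.subset
    omega
  · have h1 : ((badIdx ζ Φ ∩ 𝒜).card : ℝ) ≤ S.card := by
      exact_mod_cast Finset.card_le_card (badIdx_inter_subset hclosed hs)
    have h2 : (S.card : ℝ) ≤ E := le_trans (by exact_mod_cast Finset.card_le_card h.subset) h𝒜
    have h3 := h.card_le_of_expands hE h2
    have h4 : 0 ≤ (ζ - κ) * k := mul_nonneg (by linarith) (Nat.cast_nonneg _)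
    nlinarith

/-- Connected sets of clauses contain few bad clauses. -/
theorem card_good_ge {κ E δ : ℝ} (hE : Expands Φ κ E) (hζ : κ < ζ) (hk : 0 < k) {L B : ℕ}
    (hB : (badIdx ζ Φ).card ≤ B) (hLB : (L + B : ℝ) ≤ E)
    (hH : ∀ S, Conn Φ S → L ≤ S.card → (S.card : ℝ) ≤ E →
      ((highVars Φ ∩ varsOf Φ S).card : ℝ) ≤ δ * (ζ - κ) * k * S.card) (hδ : δ ≤ 1)
    {S : Finset (Fin m)} (hS : S ∈ connSets Φ L) :
    (1 - δ) * L ≤ (S ∩ goodIdx ζ Φ).card := by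
  classical
  obtain ⟨hconn, hcard⟩ := mem_connSets.1 hS
  -- Enlarge `S` by bad clauses to a largest connected set `T`; maximality makes `T` closed under
  -- bad clauses that touch it.
  set 𝒯 := Finset.univ.filter fun T : Finset (Fin m) =>
    Conn Φ T ∧ S ⊆ T ∧ T ⊆ S ∪ badIdx ζ Φ with h𝒯
  obtain ⟨T, hT, hmax⟩ := Finset.exists_max_image 𝒯 Finset.card
    ⟨S, by simp [h𝒯, hconn]⟩
  simp only [h𝒯, Finset.mem_filter, Finset.mem_univ, true_and] at hT hmax
  obtain ⟨hTc, hST, hTS⟩ := hT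
  have hclosed : ∀ j ∈ badIdx ζ Φ, ¬ Disjoint (vars (Φ j)) (varsOf Φ T) → j ∈ T := by
    intro j hj hd
    by_contra hjT
    have := hmax (insert j T) ⟨Conn.insert T j hTc hjT hd, hST.trans (Finset.subset_insert j T),
      Finset.insert_subset (Finset.mem_union_right _ hj) hTS⟩
    rw [Finset.card_insert_of_notMem hjT] at this
    omega
  have hTcard : T.card ≤ L + B := (Finset.card_le_card hTS).trans
    ((Finset.card_union_le _ _).trans (by omega))
  have hTE : (T.card : ℝ) ≤ E := le_trans (by exact_mod_cast hTcard) hLB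
  have hLT : L ≤ T.card := hcard ▸ Finset.card_le_card hST
  have h1 := card_badIdx_inter_le hE hζ.le hTE hclosed
  have h2 := hH T hTc hLT hTE
  have h3 : ((badIdx ζ Φ ∩ T).card : ℝ) ≤ δ * T.card := by
    have hpos : 0 < (ζ - κ) * k := mul_pos (by linarith) (by exact_mod_cast hk)
    nlinarith
  -- All clauses of `T` outside `S` are bad, so `S` contains every good clause of `T`.
  have h4 : T.card ≤ (S ∩ goodIdx ζ Φ).card + (badIdx ζ Φ ∩ T).card := by
    refine le_trans (Finset.card_le_card fun j hj => ?_) (Finset.card_union_le _ _)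
    by_cases hb : j ∈ badIdx ζ Φ
    · exact Finset.mem_union_right _ (Finset.mem_inter.2 ⟨hb, hj⟩)
    · refine Finset.mem_union_left _ (Finset.mem_inter.2
        ⟨(Finset.mem_union.1 (hTS hj)).resolve_right hb, ?_⟩)
      by_contra hg
      exact hb (notMem_goodIdx.1 hg)
  have h5 : (T.card : ℝ) ≤ (S ∩ goodIdx ζ Φ).card + (badIdx ζ Φ ∩ T).card := by exact_mod_cast h4
  have h6 : (L : ℝ) ≤ T.card := by exact_mod_cast hLT
  nlinarith

/-- A family of clauses with Hall's property is satisfiable. -/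
theorem exists_sat_of_hall {𝒜 : Finset (Fin m)} (h : ∀ S ⊆ 𝒜, S.card ≤ (varsOf Φ S).card) :
    ∃ β : Assignment n, ∀ j ∈ 𝒜, Sat β (Φ j) := by
  classical
  have hall := (Finset.all_card_le_biUnion_card_iff_exists_injective
    (fun j : {j // j ∈ 𝒜} => vars (Φ j.1))).1 (fun s => by
      have h1 := h (s.map (Function.Embedding.subtype _)) (fun j hj => by
        obtain ⟨a, _, rfl⟩ := Finset.mem_map.1 hj
        exact a.2)
      rw [Finset.card_map] at h1
      refine h1.trans (Finset.card_le_card fun v hv => ?_)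
      obtain ⟨j, hj, hvj⟩ := mem_varsOf.1 hv
      obtain ⟨a, ha, rfl⟩ := Finset.mem_map.1 hj
      exact Finset.mem_biUnion.2 ⟨a, ha, hvj⟩)
  obtain ⟨f, hinj, hf⟩ := hall
  have hlit : ∀ j : {j // j ∈ 𝒜}, ∃ b, (f j, b) ∈ (Φ j.1).1 := fun j => mem_vars.1 (hf j)
  choose b hb using hlit
  refine ⟨fun v => if hv : ∃ j, f j = v then b hv.choose else true, fun j hj => ?_⟩
  refine ⟨(f ⟨j, hj⟩, b ⟨j, hj⟩), hb _, ?_⟩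
  have hex : ∃ j', f j' = f ⟨j, hj⟩ := ⟨_, rfl⟩
  have : hex.choose = ⟨j, hj⟩ := hinj hex.choose_spec
  simp only [dif_pos hex, this]

end Bad

/-! ### Shared variables in expanding sets -/

section Overlap

variable {Φ : Formula k n m}

lemma sum_card_filter_mem_vars (Φ : Formula k n m) (S : Finset (Fin m)) :
    ∑ v ∈ varsOf Φ S, (S.filter fun j => v ∈ vars (Φ j)).card = k * S.card := by
  classical
  have : k * S.card = ∑ j ∈ S, (vars (Φ j)).card := by
    simp [card_vars, mul_comm]
  rw [this]
  simp_rw [Finset.card_eq_sum_ones, Finset.sum_filter]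
  rw [Finset.sum_comm]
  refine Finset.sum_congr rfl fun j hj => ?_
  rw [← Finset.sum_filter]
  congr 1
  ext v
  simp only [Finset.mem_filter]
  exact ⟨fun h => h.2, fun h => ⟨mem_varsOf.2 ⟨j, hj, h⟩, h⟩⟩

/-- A variable in `t ≥ 2` clauses of `S` is counted `t ≤ 2(t - 1)` times in the sum of overlaps, and
a variable in one clause not at all. -/
lemma sum_overlap_le (Φ : Formula k n m) (S : Finset (Fin m)) :
    ∑ j ∈ S, (vars (Φ j) ∩ varsOf Φ (S.erase j)).card + 2 * (varsOf Φ S).card ≤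
      2 * (k * S.card) := by
  classical
  have e1 : ∀ j ∈ S, (vars (Φ j) ∩ varsOf Φ (S.erase j)).card =
      ∑ v ∈ varsOf Φ S, if v ∈ vars (Φ j) ∩ varsOf Φ (S.erase j) then 1 else 0 := by
    intro j hj
    rw [Finset.card_eq_sum_ones, ← Finset.sum_filter]
    congr 1
    ext v
    simp only [Finset.mem_filter, Finset.mem_inter]
    exact ⟨fun h => ⟨mem_varsOf.2 ⟨j, hj, h.1⟩, h⟩, fun h => h.2⟩
  rw [Finset.sum_congr rfl e1, Finset.sum_comm, ← sum_card_filter_mem_vars Φ S,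
    Finset.card_eq_sum_ones, Finset.mul_sum,
    Finset.mul_sum, ← Finset.sum_add_distrib]
  refine Finset.sum_le_sum fun v hv => ?_
  rw [← Finset.sum_filter, ← Finset.card_eq_sum_ones, mul_one]
  obtain ⟨j, hj, hvj⟩ := mem_varsOf.1 hv
  have hjF : j ∈ S.filter fun j => v ∈ vars (Φ j) := Finset.mem_filter.2 ⟨hj, hvj⟩
  have hle : (S.filter fun i => v ∈ vars (Φ i) ∩ varsOf Φ (S.erase i)).card ≤
      (S.filter fun j => v ∈ vars (Φ j)).card :=
    Finset.card_le_card fun i hi => by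
      rw [Finset.mem_filter] at hi ⊢
      exact ⟨hi.1, (Finset.mem_inter.1 hi.2).1⟩
  rcases Nat.lt_or_ge (S.filter fun j => v ∈ vars (Φ j)).card 2 with h2 | h2
  · have h1 : (S.filter fun j => v ∈ vars (Φ j)).card ≤ 1 := by omega
    have h0 : S.filter (fun i => v ∈ vars (Φ i) ∩ varsOf Φ (S.erase i)) = ∅ := by
      rw [Finset.filter_eq_empty_iff]
      intro i hi hvi
      obtain ⟨h3, h4⟩ := Finset.mem_inter.1 hvi
      obtain ⟨i', hi', h5⟩ := mem_varsOf.1 h4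
      obtain ⟨hne, hi'S⟩ := Finset.mem_erase.1 hi'
      exact hne (Finset.card_le_one.1 h1 i' (Finset.mem_filter.2 ⟨hi'S, h5⟩) i
        (Finset.mem_filter.2 ⟨hi, h3⟩))
    have hpos : 0 < (S.filter fun j => v ∈ vars (Φ j)).card := Finset.card_pos.2 ⟨j, hjF⟩
    rw [h0, Finset.card_empty]
    omega
  · omega

lemma sum_overlap_le_of_expands {κ E : ℝ} (hE : Expands Φ κ E) {S : Finset (Fin m)}
    (hS : (S.card : ℝ) ≤ E) :
    ∑ j ∈ S, ((vars (Φ j) ∩ varsOf Φ (S.erase j)).card : ℝ) ≤ 2 * κ * k * S.card := by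
  have h1 := sum_overlap_le Φ S
  have h2 := hE S hS
  have h3 : ∑ j ∈ S, ((vars (Φ j) ∩ varsOf Φ (S.erase j)).card : ℝ) +
      2 * (varsOf Φ S).card ≤ 2 * (k * S.card) := by exact_mod_cast h1
  linarith

lemma card_privVars_add (R : Finset (Fin n)) (S : Finset (Fin m)) (j : Fin m) :
    (vars (Φ j) ∩ R).card ≤
      (privVars Φ R S j).card + (vars (Φ j) ∩ varsOf Φ (S.erase j)).card := by
  refine le_trans (Finset.card_le_card fun v hv => ?_) (Finset.card_union_le _ _)
  by_cases h : v ∈ varsOf Φ (S.erase j)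
  · exact Finset.mem_union_right _ (Finset.mem_inter.2 ⟨(Finset.mem_inter.1 hv).1, h⟩)
  · exact Finset.mem_union_left _ (Finset.mem_sdiff.2 ⟨hv, h⟩)

/-- The probability bound for a single connected set of clauses. -/
theorem prod_le_of_expands {κ E e r δ Q : ℝ} {L : ℕ} (hE : Expands Φ κ E)
    {S G : Finset (Fin m)} {R : Finset (Fin n)} (hSL : S.card = L) (hS : (S.card : ℝ) ≤ E)
    (he : 0 ≤ e) (he' : e ≤ 1 / 2) (hR : ∀ j ∈ G, r ≤ (vars (Φ j) ∩ R).card)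
    (hgood : (1 - δ) * L ≤ (S ∩ G).card)
    (hQ : k * (2 * e) + (1 / 2 + e) ^ r ≤ Q) (hQ1 : Q ≤ 1) :
    ∏ j ∈ S ∩ G, (k * (2 * e) + (1 / 2 + e) ^ (privVars Φ R S j).card) ≤
      Q ^ ((1 - δ) * L) * 2 ^ (2 * κ * k * L) := by
  set p : ℝ := 1 / 2 + e with hp
  have hp0 : 1 / 2 ≤ p := by linarith
  have hp1 : p ≤ 1 := by linarith
  have hpr : 0 < p ^ r := by positivity
  have hQ0 : 0 < Q := by
    have : (0 : ℝ) ≤ k * (2 * e) := by positivity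
    linarith
  have hterm : ∀ j ∈ S ∩ G, k * (2 * e) + p ^ (privVars Φ R S j).card ≤
      Q * 2 ^ ((vars (Φ j) ∩ varsOf Φ (S.erase j)).card : ℝ) := by
    intro j hj
    set o : ℝ := ((vars (Φ j) ∩ varsOf Φ (S.erase j)).card : ℝ) with ho
    have ho0 : 0 ≤ o := Nat.cast_nonneg _
    have h1 : r - o ≤ ((privVars Φ R S j).card : ℝ) := by
      have h2 := hR j (Finset.mem_inter.1 hj).2
      have h3 : ((vars (Φ j) ∩ R).card : ℝ) ≤ (privVars Φ R S j).card + o := by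
        rw [ho]; exact_mod_cast card_privVars_add R S j
      linarith
    -- As `p⁻¹ ≤ 2`, each shared variable costs at most a factor 2.
    have h2 : p ^ (privVars Φ R S j).card ≤ p ^ r * 2 ^ o := by
      rw [← Real.rpow_natCast]
      calc p ^ ((privVars Φ R S j).card : ℝ) ≤ p ^ (r - o) :=
            Real.rpow_le_rpow_of_exponent_ge (by linarith) hp1 h1
        _ = p ^ r * (p⁻¹) ^ o := by
            rw [Real.rpow_sub (by linarith), Real.inv_rpow (by linarith), div_eq_mul_inv]
        _ ≤ p ^ r * 2 ^ o := by
            refine mul_le_mul_of_nonneg_left (Real.rpow_le_rpow (by positivity) ?_ ho0) hpr.le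
            rw [inv_le_comm₀ (by linarith) (by norm_num)]
            linarith
    have h3 : (1 : ℝ) ≤ 2 ^ o := Real.one_le_rpow (by norm_num) ho0
    have h4 : (0 : ℝ) ≤ k * (2 * e) := by positivity
    nlinarith
  calc ∏ j ∈ S ∩ G, (k * (2 * e) + p ^ (privVars Φ R S j).card)
      ≤ ∏ j ∈ S ∩ G, Q * 2 ^ ((vars (Φ j) ∩ varsOf Φ (S.erase j)).card : ℝ) :=
        Finset.prod_le_prod (fun j _ => by positivity) hterm
    _ = Q ^ (S ∩ G).card * 2 ^ (∑ j ∈ S ∩ G, ((vars (Φ j) ∩ varsOf Φ (S.erase j)).card : ℝ)) := by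
        rw [Finset.prod_mul_distrib, Finset.prod_const, Real.rpow_sum_of_pos (by norm_num)]
    _ ≤ Q ^ ((1 - δ) * L) * 2 ^ (2 * κ * k * L) := by
        refine mul_le_mul ?_ ?_ (by positivity) (by positivity)
        · rw [← Real.rpow_natCast]
          exact Real.rpow_le_rpow_of_exponent_ge hQ0 hQ1 hgood
        · refine Real.rpow_le_rpow_of_exponent_le (by norm_num) ?_
          rw [← hSL]
          exact (Finset.sum_le_sum_of_subset_of_nonneg Finset.inter_subset_left
            fun _ _ _ => Nat.cast_nonneg _).trans (sum_overlap_le_of_expands hE hS)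

end Overlap

/-! ### Row sums of the influence matrix -/

section Spectral

variable {Φ : Formula k n m}

lemma condProb_eq_marg (Φ : Formula k n m) (Λ : Finset (Fin n)) (τ : Assignment n) {u v : Fin n}
    (hu : u ∉ Λ) (b : Bool) :
    condProb Φ {σ | σ v = true} ({σ | σ u = b} ∩ pinned Λ τ) =
      marg Φ (insert u Λ) (Function.update τ u b) v true := by
  have h1 : solutions Φ ∩ ({σ | σ u = b} ∩ pinned Λ τ) =
      solPin Φ (insert u Λ) (Function.update τ u b) := by
    rw [solPin_insert hu, solPin, Set.inter_assoc, Set.inter_comm (pinned Λ τ)]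
  have h2 : solutions Φ ∩ ({σ | σ v = true} ∩ ({σ | σ u = b} ∩ pinned Λ τ)) =
      solPin Φ (insert u Λ) (Function.update τ u b) ∩ {σ | σ v = true} := by
    rw [← h1]
    ext σ
    simp only [Set.mem_inter_iff]
    tauto
  unfold condProb solProb marg
  rw [h1, h2]
  -- Without solutions both sides are `0 / 0 = 0`.
  rcases eq_or_ne ((solutions Φ).ncard : ℝ) 0 with h | h
  · have h3 : solPin Φ (insert u Λ) (Function.update τ u b) = ∅ := by
      have : solutions Φ = ∅ := by
        rw [← Set.ncard_eq_zero (Set.toFinite _)]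
        exact_mod_cast h
      rw [solPin, this, Set.empty_inter]
    simp [h3]
  · rw [div_div_div_cancel_right₀ h]

/-- Gershgorin's theorem with zero diagonal; the row sum is then extended from `M \ Λ` to all
variables other than `u`. -/
lemma isSpectrallyIndependent_of_discrepancy_le {M : Finset (Fin n)} {η : ℝ}
    (h : ∀ Λ ⊆ M, ∀ u ∈ M \ Λ, ∀ τ : Assignment n,
      ∑ v ∈ Finset.univ.erase u, |marg Φ (insert u Λ) (Function.update τ u true) v true -
        marg Φ (insert u Λ) (Function.update τ u false) v true| ≤ η) :
    IsSpectrallyIndependent Φ M η := by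
  intro Λ hΛ τ lam hlam
  obtain ⟨u, hu⟩ := eigenvalue_mem_ball hlam
  have h0 : influenceMatrix Φ M Λ τ u u = 0 := by simp [influenceMatrix]
  rw [h0, mem_closedBall_zero_iff, Real.norm_eq_abs] at hu
  refine hu.trans ((le_trans ?_ (h Λ hΛ u.1 u.2 τ)))
  have hmem := (Finset.mem_sdiff.1 u.2).2
  have e1 : ∑ v ∈ Finset.univ.erase u, ‖influenceMatrix Φ M Λ τ u v‖ =
      ∑ v ∈ (Finset.univ.erase u).map (Function.Embedding.subtype (· ∈ M \ Λ)),
        |marg Φ (insert u.1 Λ) (Function.update τ u.1 true) v true -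
        marg Φ (insert u.1 Λ) (Function.update τ u.1 false) v true| := by
    rw [Finset.sum_map]
    refine Finset.sum_congr rfl fun v hv => ?_
    have hne : u ≠ v := (Finset.ne_of_mem_erase hv).symm
    simp only [influenceMatrix, Matrix.of_apply, hne, if_false, Real.norm_eq_abs,
      Function.Embedding.coe_subtype]
    rw [condProb_eq_marg Φ Λ τ hmem, condProb_eq_marg Φ Λ τ hmem]
  rw [e1]
  refine Finset.sum_le_sum_of_subset_of_nonneg ?_ fun _ _ _ => abs_nonneg _
  intro v hv
  obtain ⟨a, ha, rfl⟩ := Finset.mem_map.1 hv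
  refine Finset.mem_erase.2 ⟨fun he => Finset.ne_of_mem_erase ha (Subtype.ext he),
    Finset.mem_univ _⟩

end Spectral

/-! ### The conclusion for a fixed formula and marking -/

section Marking

variable {ζ γ : ℝ} {Φ : Formula k n m} {M : Finset (Fin n)}

open scoped Classical in
/-- The unmarked good variables. -/
noncomputable def freeVars (ζ : ℝ) (Φ : Formula k n m) (M : Finset (Fin n)) : Finset (Fin n) :=
  Finset.univ.filter fun v => v ∈ goodVars ζ Φ ∧ v ∉ M

lemma mem_freeVars {v : Fin n} : v ∈ freeVars ζ Φ M ↔ v ∈ goodVars ζ Φ ∧ v ∉ M := by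
  simp [freeVars]

lemma IsGoodMarking.le_card (h : IsGoodMarking γ ζ Φ M) {j : Fin m} (hj : j ∈ goodIdx ζ Φ) :
    γ * (1 - ζ) * k ≤ (vars (Φ j) ∩ freeVars ζ Φ M).card := by
  refine (h.2 j (mem_goodIdx.1 hj)).2.trans (le_of_eq ?_)
  rw [← Set.ncard_coe_finset]
  congr 2
  ext v
  simp only [Set.mem_sdiff, Set.mem_inter_iff, Finset.mem_coe, Finset.mem_inter, mem_vars,
    mem_freeVars]
  tauto

lemma disjoint_vars_of_notMem_goodIdx {A : Finset (Fin n)} (hA : ∀ v ∈ A, v ∈ goodVars ζ Φ)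
    {j : Fin m} (hj : j ∉ goodIdx ζ Φ) : Disjoint (vars (Φ j)) A :=
  Finset.disjoint_left.2 fun _ hv hvA =>
    hA _ hvA (vbl_subset_badVars (mem_badIdx.1 (notMem_goodIdx.1 hj)) (mem_vars.1 hv))

lemma card_filter_mem_le {G : Finset (Fin m)} {v : Fin n} (hv : v ∈ goodVars ζ Φ) :
    ((G.filter fun i => v ∈ vars (Φ i)).card : ℝ) ≤ degThreshold k n m := by
  refine le_trans ?_ (degree_lt_of_mem_goodVars hv).le
  rw [degree_eq_card]
  exact_mod_cast Finset.card_le_card (Finset.filter_subset_filter _ (Finset.subset_univ G))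

lemma degThreshold_nonneg (k n m : ℕ) : 0 ≤ degThreshold k n m := by
  unfold degThreshold; positivity

/-- A neighbour shares with `j` one of at most `k` good variables, each of degree below the
threshold. -/
lemma card_neighbors_le {G : Finset (Fin m)} {A : Finset (Fin n)}
    (hA : ∀ v ∈ A, v ∈ goodVars ζ Φ) (j : Fin m) :
    ((G.filter fun i => ¬ Disjoint (vars (Φ i) ∩ A) (vars (Φ j) ∩ A)).card : ℝ) ≤
      k * degThreshold k n m := by
  classical
  have hsub : (G.filter fun i => ¬ Disjoint (vars (Φ i) ∩ A) (vars (Φ j) ∩ A)) ⊆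
      (vars (Φ j) ∩ A).biUnion fun v => G.filter fun i => v ∈ vars (Φ i) := by
    intro i hi
    obtain ⟨hiG, hd⟩ := Finset.mem_filter.1 hi
    obtain ⟨v, h1, h2⟩ := Finset.not_disjoint_iff.1 hd
    exact Finset.mem_biUnion.2 ⟨v, h2, Finset.mem_filter.2 ⟨hiG, (Finset.mem_inter.1 h1).1⟩⟩
  have h1 : ((G.filter fun i => ¬ Disjoint (vars (Φ i) ∩ A) (vars (Φ j) ∩ A)).card : ℝ) ≤
      ∑ v ∈ vars (Φ j) ∩ A, ((G.filter fun i => v ∈ vars (Φ i)).card : ℝ) := by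
    exact_mod_cast (Finset.card_le_card hsub).trans Finset.card_biUnion_le
  refine h1.trans ((Finset.sum_le_card_nsmul _ _ (degThreshold k n m) fun v hv =>
    card_filter_mem_le (hA v (Finset.mem_inter.1 hv).2)).trans ?_)
  rw [nsmul_eq_mul]
  refine mul_le_mul_of_nonneg_right ?_ (degThreshold_nonneg k n m)
  exact_mod_cast (Finset.card_le_card Finset.inter_subset_left).trans (card_vars (Φ j)).le

lemma locallySparse_of_card {A Z : Finset (Fin n)} {r : ℝ} (hZA : Z ⊆ A)
    (hA : ∀ v ∈ A, v ∈ goodVars ζ Φ) (hr : ∀ j ∈ goodIdx ζ Φ, r ≤ (vars (Φ j) ∩ Z).card)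
    (h1 : 4 * (1 / 2 : ℝ) ^ r * (k * degThreshold k n m) ≤ 1) (h2 : 2 * (1 / 2 : ℝ) ^ r < 1) :
    LocallySparse Φ (goodIdx ζ Φ) A Z ((1 / 2 : ℝ) ^ r) (k * degThreshold k n m) where
  subset := hZA
  nonneg := by positivity
  four_mul_le := h1
  lt_one := h2
  prob_le j hj := by
    rw [← Real.rpow_natCast]
    exact Real.rpow_le_rpow_of_exponent_ge (by norm_num) (by norm_num) (hr j hj)
  degree_le j _ := card_neighbors_le hA j

/-- Every pinning of good variables outside a set of free variables that meets every good clause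
in many variables extends to a solution. -/
lemma solPin_nonempty_of_badSat {D Z : Finset (Fin n)} {q d : ℝ}
    (hls : LocallySparse Φ (goodIdx ζ Φ) Z Z q d) (hZ : ∀ v ∈ Z, v ∈ goodVars ζ Φ)
    (hD : ∀ v ∈ D, v ∈ goodVars ζ Φ) (hDZ : Disjoint D Z)
    (hβ : ∃ β : Assignment n, ∀ j ∈ badIdx ζ Φ, Sat β (Φ j)) (x : Assignment n) :
    (solPin Φ D x).Nonempty := by
  obtain ⟨β, hβ⟩ := hβ
  have h := hls.solPin_nonempty hDZ (fun j hj => disjoint_vars_of_notMem_goodIdx hZ hj)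
    (D.piecewise x β) (fun j hj => by
      have hdis := disjoint_vars_of_notMem_goodIdx hD hj
      refine Sat.congr (fun v hv => ?_) (hβ j (notMem_goodIdx.1 hj))
      simp [Finset.disjoint_left.1 hdis hv])
  have he : pinned D x = pinned D (D.piecewise x β) := by
    ext σ
    exact forall₂_congr fun v hv => by rw [Finset.piecewise_eq_of_mem _ _ _ hv]
  rwa [solPin, he]

lemma hasFullSupport_of_nonempty (h : ∀ τ, (solPin Φ M τ).Nonempty) : HasFullSupport Φ M := by
  intro τ
  have h1 := h τ
  have h2 : (solutions Φ).Nonempty := h1.mono Set.inter_subset_left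
  unfold solProb
  have h3 := (Set.ncard_pos (Set.toFinite _)).2 h1
  have h4 := (Set.ncard_pos (Set.toFinite _)).2 h2
  unfold solPin at h3
  positivity

/-- When all variables of clauses have high degree, the good variables are independent. -/
theorem conclusion_of_degThreshold_le_one (hζ : ζ ≤ 1) (hΔ : degThreshold k n m ≤ 1) {κ E η : ℝ}
    (hE : Expands Φ κ E) (hmE : (m : ℝ) ≤ E) (hκ : 1 ≤ (1 - κ) * k) (hη : 0 ≤ η)
    (hM : IsGoodMarking γ ζ Φ M) : HasFullSupport Φ M ∧ IsSpectrallyIndependent Φ M η := by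
  have hhigh : ∀ j, ∀ v ∈ vars (Φ j), v ∈ highDegree Φ := by
    intro j v hv
    refine hΔ.trans ?_
    rw [degree_eq_card]
    exact_mod_cast Finset.card_pos.2 ⟨j, Finset.mem_filter.2 ⟨Finset.mem_univ j, hv⟩⟩
  have hbad : ∀ j, j ∈ badIdx ζ Φ := by
    intro j
    rw [mem_badIdx]
    have h1 : vbl (Φ j) ∩ badVars ζ Φ = (vars (Φ j) : Set (Fin n)) := by
      rw [coe_vars, Set.inter_eq_left]
      exact fun v hv => badStage_subset ζ Φ 0 (hhigh j v (mem_vars.2 hv))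
    change ζ * k ≤ _
    rw [h1, Set.ncard_coe_finset, card_vars]
    exact mul_le_of_le_one_left (Nat.cast_nonneg k) hζ
  have hgood : goodIdx ζ Φ = ∅ := by
    rw [Finset.eq_empty_iff_forall_notMem]
    exact fun j => notMem_goodIdx.2 (hbad j)
  have hls : LocallySparse Φ (goodIdx ζ Φ) ∅ ∅ 0 0 := by
    rw [hgood]
    exact ⟨Finset.Subset.rfl, le_rfl, by norm_num, by norm_num, by simp, by simp⟩
  have hsat : ∃ β : Assignment n, ∀ j ∈ badIdx ζ Φ, Sat β (Φ j) := by
    refine exists_sat_of_hall fun S _ => ?_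
    have h1 : (S.card : ℝ) ≤ m := by
      exact_mod_cast (Finset.card_le_univ S).trans (by simp)
    have h2 := hE S (h1.trans hmE)
    have h3 : (S.card : ℝ) ≤ (varsOf Φ S).card := by
      have : (0 : ℝ) ≤ S.card := Nat.cast_nonneg _
      nlinarith
    exact_mod_cast h3
  have hne : ∀ D : Finset (Fin n), (∀ v ∈ D, v ∈ goodVars ζ Φ) → ∀ x, (solPin Φ D x).Nonempty :=
    fun D hD x => solPin_nonempty_of_badSat hls (by simp) hD (by simp) hsat x
  refine ⟨hasFullSupport_of_nonempty fun τ => hne M (fun v hv => hM.1 hv) τ, ?_⟩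
  refine isSpectrallyIndependent_of_discrepancy_le fun Λ hΛ u hu τ => ?_
  obtain ⟨huM, huΛ⟩ := Finset.mem_sdiff.1 hu
  have hug := hM.1 huM
  have hnot : ∀ j, u ∉ vars (Φ j) := fun j hj => hug (badStage_subset ζ Φ 0 (hhigh j u hj))
  have hD : ∀ v ∈ insert u Λ, v ∈ goodVars ζ Φ := fun v hv => by
    rcases Finset.mem_insert.1 hv with rfl | h
    · exact hug
    · exact hM.1 (hΛ h)
  -- No clause contains the good variable `u`, so a discrepancy at `u` cannot spread.
  have hreach : ∀ v, Reach Φ ∅ ∅ u (insert u Λ) (Function.update τ u true)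
      (Function.update τ u false) v → v = u := by
    intro v hv
    induction hv with
    | base => rfl
    | disc j v w _ hv _ _ _ ih => exact (hnot j (ih ▸ hv)).elim
    | fail j v w _ hv _ _ ih => exact (hnot j (ih ▸ hv)).elim
  refine (Finset.sum_eq_zero fun v hv => ?_).le.trans hη
  have h := marginal_eq_of_not_reach (Φ := Φ) (G := ∅) (R := ∅) (D := insert u Λ) (u := u)
    (x := Function.update τ u true) (y := Function.update τ u false)
    (fun w hw hne => by
      by_cases hwu : w = u
      · rw [hwu]; exact Reach.base
      · simp [hwu] at hne)
    (by simp) (fun hr => Finset.ne_of_mem_erase hv (hreach v hr)) true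
  have h1 : ((solPin Φ (insert u Λ) (Function.update τ u true)).ncard : ℝ) ≠ 0 := by
    exact_mod_cast ((Set.ncard_pos (Set.toFinite _)).2 (hne _ hD _)).ne'
  have h2 : ((solPin Φ (insert u Λ) (Function.update τ u false)).ncard : ℝ) ≠ 0 := by
    exact_mod_cast ((Set.ncard_pos (Set.toFinite _)).2 (hne _ hD _)).ne'
  rw [abs_eq_zero, sub_eq_zero, marg, marg, div_eq_div_iff h1 h2,
    mul_comm ((_ ∩ _ : Set (Assignment n)).ncard : ℝ) ((solPin Φ (insert u Λ)
      (Function.update τ u true)).ncard : ℝ)]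
  exact_mod_cast h

/-- The conclusion for formulas with the typical properties. -/
theorem conclusion_of_typical {κ E δ Q N s : ℝ} {L B : ℕ} (hζ : κ < ζ)
    (hE : Expands Φ κ E) (hκ : 1 ≤ (1 - κ) * k) (hL : L ≠ 0) (hLB : (L + B : ℝ) ≤ E)
    (hhigh : ((highVars Φ).card : ℝ) < (ζ - κ) * k * B)
    (hH : ∀ S, Conn Φ S → L ≤ S.card → (S.card : ℝ) ≤ E →
      ((highVars Φ ∩ varsOf Φ S).card : ℝ) ≤ δ * (ζ - κ) * k * S.card) (hδ : δ ≤ 1)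
    (hN : ((connSets Φ L).card : ℝ) ≤ N)
    (hM : IsGoodMarking γ ζ Φ M) (hs : s = γ * (1 - ζ) * k) (hs0 : 0 ≤ s)
    (h1 : 8 * (2 : ℝ) ^ (-(s / 6)) * (k * degThreshold k n m) ≤ 1)
    (h2 : 4 * (2 : ℝ) ^ (-(s / 6)) < 1)
    (hQ : k * (2 * (2 * (1 / 2 : ℝ) ^ (s / 4) * degThreshold k n m)) +
      (1 / 2 + 2 * (1 / 2 : ℝ) ^ (s / 4) * degThreshold k n m) ^ (s / 4) ≤ Q) (hQ1 : Q ≤ 1) :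
    HasFullSupport Φ M ∧ IsSpectrallyIndependent Φ M
      ((1 + k * L) + n * (N * (Q ^ ((1 - δ) * L) * 2 ^ (2 * κ * k * L)))) := by
  set Δ := degThreshold k n m with hΔ
  have hΔ0 : 0 ≤ Δ := degThreshold_nonneg k n m
  have hk : 0 < k := by
    rcases Nat.eq_zero_or_pos k with h | h
    · rw [h] at hκ; norm_num at hκ
    · exact h
  have hk1 : (1 : ℝ) ≤ k := by exact_mod_cast hk
  have hq_le : (1 / 2 : ℝ) ^ (s / 4) ≤ 2 ^ (-(s / 6)) := by
    rw [one_div, Real.inv_rpow (by norm_num), ← Real.rpow_neg (by norm_num)]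
    exact Real.rpow_le_rpow_of_exponent_le (by norm_num) (by linarith)
  set q : ℝ := (1 / 2 : ℝ) ^ (s / 4) with hq
  have hq0 : 0 < q := by positivity
  have hkΔ : 0 ≤ k * Δ := by positivity
  have h1' : 8 * q * (k * Δ) ≤ 1 := le_trans (by gcongr) h1
  have h2' : 2 * q < 1 := by linarith
  have hqΔ : 8 * q * Δ ≤ 1 :=
    le_trans (mul_le_mul_of_nonneg_left (le_mul_of_one_le_left hΔ0 hk1) (by positivity)) h1'
  set e : ℝ := 2 * q * Δ with he
  have he0 : 0 ≤ e := by positivity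
  -- The free variables in `R'` are revealed by the coupling; the others are reserved for the local
  -- lemma.
  obtain ⟨R', hR'⟩ := exists_balanced (fun j => vars (Φ j) ∩ freeVars ζ Φ M) (goodIdx ζ Φ) hs0
    (fun j hj => hs ▸ hM.le_card hj)
    (fun j _ => card_neighbors_le (fun v hv => (mem_freeVars.1 hv).1) j) h1 h2
  set R := freeVars ζ Φ M ∩ R' with hR
  set Z := freeVars ζ Φ M \ R' with hZ
  have hZg : ∀ v ∈ Z, v ∈ goodVars ζ Φ := fun v hv =>
    (mem_freeVars.1 (Finset.mem_sdiff.1 hv).1).1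
  have hRg : ∀ v ∈ R, v ∈ goodVars ζ Φ := fun v hv =>
    (mem_freeVars.1 (Finset.mem_inter.1 hv).1).1
  have hRM : ∀ v ∈ R, v ∉ M := fun v hv => (mem_freeVars.1 (Finset.mem_inter.1 hv).1).2
  have hRcard : ∀ j ∈ goodIdx ζ Φ, s / 4 ≤ (vars (Φ j) ∩ R).card := by
    intro j hj
    have := (hR' j hj).1
    rwa [Finset.inter_assoc] at this
  have hZcard : ∀ j ∈ goodIdx ζ Φ, s / 4 ≤ (vars (Φ j) ∩ Z).card := by
    intro j hj
    have := (hR' j hj).2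
    rwa [Finset.inter_sdiff_assoc] at this
  -- Violation probabilities are bounded through `Z` alone, so `A` may be larger: `A = Z` gives
  -- extensions of pinnings, and `A = insert w Z` gives the marginal of `w`.
  have hls : ∀ A, Z ⊆ A → (∀ v ∈ A, v ∈ goodVars ζ Φ) →
      LocallySparse Φ (goodIdx ζ Φ) A Z q (k * Δ) := fun A hZA hA =>
    locallySparse_of_card hZA hA hZcard (by linarith) h2'
  have hbadE : ((badIdx ζ Φ).card : ℝ) ≤ E := by
    have hBE : (B : ℝ) ≤ E := by
      have : (0 : ℝ) ≤ L := Nat.cast_nonneg _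
      linarith
    refine le_trans ?_ hBE
    exact_mod_cast (card_badIdx_lt hE hBE hhigh).le
  have hbadB : (badIdx ζ Φ).card ≤ B := by
    refine (card_badIdx_lt hE ?_ hhigh).le
    have : (0 : ℝ) ≤ L := Nat.cast_nonneg _
    linarith
  have hsat : ∃ β : Assignment n, ∀ j ∈ badIdx ζ Φ, Sat β (Φ j) := by
    refine exists_sat_of_hall fun S hS => ?_
    have h3 := hE S (le_trans (by exact_mod_cast Finset.card_le_card hS) hbadE)
    have h4 : (S.card : ℝ) ≤ (varsOf Φ S).card := by
      have : (0 : ℝ) ≤ S.card := Nat.cast_nonneg _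
      nlinarith
    exact_mod_cast h4
  have hne : ∀ D : Finset (Fin n), (∀ v ∈ D, v ∈ goodVars ζ Φ) → Disjoint D Z →
      ∀ x, (solPin Φ D x).Nonempty := fun D hD hDZ x =>
    solPin_nonempty_of_badSat (hls Z Finset.Subset.rfl hZg) hZg hD hDZ hsat x
  have hMZ : Disjoint M Z := Finset.disjoint_left.2 fun v hv hvZ =>
    (mem_freeVars.1 (Finset.mem_sdiff.1 hvZ).1).2 hv
  have hRZ : Disjoint R Z := Finset.disjoint_left.2 fun v hv hvZ =>
    (Finset.mem_sdiff.1 hvZ).2 (Finset.mem_inter.1 hv).2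
  refine ⟨hasFullSupport_of_nonempty fun τ => hne M (fun v hv => hM.1 hv) hMZ τ, ?_⟩
  refine isSpectrallyIndependent_of_discrepancy_le fun Λ hΛ u hu τ => ?_
  obtain ⟨huM, huΛ⟩ := Finset.mem_sdiff.1 hu
  have hD₀M : insert u Λ ⊆ M := Finset.insert_subset huM hΛ
  have hDg : ∀ D, D ⊆ insert u Λ ∪ R → ∀ v ∈ D, v ∈ goodVars ζ Φ := fun D hD v hv => by
    rcases Finset.mem_union.1 (hD hv) with h | h
    · exact hM.1 (hD₀M h)
    · exact hRg v h
  have hDZ : ∀ D, D ⊆ insert u Λ ∪ R → Disjoint D Z := fun D hD =>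
    Finset.disjoint_of_subset_left hD (Finset.disjoint_union_left.2
      ⟨Finset.disjoint_of_subset_left hD₀M hMZ, hRZ⟩)
  have hdisc := discrepancy_le_sum (Φ := Φ) (G := goodIdx ζ Φ) (R := R) (u := u)
    (x := Function.update τ u true) (y := Function.update τ u false) (D₀ := insert u Λ) he0 L hL
    (Finset.disjoint_left.2 fun v hv hvR => hRM v hvR (hD₀M hv))
    (fun j hj => Finset.disjoint_iff_inter_eq_empty.1 (disjoint_vars_of_notMem_goodIdx hRg hj))
    (fun D x _ hD => hne D (hDg D hD) (hDZ D hD) x)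
    (fun D x w b _ hD hw hwD => by
      have hwg := hRg w hw
      have hA : ∀ v ∈ insert w Z, v ∈ goodVars ζ Φ := fun v hv => by
        rcases Finset.mem_insert.1 hv with rfl | h
        · exact hwg
        · exact hZg v h
      have hm := (hls (insert w Z) (Finset.subset_insert w Z) hA).marginal_le (D := D)
        (Finset.disjoint_insert_right.2 ⟨hwD, hDZ D hD⟩)
        (fun j hj => disjoint_vars_of_notMem_goodIdx hA hj) x (Finset.mem_insert_self w Z) b
        (card_filter_mem_le hwg) (by linarith)
      have hpos : (0 : ℝ) < (solPin Φ D x).ncard := by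
        exact_mod_cast (Set.ncard_pos (Set.toFinite _)).2 (hne D (hDg D hD) (hDZ D hD) x)
      unfold marg
      rw [div_le_iff₀ hpos]
      -- Valid as `e ≤ 1/4`; it turns the bound `1 / (2(1 - e))` into `1/2 + e`.
      have h3 : (1 : ℝ) ≤ (1 - e) * (1 + 2 * e) := by nlinarith
      have h4 : (0 : ℝ) ≤ (solPin Φ D x ∩ {σ | σ w = b}).ncard := Nat.cast_nonneg _
      have h5 : (0 : ℝ) ≤ 1 + 2 * e := by linarith
      have h6 := mul_le_mul_of_nonneg_left hm h5
      nlinarith)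
    (fun w hw hne => by
      by_contra hwu
      simp [hwu] at hne)
  have hsum : ∑ S ∈ connSets Φ L, ∏ j ∈ S ∩ goodIdx ζ Φ,
      (k * (2 * e) + (1 / 2 + e) ^ (privVars Φ R S j).card) ≤
      N * (Q ^ ((1 - δ) * L) * 2 ^ (2 * κ * k * L)) := by
    have hQ0 : 0 ≤ Q := le_trans (by positivity) hQ
    refine (Finset.sum_le_card_nsmul _ _ (Q ^ ((1 - δ) * L) * 2 ^ (2 * κ * k * L))
      fun S hS => ?_).trans ?_
    · have hSL := (mem_connSets.1 hS).2
      refine prod_le_of_expands hE hSL ?_ he0 (by linarith) hRcard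
        (card_good_ge hE hζ hk hbadB hLB hH hδ hS) hQ hQ1
      rw [hSL]
      have : (0 : ℝ) ≤ B := Nat.cast_nonneg _
      linarith
    · rw [nsmul_eq_mul]
      exact mul_le_mul_of_nonneg_right hN (by positivity)
  refine le_trans (Finset.sum_le_sum_of_subset_of_nonneg (Finset.erase_subset _ _)
    fun _ _ _ => abs_nonneg _) (hdisc.trans ?_)
  gcongr

end Marking

/-! ### Counting clauses -/

section ClauseCount

lemma descFactorial_mul_pow_le {r n : ℕ} (h : r ≤ n) (k : ℕ) :
    r.descFactorial k * n ^ k ≤ n.descFactorial k * r ^ k := by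
  induction k with
  | zero => simp
  | succ k ih =>
    rw [Nat.descFactorial_succ, Nat.descFactorial_succ, pow_succ, pow_succ]
    have h1 : (r - k) * n ≤ (n - k) * r := by
      rw [Nat.sub_mul, Nat.sub_mul, mul_comm n r]
      exact Nat.sub_le_sub_left (Nat.mul_le_mul_left k h) _
    calc (r - k) * r.descFactorial k * (n ^ k * n) = ((r - k) * n) * (r.descFactorial k * n ^ k) := by
          ring
      _ ≤ ((n - k) * r) * (n.descFactorial k * r ^ k) := Nat.mul_le_mul h1 ih
      _ = _ := by ring

lemma choose_mul_pow_le {r n : ℕ} (h : r ≤ n) (k : ℕ) :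
    r.choose k * n ^ k ≤ n.choose k * r ^ k := by
  have h1 := descFactorial_mul_pow_le h k
  rw [Nat.descFactorial_eq_factorial_mul_choose, Nat.descFactorial_eq_factorial_mul_choose,
    mul_assoc, mul_assoc] at h1
  exact Nat.le_of_mul_le_mul_left h1 (Nat.factorial_pos k)

lemma choose_div_le {r n : ℕ} (h : r ≤ n) (k : ℕ) (hk : k ≤ n) :
    (r.choose k : ℝ) / n.choose k ≤ ((r : ℝ) / n) ^ k := by
  have h1 : (0 : ℝ) < n.choose k := by exact_mod_cast Nat.choose_pos hk
  rcases Nat.eq_zero_or_pos n with h0 | h0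
  · subst h0
    simp at hk h
    subst hk; simp
  rw [div_pow, div_le_div_iff₀ h1 (by positivity), mul_comm ((r : ℝ) ^ k)]
  exact_mod_cast choose_mul_pow_le h k

/-- The sign patterns on `W` correspond to the subsets of positive variables. -/
lemma card_vars_eq (W : Finset (Fin n)) (hW : W.card = k) :
    (Finset.univ.filter fun c : KClause k n => vars c = W).card = 2 ^ k := by
  classical
  have hpow : 2 ^ k = W.powerset.card := by rw [Finset.card_powerset, hW]
  rw [hpow]
  symm
  have himg : ∀ T : Finset (Fin n), (W.image fun v => (v, decide (v ∈ T))).image Prod.fst = W := by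
    intro T
    rw [Finset.image_image]
    exact (Finset.image_congr fun v _ => rfl).trans Finset.image_id
  refine Finset.card_bij (fun T _ => (⟨W.image fun v => (v, decide (v ∈ T)), ?_, ?_⟩ : KClause k n))
    ?_ ?_ ?_
  · rw [Finset.card_image_of_injective, hW]
    intro a b h
    exact (Prod.ext_iff.1 h).1
  · rw [himg, hW]
  · intro T _
    rw [Finset.mem_filter]
    exact ⟨Finset.mem_univ _, himg T⟩
  · intro T hT T' hT' h
    have h' : (W.image fun v => (v, decide (v ∈ T))) = W.image fun v => (v, decide (v ∈ T')) :=
      congrArg Subtype.val h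
    have key : ∀ T T' : Finset (Fin n), T ⊆ W → (W.image fun v => (v, decide (v ∈ T))) =
        (W.image fun v => (v, decide (v ∈ T'))) → T ⊆ T' := by
      intro T T' hT h v hv
      have h1 : (v, true) ∈ W.image fun v => (v, decide (v ∈ T)) :=
        Finset.mem_image.2 ⟨v, hT hv, by simp [hv]⟩
      rw [h] at h1
      obtain ⟨w, _, hw⟩ := Finset.mem_image.1 h1
      obtain ⟨hw1, hw2⟩ := Prod.ext_iff.1 hw
      simp only at hw1 hw2
      subst hw1
      simpa using hw2
    exact Finset.Subset.antisymm (key T T' (Finset.mem_powerset.1 hT) h')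
      (key T' T (Finset.mem_powerset.1 hT') h'.symm)
  · intro c hc
    have hcW : vars c = W := (Finset.mem_filter.1 hc).2
    have hinj : Set.InjOn Prod.fst (c.1 : Set (Fin n × Bool)) := by
      rw [← Finset.card_image_iff, c.2.1]
      exact c.2.2
    refine ⟨W.filter fun v => (v, true) ∈ c.1, Finset.mem_powerset.2 (Finset.filter_subset _ _), ?_⟩
    apply Subtype.ext
    have hmem : ∀ v, v ∈ W → (v, decide (v ∈ W.filter fun v => (v, true) ∈ c.1)) ∈ c.1 := by
      intro v hv
      obtain ⟨b, hb⟩ := mem_vars.1 (hcW.symm ▸ hv : v ∈ vars c)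
      by_cases ht : (v, true) ∈ c.1
      · simp [hv, ht]
      · have : b = false := by
          cases b
          · rfl
          · exact (ht hb).elim
        subst this
        simpa [hv, ht] using hb
    refine Finset.eq_of_subset_of_card_le ?_ ?_
    · intro l hl
      obtain ⟨v, hv, rfl⟩ := Finset.mem_image.1 hl
      exact hmem v hv
    · rw [c.2.1, Finset.card_image_of_injective, hW]
      intro a b h
      exact (Prod.ext_iff.1 h).1

lemma card_filter_vars (P : Finset (Fin n) → Prop) [DecidablePred P] :
    (Finset.univ.filter fun c : KClause k n => P (vars c)).card =
      ((Finset.powersetCard k (Finset.univ : Finset (Fin n))).filter P).card * 2 ^ k := by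
  classical
  rw [Finset.card_eq_sum_card_fiberwise (f := vars)
    (t := (Finset.powersetCard k (Finset.univ : Finset (Fin n))).filter P)]
  · rw [Finset.sum_congr rfl (g := fun _ => 2 ^ k), Finset.sum_const, smul_eq_mul]
    intro W hW
    obtain ⟨h1, h2⟩ := Finset.mem_filter.1 hW
    rw [← card_vars_eq W (Finset.mem_powersetCard.1 h1).2, Finset.filter_filter]
    congr 1
    ext c
    simp only [Finset.mem_filter, Finset.mem_univ, true_and]
    exact ⟨fun h => h.2, fun h => ⟨h ▸ h2, h⟩⟩
  · intro c hc
    have hc' := (Finset.mem_filter.1 (Finset.mem_coe.1 hc)).2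
    exact Finset.mem_coe.2 (Finset.mem_filter.2
      ⟨Finset.mem_powersetCard.2 ⟨Finset.subset_univ _, card_vars c⟩, hc'⟩)

lemma card_kClause (k n : ℕ) : Fintype.card (KClause k n) = n.choose k * 2 ^ k := by
  simpa using card_filter_vars (k := k) (n := n) fun _ => True

open scoped Classical in
/-- The fraction of the clauses with a given property. -/
noncomputable def clauseProb (k n : ℕ) (P : KClause k n → Prop) : ℝ :=
  ((Finset.univ.filter P).card : ℝ) / Fintype.card (KClause k n)

lemma clauseProb_nonneg (P : KClause k n → Prop) : 0 ≤ clauseProb k n P := by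
  unfold clauseProb; positivity

lemma clauseProb_vars (P : Finset (Fin n) → Prop) [DecidablePred P] :
    clauseProb k n (fun c => P (vars c)) =
      (((Finset.powersetCard k (Finset.univ : Finset (Fin n))).filter P).card : ℝ) /
        n.choose k := by
  classical
  unfold clauseProb
  have h := card_filter_vars (k := k) P
  have h' : (Finset.univ.filter fun c : KClause k n => P (vars c)).card = _ := h
  rw [card_kClause]
  have h0 : ((2 : ℝ) ^ k) ≠ 0 := by positivity
  have e : ((@Finset.filter _ (fun c : KClause k n => P (vars c))
      (fun a => Classical.propDecidable _) Finset.univ).card : ℝ) =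
      (((Finset.powersetCard k (Finset.univ : Finset (Fin n))).filter P).card : ℝ) * 2 ^ k := by
    rw [← Nat.cast_two, ← Nat.cast_pow, ← Nat.cast_mul, ← h]
    congr!
  rw [e]
  push_cast
  rw [mul_div_mul_right _ _ h0]

lemma clauseProb_subset_le (hk : k ≤ n) (R : Finset (Fin n)) :
    clauseProb k n (fun c => vars c ⊆ R) ≤ ((R.card : ℝ) / n) ^ k := by
  classical
  rw [clauseProb_vars (fun W => W ⊆ R)]
  have : (Finset.powersetCard k (Finset.univ : Finset (Fin n))).filter (fun W => W ⊆ R) =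
      Finset.powersetCard k R := by
    ext W
    simp only [Finset.mem_filter, Finset.mem_powersetCard, Finset.subset_univ, true_and]
    exact and_comm
  rw [this, Finset.card_powersetCard]
  exact choose_div_le (by simpa using Finset.card_le_univ R) k hk

/-- With `b` the size of `B`, the ratio `C(n-b, k-b) / C(n, k)` equals `C(k, b) / C(n, b)`, which is
at most `(k/n)^b`. -/
lemma clauseProb_superset_le (hk : k ≤ n) (B : Finset (Fin n)) :
    clauseProb k n (fun c => B ⊆ vars c) ≤ ((k : ℝ) / n) ^ B.card := by
  classical
  rw [clauseProb_vars (fun W => B ⊆ W)]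
  by_cases hB : B.card ≤ k
  · have hcard : ((Finset.powersetCard k (Finset.univ : Finset (Fin n))).filter
        (fun W => B ⊆ W)).card ≤ (n - B.card).choose (k - B.card) := by
      have h1 : (Finset.powersetCard (k - B.card) Bᶜ).card =
          (n - B.card).choose (k - B.card) := by
        rw [Finset.card_powersetCard, Finset.card_compl, Fintype.card_fin]
      rw [← h1]
      refine Finset.card_le_card_of_injOn (fun W => W \ B) ?_ ?_
      · intro W hW
        obtain ⟨h2, h3⟩ := Finset.mem_filter.1 (Finset.mem_coe.1 hW)
        refine Finset.mem_coe.2 (Finset.mem_powersetCard.2 ⟨?_, ?_⟩)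
        · intro v hv
          exact Finset.mem_compl.2 (Finset.mem_sdiff.1 hv).2
        · rw [Finset.card_sdiff_of_subset h3, (Finset.mem_powersetCard.1 h2).2]
      · intro W hW W' hW' h
        have h3 := (Finset.mem_filter.1 (Finset.mem_coe.1 hW)).2
        have h4 := (Finset.mem_filter.1 (Finset.mem_coe.1 hW')).2
        have h5 : W \ B = W' \ B := h
        rw [← Finset.sdiff_union_of_subset h3, h5, Finset.sdiff_union_of_subset h4]
    have hBn : B.card ≤ n := hB.trans hk
    have hmul := Nat.choose_mul (n := n) hB
    have h1 : (0 : ℝ) < n.choose k := by exact_mod_cast Nat.choose_pos hk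
    have h2 : (0 : ℝ) < n.choose B.card := by exact_mod_cast Nat.choose_pos hBn
    refine le_trans ?_ (choose_div_le hk B.card hBn)
    rw [div_le_div_iff₀ h1 h2]
    have h3 : (n.choose k * k.choose B.card : ℝ) =
        n.choose B.card * (n - B.card).choose (k - B.card) := by exact_mod_cast hmul
    have h4 : (((Finset.powersetCard k (Finset.univ : Finset (Fin n))).filter
        (fun W => B ⊆ W)).card : ℝ) ≤ ((n - B.card).choose (k - B.card) : ℕ) := by
      exact_mod_cast hcard
    nlinarith
  · have : (Finset.powersetCard k (Finset.univ : Finset (Fin n))).filter (fun W => B ⊆ W) = ∅ := by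
      rw [Finset.filter_eq_empty_iff]
      intro W hW hBW
      have := Finset.card_le_card hBW
      rw [(Finset.mem_powersetCard.1 hW).2] at this
      exact hB this
    rw [this]
    simp only [Finset.card_empty, Nat.cast_zero, zero_div]
    positivity

lemma clauseProb_mono {P Q : KClause k n → Prop} (h : ∀ c, P c → Q c) :
    clauseProb k n P ≤ clauseProb k n Q := by
  classical
  unfold clauseProb
  refine div_le_div_of_nonneg_right (Nat.cast_le.2 (Finset.card_le_card fun c hc => ?_))
    (Nat.cast_nonneg _)
  rw [Finset.mem_filter] at hc ⊢
  exact ⟨hc.1, h c hc.2⟩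

lemma clauseProb_touch_le (hk : k ≤ n) (W : Finset (Fin n)) :
    clauseProb k n (fun c => ¬ Disjoint (vars c) W) ≤ W.card * ((k : ℝ) / n) := by
  classical
  have h1 : clauseProb k n (fun c => ¬ Disjoint (vars c) W) ≤
      ∑ v ∈ W, clauseProb k n (fun c => {v} ⊆ vars c) := by
    unfold clauseProb
    rw [← Finset.sum_div]
    gcongr
    have hsub : (Finset.univ.filter fun c : KClause k n => ¬ Disjoint (vars c) W) ⊆
        W.biUnion fun v => Finset.univ.filter fun c : KClause k n => {v} ⊆ vars c := by
      intro c hc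
      obtain ⟨v, h1, h2⟩ := Finset.not_disjoint_iff.1 (Finset.mem_filter.1 hc).2
      exact Finset.mem_biUnion.2 ⟨v, h2, Finset.mem_filter.2 ⟨Finset.mem_univ _,
        Finset.singleton_subset_iff.2 h1⟩⟩
    have := (Finset.card_le_card hsub).trans Finset.card_biUnion_le
    calc _ ≤ ((∑ v ∈ W, (Finset.univ.filter fun c : KClause k n => {v} ⊆ vars c).card : ℕ) : ℝ) := by
          refine Nat.cast_le.2 (le_trans (le_of_eq ?_) this)
          congr!
      _ = _ := by
          push_cast
          refine Finset.sum_congr rfl fun v _ => ?_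
          congr!
  refine h1.trans ((Finset.sum_le_card_nsmul _ _ ((k : ℝ) / n) fun v _ => ?_).trans ?_)
  · simpa using clauseProb_superset_le hk {v}
  · rw [nsmul_eq_mul]

end ClauseCount

/-! ### Union bounds and independence of clauses -/

section FormulaProb

lemma formulaProb_mono {P Q : Formula k n m → Prop} (h : ∀ Φ, P Φ → Q Φ) :
    formulaProb k n m P ≤ formulaProb k n m Q := by
  unfold formulaProb
  gcongr
  · exact Set.toFinite _
  · exact h _

lemma formulaProb_le_one (P : Formula k n m → Prop) : formulaProb k n m P ≤ 1 := by
  refine div_le_one_of_le₀ ?_ (Nat.cast_nonneg _)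
  rw [← Set.ncard_univ]
  exact_mod_cast Set.ncard_le_ncard (Set.subset_univ _) (Set.toFinite _)

lemma formulaProb_or_le (P Q : Formula k n m → Prop) :
    formulaProb k n m (fun Φ => P Φ ∨ Q Φ) ≤ formulaProb k n m P + formulaProb k n m Q := by
  unfold formulaProb
  rw [← add_div]
  gcongr
  have : {Φ : Formula k n m | P Φ ∨ Q Φ} = {Φ | P Φ} ∪ {Φ | Q Φ} := rfl
  rw [this]
  exact_mod_cast Set.ncard_union_le _ _

lemma formulaProb_exists_le {ι : Type*} (I : Finset ι) (P : ι → Formula k n m → Prop) :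
    formulaProb k n m (fun Φ => ∃ i ∈ I, P i Φ) ≤ ∑ i ∈ I, formulaProb k n m (P i) := by
  unfold formulaProb
  rw [← Finset.sum_div]
  gcongr
  have : {Φ : Formula k n m | ∃ i ∈ I, P i Φ} = ⋃ i ∈ I, {Φ | P i Φ} := by
    ext; simp
  rw [this]
  exact_mod_cast Finset.set_ncard_biUnion_le I _

lemma card_formula_pos (hk : k ≤ n) : 0 < Nat.card (Formula k n m) := by
  rw [Nat.card_eq_fintype_card, Fintype.card_fun, card_kClause]
  have := Nat.choose_pos hk
  positivity

lemma formulaProb_add_not (hk : k ≤ n) (P : Formula k n m → Prop) :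
    formulaProb k n m P + formulaProb k n m (fun Φ => ¬ P Φ) = 1 := by
  have h : (0 : ℝ) < Nat.card (Formula k n m) := by exact_mod_cast card_formula_pos hk
  unfold formulaProb
  rw [← add_div, div_eq_one_iff_eq h.ne']
  have : {Φ : Formula k n m | ¬ P Φ} = {Φ | P Φ}ᶜ := rfl
  rw [this]
  exact_mod_cast Set.ncard_add_ncard_compl _

lemma formulaProb_forall (P : Fin m → KClause k n → Prop) :
    formulaProb k n m (fun Φ => ∀ j, P j (Φ j)) = ∏ j, clauseProb k n (P j) := by
  classical
  have h : {Φ : Formula k n m | ∀ j, P j (Φ j)} =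
      ((Fintype.piFinset fun j => Finset.univ.filter (P j) : Finset (Formula k n m)) : Set _) := by
    ext Φ
    simp
  unfold formulaProb clauseProb
  rw [h, Set.ncard_coe_finset, Fintype.card_piFinset, Finset.prod_div_distrib,
    Finset.prod_const, Nat.card_eq_fintype_card, Fintype.card_fun, Finset.card_univ,
    Fintype.card_fin]
  push_cast
  congr!

/-- Probability that given clauses have all their variables in a given set, while given
variables have large degree in the other clauses. -/
theorem formulaProb_subset_degree_le (hk : k ≤ n) (S : Finset (Fin m)) (R T : Finset (Fin n))
    (d : ℕ) :
    formulaProb k n m (fun Φ => (∀ i ∈ S, vars (Φ i) ⊆ R) ∧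
      ∀ v ∈ T, d ≤ (Sᶜ.filter fun j => v ∈ vars (Φ j)).card) ≤
      ((R.card : ℝ) / n) ^ (k * S.card) * ((m.choose d : ℝ) * ((k : ℝ) / n) ^ d) ^ T.card := by
  classical
  -- `J v` is a choice of `d` clauses outside `S` that contain `v`; off `T` it is fixed to `∅`, so
  -- only `T` contributes choices.
  set 𝒥 : Finset (Fin n → Finset (Fin m)) :=
    Fintype.piFinset fun v => if v ∈ T then Finset.powersetCard d Sᶜ else {∅} with h𝒥
  have h𝒥card : 𝒥.card ≤ (m.choose d) ^ T.card := by
    rw [h𝒥, Fintype.card_piFinset]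
    have : ∀ v : Fin n, (if v ∈ T then Finset.powersetCard d Sᶜ else {∅}).card ≤
        if v ∈ T then m.choose d else 1 := by
      intro v
      split_ifs
      · rw [Finset.card_powersetCard]
        exact Nat.choose_le_choose d ((Finset.card_le_univ _).trans (by simp))
      · simp
    refine (Finset.prod_le_prod (fun _ _ => Nat.zero_le _) fun v _ => this v).trans ?_
    rw [Finset.prod_ite_mem, Finset.univ_inter, Finset.prod_const]
  have h1 : formulaProb k n m (fun Φ => (∀ i ∈ S, vars (Φ i) ⊆ R) ∧
      ∀ v ∈ T, d ≤ (Sᶜ.filter fun j => v ∈ vars (Φ j)).card) ≤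
      formulaProb k n m (fun Φ => ∃ J ∈ 𝒥, ∀ j, (j ∈ S → vars (Φ j) ⊆ R) ∧
        (j ∉ S → T.filter (fun v => j ∈ J v) ⊆ vars (Φ j))) := by
    refine formulaProb_mono fun Φ hΦ => ?_
    have hex : ∀ v ∈ T, ∃ J ⊆ Sᶜ.filter (fun j => v ∈ vars (Φ j)), J.card = d := fun v hv =>
      Finset.exists_subset_card_eq (hΦ.2 v hv)
    choose! J hJ using hex
    refine ⟨fun v => if v ∈ T then J v else ∅, ?_, fun j => ⟨hΦ.1 j, fun _ v hv => ?_⟩⟩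
    · rw [h𝒥, Fintype.mem_piFinset]
      intro v
      by_cases hv : v ∈ T
      · simp only [hv, if_true, Finset.mem_powersetCard]
        exact ⟨(hJ v hv).1.trans (Finset.filter_subset _ _), (hJ v hv).2⟩
      · simp [hv]
    · obtain ⟨hvT, hj⟩ := Finset.mem_filter.1 hv
      simp only [hvT, if_true] at hj
      exact (Finset.mem_filter.1 ((hJ v hvT).1 hj)).2
  have h2 : ∀ J ∈ 𝒥, formulaProb k n m (fun Φ => ∀ j, (j ∈ S → vars (Φ j) ⊆ R) ∧
        (j ∉ S → T.filter (fun v => j ∈ J v) ⊆ vars (Φ j))) ≤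
      ((R.card : ℝ) / n) ^ (k * S.card) * (((k : ℝ) / n) ^ d) ^ T.card := by
    intro J hJ
    rw [h𝒥, Fintype.mem_piFinset] at hJ
    rw [formulaProb_forall fun j c => (j ∈ S → vars c ⊆ R) ∧
        (j ∉ S → T.filter (fun v => j ∈ J v) ⊆ vars c)]
    -- Double counting the prescribed incidences: each costs a factor `k / n`, whichever clause it
    -- falls in.
    have hsum : ∑ j ∈ Sᶜ, (T.filter fun v => j ∈ J v).card = d * T.card := by
      simp_rw [Finset.card_eq_sum_ones, Finset.sum_filter]
      rw [Finset.sum_comm, Finset.mul_sum]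
      refine Finset.sum_congr rfl fun v hv => ?_
      have hJv := hJ v
      rw [if_pos hv, Finset.mem_powersetCard] at hJv
      rw [← Finset.sum_filter, ← Finset.card_eq_sum_ones, mul_one, ← hJv.2]
      congr 1
      ext j
      simp only [Finset.mem_filter]
      exact ⟨fun h => h.2, fun h => ⟨hJv.1 h, h⟩⟩
    rw [← Finset.prod_mul_prod_compl S, pow_mul, ← pow_mul _ d, ← hsum,
      ← Finset.prod_pow_eq_pow_sum, ← Finset.prod_const]
    refine mul_le_mul (Finset.prod_le_prod (fun _ _ => clauseProb_nonneg _) fun j hj => ?_)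
      (Finset.prod_le_prod (fun _ _ => clauseProb_nonneg _) fun j hj => ?_)
      (Finset.prod_nonneg fun _ _ => clauseProb_nonneg _) (by positivity)
    · exact (clauseProb_mono fun c hc => hc.1 hj).trans (clauseProb_subset_le hk R)
    · exact (clauseProb_mono fun c hc => hc.2 (Finset.mem_compl.1 hj)).trans
        (clauseProb_superset_le hk _)
  refine h1.trans ((formulaProb_exists_le 𝒥 _).trans
    ((Finset.sum_le_card_nsmul _ _ _ h2).trans ?_))
  rw [nsmul_eq_mul, mul_pow, mul_left_comm]
  gcongr
  exact_mod_cast h𝒥card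

end FormulaProb

/-! ### Connected sets of clauses via trees -/

section Trees

/-- Updating one clause to a random clause does not change the distribution of a formula. -/
lemma formulaProb_and_le (hk : k ≤ n) (j : Fin m) (P : Formula k n m → Prop)
    (Q : Formula k n m → KClause k n → Prop) {t : ℝ}
    (hP : ∀ Φ c, P Φ → P (Function.update Φ j c))
    (hQ : ∀ Φ c c', Q Φ c' → Q (Function.update Φ j c) c')
    (hQt : ∀ Φ, clauseProb k n (Q Φ) ≤ t) :
    formulaProb k n m (fun Φ => P Φ ∧ Q Φ (Φ j)) ≤ t * formulaProb k n m P := by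
  classical
  have hN : (0 : ℝ) < Fintype.card (KClause k n) := by
    rw [card_kClause]
    have := Nat.choose_pos hk
    positivity
  have hF : (0 : ℝ) < Nat.card (Formula k n m) := by exact_mod_cast card_formula_pos hk
  set sw : Formula k n m × KClause k n → Formula k n m × KClause k n := fun p =>
    (Function.update p.1 j p.2, p.1 j) with hsw
  have hinv : Function.Involutive sw := by
    rintro ⟨Φ, c⟩
    simp [hsw]
  have h1 : ({Φ : Formula k n m | P Φ ∧ Q Φ (Φ j)} ×ˢ (Set.univ : Set (KClause k n))).ncard ≤
      {p : Formula k n m × KClause k n | P p.1 ∧ Q p.1 p.2}.ncard := by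
    refine Set.ncard_le_ncard_of_injOn sw ?_ hinv.injective.injOn (Set.toFinite _)
    rintro ⟨Φ, c⟩ ⟨⟨h1, h2⟩, _⟩
    exact ⟨hP Φ c h1, hQ Φ c _ h2⟩
  have h2 : ({p : Formula k n m × KClause k n | P p.1 ∧ Q p.1 p.2}.ncard : ℝ) ≤
      t * Fintype.card (KClause k n) * ({Φ : Formula k n m | P Φ}.ncard : ℝ) := by
    have e1 : {p : Formula k n m × KClause k n | P p.1 ∧ Q p.1 p.2}.ncard =
        ∑ Φ ∈ Finset.univ.filter P, (Finset.univ.filter (Q Φ)).card := by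
      have : {p : Formula k n m × KClause k n | P p.1 ∧ Q p.1 p.2} =
          (((Finset.univ.filter P).sigma fun Φ => Finset.univ.filter (Q Φ)).map
            (Equiv.sigmaEquivProd _ _).toEmbedding : Finset (Formula k n m × KClause k n)) := by
        ext ⟨Φ, c⟩
        simp
      rw [this, Set.ncard_coe_finset, Finset.card_map, Finset.card_sigma]
    have e2 : {Φ : Formula k n m | P Φ}.ncard = (Finset.univ.filter P).card := by
      rw [← Set.ncard_coe_finset]
      congr 1
      ext; simp
    rw [e1, e2]
    push_cast
    refine (Finset.sum_le_card_nsmul _ _ (t * Fintype.card (KClause k n)) fun Φ _ => ?_).trans ?_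
    · have := hQt Φ
      unfold clauseProb at this
      rw [div_le_iff₀ hN] at this
      convert this
    · rw [nsmul_eq_mul]
      exact le_of_eq (mul_comm _ _)
  rw [Set.ncard_prod, Set.ncard_univ, Nat.card_eq_fintype_card] at h1
  have h3 : ({Φ : Formula k n m | P Φ ∧ Q Φ (Φ j)}.ncard : ℝ) * Fintype.card (KClause k n) ≤
      t * Fintype.card (KClause k n) * ({Φ : Formula k n m | P Φ}.ncard : ℝ) :=
    le_trans (by exact_mod_cast h1) h2
  unfold formulaProb
  rw [← mul_div_assoc]
  gcongr
  nlinarith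

/-- The map `f` is the parent function of a tree on `S`. -/
inductive TreeOn (f : Fin m → Fin m) : Finset (Fin m) → Prop
  | single (j : Fin m) : f j = j → TreeOn f {j}
  | insert (S : Finset (Fin m)) (j : Fin m) : TreeOn f S → j ∉ S → f j ∈ S → TreeOn f (insert j S)

/-- Adjacent clauses of the tree share a variable. -/
def TreeEdges (f : Fin m → Fin m) (S : Finset (Fin m)) (Φ : Formula k n m) : Prop :=
  ∀ j ∈ S, f j ≠ j → ¬ Disjoint (vars (Φ j)) (vars (Φ (f j)))

lemma TreeOn.maps {f : Fin m → Fin m} {S : Finset (Fin m)} (h : TreeOn f S) :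
    ∀ j ∈ S, f j ∈ S := by
  induction h with
  | single j hj => simp [hj]
  | insert S j _ _ hfj ih =>
    intro i hi
    rcases Finset.mem_insert.1 hi with rfl | hi
    · exact Finset.mem_insert_of_mem hfj
    · exact Finset.mem_insert_of_mem (ih i hi)

lemma TreeOn.congr {f g : Fin m → Fin m} {S : Finset (Fin m)} (h : TreeOn f S)
    (hfg : ∀ j ∈ S, f j = g j) : TreeOn g S := by
  induction h with
  | single j hj => exact TreeOn.single j (by rw [← hfg j (by simp), hj])
  | insert S j _ hjS hfj ih =>
    exact TreeOn.insert S j (ih fun i hi => hfg i (Finset.mem_insert_of_mem hi)) hjS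
      (by rwa [← hfg j (Finset.mem_insert_self j S)])

/-- Each added clause takes as parent an earlier clause it meets. Fixing `f` to be the identity off
`S` leaves at most `|S|^|S|` functions. -/
lemma Conn.exists_tree {Φ : Formula k n m} {S : Finset (Fin m)} (h : Conn Φ S) :
    ∃ f : Fin m → Fin m, (∀ j ∉ S, f j = j) ∧ TreeOn f S ∧ TreeEdges f S Φ := by
  induction h with
  | single j => exact ⟨id, fun _ _ => rfl, TreeOn.single j rfl, fun _ _ h => (h rfl).elim⟩
  | insert S j _ hj hd ih =>
    obtain ⟨f, h1, h2, h3⟩ := ih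
    obtain ⟨v, hv, hvS⟩ := Finset.not_disjoint_iff.1 hd
    obtain ⟨i, hi, hvi⟩ := mem_varsOf.1 hvS
    have hne : ∀ a ∈ S, a ≠ j := fun a ha he => hj (he ▸ ha)
    refine ⟨Function.update f j i, fun a ha => ?_, TreeOn.insert S j (h2.congr fun a ha => ?_) hj
      (by simpa using hi), fun a ha hfa => ?_⟩
    · rw [Finset.mem_insert, not_or] at ha
      rw [Function.update_of_ne ha.1, h1 a ha.2]
    · rw [Function.update_of_ne (hne a ha)]
    · rcases Finset.mem_insert.1 ha with rfl | ha
      · rw [Function.update_self]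
        exact Finset.not_disjoint_iff.2 ⟨v, hv, hvi⟩
      · rw [Function.update_of_ne (hne a ha)] at hfa ⊢
        exact h3 a ha hfa

/-- Peel off the last leaf: its clause enters no other tree edge, and a fresh clause meets the `k`
variables of the parent with probability at most `k² / n`. -/
lemma TreeOn.formulaProb_le (hk : k ≤ n) {f : Fin m → Fin m} {S : Finset (Fin m)}
    (h : TreeOn f S) :
    formulaProb k n m (TreeEdges f S) ≤ ((k : ℝ) ^ 2 / n) ^ (S.card - 1) := by
  induction h with
  | single j _ => simpa using formulaProb_le_one _
  | insert S j hS hj hfj ih =>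
    have hpos : 0 < S.card := Finset.card_pos.2 ⟨_, hfj⟩
    rw [Finset.card_insert_of_notMem hj, Nat.add_sub_cancel]
    obtain ⟨a, ha⟩ : ∃ a, S.card = a + 1 := ⟨S.card - 1, by omega⟩
    rw [ha, Nat.add_sub_cancel] at ih
    rw [ha, pow_succ, mul_comm]
    have hne : ∀ i ∈ S, i ≠ j := fun i hi he => hj (he ▸ hi)
    have h1 := formulaProb_and_le hk j (TreeEdges f S)
      (fun Φ c => ¬ Disjoint (vars c) (vars (Φ (f j)))) (t := (k : ℝ) ^ 2 / n)
      (fun Φ c hΦ i hi hfi => by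
        rw [Function.update_of_ne (hne i hi), Function.update_of_ne (hne _ (hS.maps i hi))]
        exact hΦ i hi hfi)
      (fun Φ c c' hc => by rwa [Function.update_of_ne (hne _ hfj)])
      (fun Φ => by
        refine (clauseProb_touch_le hk (vars (Φ (f j)))).trans (le_of_eq ?_)
        rw [card_vars]
        ring)
    refine le_trans (formulaProb_mono fun Φ hΦ => ?_) (h1.trans (by gcongr))
    exact ⟨fun i hi => hΦ i (Finset.mem_insert_of_mem hi),
      hΦ j (Finset.mem_insert_self j S) (hne _ hfj)⟩

lemma formulaProb_conn_le (hk : k ≤ n) (S : Finset (Fin m)) :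
    formulaProb k n m (fun Φ => Conn Φ S) ≤
      (S.card : ℝ) ^ S.card * ((k : ℝ) ^ 2 / n) ^ (S.card - 1) := by
  classical
  set F := Fintype.piFinset fun j : Fin m => if j ∈ S then S else {j} with hF
  have hFcard : F.card = S.card ^ S.card := by
    rw [hF, Fintype.card_piFinset]
    have : ∀ j : Fin m, (if j ∈ S then S else {j}).card = if j ∈ S then S.card else 1 := by
      intro j; split_ifs <;> simp
    rw [Finset.prod_congr rfl fun j _ => this j, Finset.prod_ite_mem, Finset.univ_inter,
      Finset.prod_const]
  have h1 : formulaProb k n m (fun Φ => Conn Φ S) ≤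
      formulaProb k n m (fun Φ => ∃ f ∈ F.filter (fun f => TreeOn f S), TreeEdges f S Φ) := by
    refine formulaProb_mono fun Φ hΦ => ?_
    obtain ⟨f, h1, h2, h3⟩ := hΦ.exists_tree
    refine ⟨f, Finset.mem_filter.2 ⟨?_, h2⟩, h3⟩
    rw [hF, Fintype.mem_piFinset]
    intro j
    split_ifs with hj
    · exact h2.maps j hj
    · simp [h1 j hj]
  refine h1.trans ((formulaProb_exists_le _ _).trans ((Finset.sum_le_card_nsmul _ _ _
    fun f hf => (Finset.mem_filter.1 hf).2.formulaProb_le hk).trans ?_))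
  rw [nsmul_eq_mul]
  gcongr
  rw [← Nat.cast_pow, ← hFcard]
  exact_mod_cast Finset.card_le_card (Finset.filter_subset _ _)

/-- First moment bound for the number of connected sets. -/
theorem formulaProb_card_connSets_gt_le (hk : k ≤ n) (L : ℕ) {N : ℝ} (hN : 0 < N) :
    formulaProb k n m (fun Φ => N < (connSets Φ L).card) ≤
      ((m.choose L : ℝ) * ((L : ℝ) ^ L * ((k : ℝ) ^ 2 / n) ^ (L - 1))) / N := by
  classical
  have hF : (0 : ℝ) < Nat.card (Formula k n m) := by exact_mod_cast card_formula_pos hk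
  rw [le_div_iff₀ hN]
  have h1 : formulaProb k n m (fun Φ => N < (connSets Φ L).card) * N ≤
      ∑ S ∈ Finset.powersetCard L (Finset.univ : Finset (Fin m)),
        formulaProb k n m (fun Φ => Conn Φ S) := by
    unfold formulaProb
    rw [← Finset.sum_div, div_mul_eq_mul_div]
    gcongr
    have e : ∀ P : Formula k n m → Prop, {Φ | P Φ}.ncard = (Finset.univ.filter P).card := by
      intro P
      rw [← Set.ncard_coe_finset]
      congr 1
      ext; simp
    rw [e, ← nsmul_eq_mul]
    refine (Finset.card_nsmul_le_sum _ (fun Φ => ((connSets Φ L).card : ℝ)) N fun Φ hΦ =>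
      (Finset.mem_filter.1 hΦ).2.le).trans ?_
    refine (Finset.sum_le_univ_sum_of_nonneg fun _ => Nat.cast_nonneg _).trans (le_of_eq ?_)
    simp_rw [e]
    have e2 : ∀ Φ : Formula k n m, (connSets Φ L).card =
        ∑ S ∈ Finset.powersetCard L (Finset.univ : Finset (Fin m)), if Conn Φ S then 1 else 0 := by
      intro Φ
      rw [← Finset.sum_filter, ← Finset.card_eq_sum_ones]
      congr 1
      ext S
      rw [mem_connSets, Finset.mem_filter, Finset.mem_powersetCard_univ]
      exact and_comm
    simp_rw [e2]
    push_cast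
    rw [Finset.sum_comm]
    refine Finset.sum_congr rfl fun S _ => ?_
    rw [Finset.card_eq_sum_ones, Finset.sum_filter]
    push_cast
    rfl
  refine h1.trans ((Finset.sum_le_card_nsmul _ _
    ((L : ℝ) ^ L * ((k : ℝ) ^ 2 / n) ^ (L - 1)) fun S hS => ?_).trans ?_)
  · have := formulaProb_conn_le (m := m) hk S
    rwa [(Finset.mem_powersetCard.1 hS).2] at this
  · rw [nsmul_eq_mul, Finset.card_powersetCard, Finset.card_univ, Fintype.card_fin]

end Trees

/-! ### Binomial estimates -/

section Estimates

lemma choose_mul_pow_self_le (m l : ℕ) :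
    (m.choose l : ℝ) * (l : ℝ) ^ l ≤ (Real.exp 1 * m) ^ l := by
  have h1 : (m.choose l : ℝ) ≤ (m : ℝ) ^ l / l.factorial := Nat.choose_le_pow_div l m
  have h2 := Real.pow_div_factorial_le_exp (l : ℝ) (Nat.cast_nonneg l) l
  have hf : (0 : ℝ) < l.factorial := by exact_mod_cast Nat.factorial_pos l
  calc (m.choose l : ℝ) * (l : ℝ) ^ l ≤ (m : ℝ) ^ l / l.factorial * (l : ℝ) ^ l := by gcongr
    _ = (m : ℝ) ^ l * ((l : ℝ) ^ l / l.factorial) := by ring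
    _ ≤ (m : ℝ) ^ l * Real.exp l := by gcongr
    _ = (Real.exp 1 * m) ^ l := by rw [mul_pow, ← Real.exp_nat_mul, mul_one, mul_comm]

lemma choose_mul_div_pow_le (n r : ℕ) (hn : 0 < n) :
    (n.choose r : ℝ) * ((r : ℝ) / n) ^ r ≤ Real.exp 1 ^ r := by
  have h := choose_mul_pow_self_le n r
  have hn' : (0 : ℝ) < (n : ℝ) ^ r := by positivity
  rw [div_pow, ← mul_div_assoc, div_le_iff₀ hn', ← mul_pow]
  exact h

/-- The factor `(kl/n)^l` on the left supplies the `l^l` that bounds `m.choose l`; it is later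
cancelled against powers on the right. -/
lemma choose_mul_choose_le {k n m l r : ℕ} (hn : 0 < n) (hr : r ≤ k * l) :
    (m.choose l : ℝ) * n.choose r * ((r : ℝ) / n) ^ (k * l) * ((k * l : ℝ) / n) ^ l ≤
      (Real.exp 1 * (m / n) * k * Real.exp 1 ^ k) ^ l * ((k * l : ℝ) / n) ^ (k * l - r) := by
  have hn' : (0 : ℝ) < n := by exact_mod_cast hn
  have h1 := choose_mul_pow_self_le m l
  have h2 := choose_mul_div_pow_le n r hn
  have h3 : ((r : ℝ) / n) ^ (k * l) = ((r : ℝ) / n) ^ r * ((r : ℝ) / n) ^ (k * l - r) := by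
    rw [← pow_add, Nat.add_sub_cancel' hr]
  have h4 : ((r : ℝ) / n) ^ (k * l - r) ≤ ((k * l : ℝ) / n) ^ (k * l - r) := by
    gcongr
    exact_mod_cast hr
  have h5 : Real.exp 1 ^ r ≤ (Real.exp 1 ^ k) ^ l := by
    rw [← pow_mul]
    exact pow_le_pow_right₀ (Real.one_le_exp (by norm_num)) hr
  calc (m.choose l : ℝ) * n.choose r * ((r : ℝ) / n) ^ (k * l) * ((k * l : ℝ) / n) ^ l
      = ((m.choose l : ℝ) * (l : ℝ) ^ l) * ((k : ℝ) / n) ^ l *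
        ((n.choose r * ((r : ℝ) / n) ^ r) * ((r : ℝ) / n) ^ (k * l - r)) := by
        rw [h3, mul_div_right_comm, mul_pow]; ring
    _ ≤ (Real.exp 1 * m) ^ l * ((k : ℝ) / n) ^ l *
        ((Real.exp 1 ^ k) ^ l * ((k * l : ℝ) / n) ^ (k * l - r)) := by
        gcongr
        exact h2.trans h5
    _ = _ := by
        rw [← mul_assoc, ← mul_pow, ← mul_pow]
        congr 2
        ring

lemma sum_half_pow_le (I : Finset ℕ) : ∑ l ∈ I, (1 / 2 : ℝ) ^ l ≤ 2 :=
  (Summable.sum_le_tsum I (fun _ _ => by positivity) summable_geometric_two).trans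
    tsum_geometric_two.le

end Estimates

/-! ### First moment bound for expansion -/

section Expansion

/-- Random formulas have no small set of clauses with few variables. -/
theorem formulaProb_not_expands_le {κ z₀ : ℝ} {a : ℕ} (hk : 0 < k) (hkn : k ≤ n) (hκ : κ ≤ 1)
    (hz₀ : 0 < z₀) (hz₁ : z₀ ≤ 1) (ha : (a : ℝ) ≤ κ * k)
    (hbase : Real.exp 1 * (m / n) * k * Real.exp 1 ^ k * z₀ ^ (a - 2) ≤ 1 / 4) (ha2 : 2 ≤ a) :
    formulaProb k n m (fun Φ => ¬ Expands Φ κ (z₀ * n / k)) ≤ 2 * k / n := by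
  classical
  have hn : 0 < n := hk.trans_le hkn
  have hn' : (0 : ℝ) < n := by exact_mod_cast hn
  have hk' : (0 : ℝ) < k := by exact_mod_cast hk
  set r : ℕ → ℕ := fun l => ⌊(1 - κ) * k * l⌋₊ with hr
  have hrl : ∀ l, r l + a * l ≤ k * l := by
    intro l
    have h1 : (r l : ℝ) ≤ (1 - κ) * k * l := Nat.floor_le (by
      have : 0 ≤ 1 - κ := by linarith
      positivity)
    have h2 : (r l + a * l : ℝ) ≤ k * l := by
      have : (0 : ℝ) ≤ l := Nat.cast_nonneg l
      nlinarith
    exact_mod_cast h2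
  set I : Finset ℕ := (Finset.Icc 1 m).filter fun l : ℕ => (l : ℝ) ≤ z₀ * n / k with hI
  have hIz : ∀ l ∈ I, (k * l : ℝ) / n ≤ z₀ := by
    intro l hl
    have := (Finset.mem_filter.1 hl).2
    rw [le_div_iff₀ hk'] at this
    rw [div_le_iff₀ hn']
    linarith
  have hIn : ∀ l ∈ I, k * l ≤ n := by
    intro l hl
    have := (hIz l hl).trans hz₁
    rw [div_le_iff₀ hn', one_mul] at this
    exact_mod_cast this
  have h1 : formulaProb k n m (fun Φ => ¬ Expands Φ κ (z₀ * n / k)) ≤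
      formulaProb k n m (fun Φ => ∃ l ∈ I, ∃ S ∈ Finset.powersetCard l (Finset.univ),
        ∃ R ∈ Finset.powersetCard (r l) (Finset.univ), (∀ i ∈ S, vars (Φ i) ⊆ R) ∧
        ∀ v ∈ (∅ : Finset (Fin n)), 0 ≤ (Sᶜ.filter fun j => v ∈ vars (Φ j)).card) := by
    refine formulaProb_mono fun Φ hΦ => ?_
    unfold Expands at hΦ
    push Not at hΦ
    obtain ⟨S, hS, hlt⟩ := hΦ
    have hpos : S.card ≠ 0 := by
      intro h0
      rw [h0, Nat.cast_zero, mul_zero] at hlt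
      exact absurd hlt (not_lt.2 (Nat.cast_nonneg _))
    have hSI : S.card ∈ I := by
      refine Finset.mem_filter.2 ⟨Finset.mem_Icc.2 ⟨Nat.one_le_iff_ne_zero.2 hpos, ?_⟩, hS⟩
      simpa using Finset.card_le_univ S
    have hvr : (varsOf Φ S).card ≤ r S.card := Nat.le_floor hlt.le
    have hrn : r S.card ≤ n := by
      have := hrl S.card
      have := hIn _ hSI
      omega
    obtain ⟨R, hR, hRc⟩ := Finset.exists_superset_card_eq hvr (by simpa using hrn)
    refine ⟨S.card, hSI, S, Finset.mem_powersetCard.2 ⟨Finset.subset_univ S, rfl⟩, R,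
      Finset.mem_powersetCard.2 ⟨Finset.subset_univ R, hRc⟩, fun i hi v hv => ?_, by simp⟩
    exact hR (mem_varsOf.2 ⟨i, hi, hv⟩)
  have h2 : ∀ l ∈ I, (m.choose l : ℝ) * (n.choose (r l) * (((r l : ℕ) : ℝ) / n) ^ (k * l)) ≤
      k / n * (1 / 2) ^ l := by
    intro l hl
    have hl1 : 1 ≤ l := (Finset.mem_Icc.1 (Finset.mem_filter.1 hl).1).1
    have hl' : (0 : ℝ) < l := by exact_mod_cast hl1
    have hrl' := hrl l
    set z : ℝ := (k * l : ℝ) / n with hz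
    have hz0 : 0 < z := by positivity
    have hzz := hIz l hl
    have hz1 : z ≤ 1 := hzz.trans hz₁
    have h3 := choose_mul_choose_le (m := m) hn (show r l ≤ k * l by omega)
    rw [← hz] at h3
    -- Of the `a` surplus powers `z^l`, one cancels the extra factor on the left, one yields the
    -- decay `k / n`, and the other `a - 2`, bounded through `z₀`, beat the base.
    have h4 : z ^ (k * l - r l) ≤ (z ^ 2 * z₀ ^ (a - 2)) ^ l := by
      calc z ^ (k * l - r l) ≤ z ^ (a * l) := pow_le_pow_of_le_one hz0.le hz1 (by omega)
        _ = (z ^ 2 * z ^ (a - 2)) ^ l := by rw [pow_mul, ← pow_add, Nat.add_sub_cancel' ha2]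
        _ ≤ (z ^ 2 * z₀ ^ (a - 2)) ^ l := by gcongr
    have h5 : (m.choose l : ℝ) * n.choose (r l) * (((r l : ℕ) : ℝ) / n) ^ (k * l) * z ^ l ≤
        (z * (1 / 4)) ^ l * z ^ l := by
      refine h3.trans ((mul_le_mul_of_nonneg_left h4 (by positivity)).trans ?_)
      rw [← mul_pow, ← mul_pow]
      refine pow_le_pow_left₀ (by positivity) ?_ l
      calc _ = (Real.exp 1 * (m / n) * k * Real.exp 1 ^ k * z₀ ^ (a - 2)) * (z * z) := by ring
        _ ≤ 1 / 4 * (z * z) := by gcongr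
        _ = _ := by ring
    have h6 := le_of_mul_le_mul_right h5 (by positivity)
    rw [← mul_assoc]
    refine h6.trans ?_
    rw [mul_pow]
    have h7 : z ^ l ≤ z := by
      simpa using pow_le_pow_of_le_one hz0.le hz1 hl1
    have h8 : (l : ℝ) ≤ 2 ^ l := by exact_mod_cast (Nat.lt_two_pow_self (n := l)).le
    calc z ^ l * (1 / 4) ^ l ≤ z * (1 / 4) ^ l := by gcongr
      _ = k / n * (l * (1 / 4) ^ l) := by rw [hz]; ring
      _ ≤ k / n * (2 ^ l * (1 / 4) ^ l) := by gcongr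
      _ = k / n * (1 / 2) ^ l := by rw [← mul_pow]; norm_num
  refine h1.trans ((formulaProb_exists_le I _).trans ?_)
  have h3 : ∀ l ∈ I, formulaProb k n m (fun Φ => ∃ S ∈ Finset.powersetCard l (Finset.univ),
        ∃ R ∈ Finset.powersetCard (r l) (Finset.univ), (∀ i ∈ S, vars (Φ i) ⊆ R) ∧
        ∀ v ∈ (∅ : Finset (Fin n)), 0 ≤ (Sᶜ.filter fun j => v ∈ vars (Φ j)).card) ≤
      k / n * (1 / 2) ^ l := by
    intro l hl
    refine le_trans ?_ (h2 l hl)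
    refine (formulaProb_exists_le _ _).trans ((Finset.sum_le_card_nsmul _ _
      (n.choose (r l) * (((r l : ℕ) : ℝ) / n) ^ (k * l)) fun S hS => ?_).trans (le_of_eq ?_))
    · refine (formulaProb_exists_le _ _).trans ((Finset.sum_le_card_nsmul _ _
        ((((r l : ℕ) : ℝ) / n) ^ (k * l)) fun R hR => ?_).trans (le_of_eq ?_))
      · have h4 := formulaProb_subset_degree_le hkn S R (∅ : Finset (Fin n)) 0
        rw [(Finset.mem_powersetCard.1 hS).2, (Finset.mem_powersetCard.1 hR).2,
          Finset.card_empty, pow_zero, mul_one] at h4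
        exact h4
      · rw [nsmul_eq_mul, Finset.card_powersetCard, Finset.card_univ, Fintype.card_fin]
    · rw [nsmul_eq_mul, Finset.card_powersetCard, Finset.card_univ, Fintype.card_fin]
  refine (Finset.sum_le_sum h3).trans ?_
  rw [← Finset.mul_sum]
  calc (k : ℝ) / n * ∑ l ∈ I, (1 / 2 : ℝ) ^ l ≤ k / n * 2 := by gcongr; exact sum_half_pow_le I
    _ = _ := by ring

end Expansion

/-! ### High-degree variables and the number of connected sets -/

section HighDegree

/-- The probability that a variable lies in `d` given clauses, summed over the choices of the
clauses, for `d = ⌈Δ⌉ - 1`. -/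
lemma choose_mul_pow_degThreshold_le (hk : 0 < k) (hn : 0 < n) (hΔ : 1 < degThreshold k n m)
    (hk3 : 2 * Real.exp 1 / (k : ℝ) ^ 3 ≤ 1) :
    (m.choose (⌈degThreshold k n m⌉₊ - 1) : ℝ) * ((k : ℝ) / n) ^ (⌈degThreshold k n m⌉₊ - 1) ≤
      2 * Real.exp 1 / (k : ℝ) ^ 3 := by
  set Δ := degThreshold k n m with hΔdef
  set d := ⌈Δ⌉₊ - 1 with hd
  have hk' : (0 : ℝ) < k := by exact_mod_cast hk
  have hn' : (0 : ℝ) < n := by exact_mod_cast hn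
  have hc2 : 1 < ⌈Δ⌉₊ := Nat.lt_ceil.2 (by exact_mod_cast hΔ)
  have hd1 : 1 ≤ d := by omega
  have hdΔ : Δ / 2 ≤ d := by
    have h1 : Δ ≤ ⌈Δ⌉₊ := Nat.le_ceil Δ
    have h2 : (⌈Δ⌉₊ : ℝ) = d + 1 := by
      have : ⌈Δ⌉₊ = d + 1 := by omega
      exact_mod_cast this
    have h3 : (1 : ℝ) ≤ d := by exact_mod_cast hd1
    linarith
  have hd0 : (0 : ℝ) < d := by exact_mod_cast hd1
  have h1 := choose_mul_pow_self_le m d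
  have h2 : (m.choose d : ℝ) * ((k : ℝ) / n) ^ d ≤ (Real.exp 1 * m * k / (n * d)) ^ d := by
    have hp : (0 : ℝ) < (d : ℝ) ^ d := by positivity
    refine le_of_mul_le_mul_right ?_ hp
    calc (m.choose d : ℝ) * ((k : ℝ) / n) ^ d * (d : ℝ) ^ d
        = ((m.choose d : ℝ) * (d : ℝ) ^ d) * ((k : ℝ) / n) ^ d := by ring
      _ ≤ (Real.exp 1 * m) ^ d * ((k : ℝ) / n) ^ d := by gcongr
      _ = _ := by
        rw [← mul_pow, ← mul_pow]
        congr 1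
        field_simp
  have h3 : Real.exp 1 * m * k / (n * d) ≤ 2 * Real.exp 1 / (k : ℝ) ^ 3 := by
    rw [div_le_div_iff₀ (by positivity) (by positivity)]
    have h4 : Δ * n = (k : ℝ) ^ 4 * m := by
      rw [hΔdef, degThreshold]; field_simp
    calc Real.exp 1 * m * k * (k : ℝ) ^ 3 = Real.exp 1 * ((k : ℝ) ^ 4 * m) := by ring
      _ = Real.exp 1 * (Δ * n) := by rw [h4]
      _ ≤ Real.exp 1 * (2 * d * n) := by gcongr; linarith
      _ = _ := by ring
  refine h2.trans ((pow_le_pow_left₀ (by positivity) h3 d).trans ?_)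
  simpa using pow_le_pow_of_le_one (by positivity) hk3 hd1

/-- Written with `d + 1` so that a variable occurring at most once in `S` retains `d` occurrences
outside `S`. -/
lemma succ_le_degree_of_mem_highVars {Φ : Formula k n m} (hΔ : 1 < degThreshold k n m)
    {v : Fin n} (hv : v ∈ highVars Φ) :
    ⌈degThreshold k n m⌉₊ - 1 + 1 ≤ (Finset.univ.filter fun j => v ∈ vars (Φ j)).card := by
  have h1 : degThreshold k n m ≤ degree Φ v := mem_highVars.1 hv
  have h2 : 1 < ⌈degThreshold k n m⌉₊ := Nat.lt_ceil.2 (by exact_mod_cast hΔ)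
  rw [← degree_eq_card]
  have := Nat.ceil_le.2 h1
  omega

/-- Random formulas have few variables of high degree. -/
theorem formulaProb_card_highVars_ge_le {c : ℝ} (hk : 0 < k) (hkn : k ≤ n)
    (hΔ : 1 < degThreshold k n m) (hc : 0 < c)
    (hk3 : 2 * Real.exp 1 / (k : ℝ) ^ 3 ≤ 1)
    (hck : Real.exp 1 / c * (2 * Real.exp 1 / (k : ℝ) ^ 3) ≤ 1 / 2) :
    formulaProb k n m (fun Φ => c * n ≤ (highVars Φ).card) ≤ 1 / (c * n) := by
  classical
  have hn : 0 < n := hk.trans_le hkn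
  have hn' : (0 : ℝ) < n := by exact_mod_cast hn
  set d := ⌈degThreshold k n m⌉₊ - 1 with hd
  set w : ℝ := 2 * Real.exp 1 / (k : ℝ) ^ 3 with hw
  have hw0 : 0 ≤ w := by positivity
  set h := ⌈c * n⌉₊ with hh
  have hcn : c * n ≤ h := Nat.le_ceil _
  have hh0 : (0 : ℝ) < h := lt_of_lt_of_le (by positivity) hcn
  have h1 : formulaProb k n m (fun Φ => c * n ≤ (highVars Φ).card) ≤
      formulaProb k n m (fun Φ => ∃ T ∈ Finset.powersetCard h (Finset.univ : Finset (Fin n)),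
        (∀ i ∈ (∅ : Finset (Fin m)), vars (Φ i) ⊆ ∅) ∧
        ∀ v ∈ T, d ≤ ((∅ : Finset (Fin m))ᶜ.filter fun j => v ∈ vars (Φ j)).card) := by
    refine formulaProb_mono fun Φ hΦ => ?_
    obtain ⟨T, hT, hTc⟩ := Finset.exists_subset_card_eq (Nat.ceil_le.2 hΦ)
    refine ⟨T, Finset.mem_powersetCard.2 ⟨Finset.subset_univ T, hTc⟩, by simp, fun v hv => ?_⟩
    have := succ_le_degree_of_mem_highVars hΔ (hT hv)
    rw [Finset.compl_empty]
    omega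
  refine h1.trans ((formulaProb_exists_le _ _).trans
    ((Finset.sum_le_card_nsmul _ _ (w ^ h) fun T hT => ?_).trans ?_))
  · have h2 := formulaProb_subset_degree_le hkn (∅ : Finset (Fin m)) ∅ T d
    rw [Finset.card_empty (α := Fin m), mul_zero, pow_zero, one_mul,
      (Finset.mem_powersetCard.1 hT).2] at h2
    exact h2.trans (pow_le_pow_left₀ (by positivity)
      (choose_mul_pow_degThreshold_le hk hn hΔ hk3) h)
  · rw [nsmul_eq_mul, Finset.card_powersetCard, Finset.card_univ, Fintype.card_fin]
    have h2 := choose_mul_pow_self_le n h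
    have h3 : (n.choose h : ℝ) * w ^ h * (h : ℝ) ^ h ≤ (1 / 2) ^ h * (h : ℝ) ^ h := by
      calc (n.choose h : ℝ) * w ^ h * (h : ℝ) ^ h = ((n.choose h : ℝ) * (h : ℝ) ^ h) * w ^ h := by
            ring
        _ ≤ (Real.exp 1 * n) ^ h * w ^ h := by gcongr
        _ = (Real.exp 1 / c * w * (c * n)) ^ h := by
            rw [← mul_pow]
            congr 1
            field_simp
        _ ≤ (1 / 2 * h) ^ h := by gcongr
        _ = _ := mul_pow _ _ _
    refine (le_of_mul_le_mul_right h3 (by positivity)).trans ?_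
    have h4 : (h : ℝ) ≤ 2 ^ h := by exact_mod_cast (Nat.lt_two_pow_self (n := h)).le
    rw [one_div_pow]
    exact one_div_le_one_div_of_le (by positivity) (hcn.trans h4)

/-- Every clause after the first shares at least one variable with its predecessors. -/
lemma Conn.card_varsOf_add_le {Φ : Formula k n m} {S : Finset (Fin m)} (h : Conn Φ S) :
    (varsOf Φ S).card + S.card ≤ k * S.card + 1 := by
  induction h with
  | single j => simp [varsOf, card_vars]
  | insert S j _ hj hd ih =>
    rw [Finset.card_insert_of_notMem hj, varsOf_insert]
    have h1 := Finset.card_union_add_card_inter (vars (Φ j)) (varsOf Φ S)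
    have h2 : 0 < (vars (Φ j) ∩ varsOf Φ S).card := by
      rw [Finset.card_pos]
      exact Finset.not_disjoint_iff_nonempty_inter.1 hd
    rw [card_vars] at h1
    rw [mul_add]
    omega

/-- In connected sets of clauses, few variables have high degree. -/
theorem formulaProb_conn_highVars_le {κ c E y : ℝ} {a L : ℕ} (hk : 0 < k) (hkn : k ≤ n)
    (hΔ : 1 < degThreshold k n m) (hE : k * E ≤ n) (ha : (a : ℝ) ≤ (c - κ) * k)
    (hk3 : 2 * Real.exp 1 / (k : ℝ) ^ 3 ≤ 1)
    (hy : Real.exp 1 * (m / n) * k * Real.exp 1 ^ k * 2 ^ k *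
      (2 * Real.exp 1 / (k : ℝ) ^ 3) ^ a ≤ y) (hy1 : y ≤ 1 / 2 * Real.exp (-2))
    (hL : Real.log n ≤ L) (hL1 : 1 ≤ L) :
    formulaProb k n m (fun Φ => Expands Φ κ E ∧ ∃ S, Conn Φ S ∧ L ≤ S.card ∧ (S.card : ℝ) ≤ E ∧
      c * k * S.card < (highVars Φ ∩ varsOf Φ S).card) ≤ 2 / n := by
  classical
  have hn : 0 < n := hk.trans_le hkn
  have hn' : (0 : ℝ) < n := by exact_mod_cast hn
  have hk' : (0 : ℝ) < k := by exact_mod_cast hk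
  set d := ⌈degThreshold k n m⌉₊ - 1 with hd
  set w : ℝ := 2 * Real.exp 1 / (k : ℝ) ^ 3 with hw
  have hw0 : 0 ≤ w := by positivity
  -- The most variables that a connected set of `l` clauses can have.
  set r : ℕ → ℕ := fun l => (k - 1) * l + 1 with hr
  have hrl : ∀ l, 1 ≤ l → r l + l = k * l + 1 := by
    intro l _
    obtain ⟨k', rfl⟩ : ∃ k', k = k' + 1 := ⟨k - 1, by omega⟩
    simp only [hr, Nat.add_sub_cancel]
    ring
  set I : Finset ℕ := (Finset.Icc L m).filter fun l : ℕ => (l : ℝ) ≤ E with hI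
  have hI1 : ∀ l ∈ I, 1 ≤ l := fun l hl =>
    hL1.trans (Finset.mem_Icc.1 (Finset.mem_filter.1 hl).1).1
  have hIn : ∀ l ∈ I, k * l ≤ n := by
    intro l hl
    have h1 := (Finset.mem_filter.1 hl).2
    have : (k * l : ℝ) ≤ n := le_trans (by gcongr) hE
    exact_mod_cast this
  have h1 : formulaProb k n m (fun Φ => Expands Φ κ E ∧ ∃ S, Conn Φ S ∧ L ≤ S.card ∧
      (S.card : ℝ) ≤ E ∧ c * k * S.card < (highVars Φ ∩ varsOf Φ S).card) ≤
      formulaProb k n m (fun Φ => ∃ l ∈ I, ∃ S ∈ Finset.powersetCard l (Finset.univ),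
        ∃ R ∈ Finset.powersetCard (r l) (Finset.univ), ∃ T ∈ Finset.powersetCard (a * l) R,
        (∀ i ∈ S, vars (Φ i) ⊆ R) ∧
        ∀ v ∈ T, d ≤ (Sᶜ.filter fun j => v ∈ vars (Φ j)).card) := by
    refine formulaProb_mono fun Φ hΦ => ?_
    obtain ⟨hexp, S, hconn, hLS, hSE, hlt⟩ := hΦ
    have hSI : S.card ∈ I := by
      refine Finset.mem_filter.2 ⟨Finset.mem_Icc.2 ⟨hLS, ?_⟩, hSE⟩
      simpa using Finset.card_le_univ S
    have hrS := hrl S.card (hI1 _ hSI)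
    have hvr : (varsOf Φ S).card ≤ r S.card := by
      have := hconn.card_varsOf_add_le
      omega
    have hrn : r S.card ≤ n := by
      have := hIn _ hSI
      have := hI1 _ hSI
      omega
    obtain ⟨R, hR, hRc⟩ := Finset.exists_superset_card_eq hvr (by simpa using hrn)
    -- Variables repeated within `S` number at most `κ k |S|` by expansion. The remaining ones get
    -- their high degree from clauses outside `S`, which are independent of `S`.
    set T₁ := (highVars Φ ∩ varsOf Φ S).filter fun v => (S.filter fun j => v ∈ vars (Φ j)).card ≤ 1
    set T₂ := (varsOf Φ S).filter fun v => ¬ (S.filter fun j => v ∈ vars (Φ j)).card ≤ 1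
    have hT₂ : T₂.card + (varsOf Φ S).card ≤ k * S.card := by
      rw [← sum_card_filter_mem_vars Φ S, Finset.card_filter, Finset.card_eq_sum_ones (varsOf Φ S),
        ← Finset.sum_add_distrib]
      refine Finset.sum_le_sum fun v hv => ?_
      obtain ⟨j, hj, hvj⟩ := mem_varsOf.1 hv
      have : 0 < (S.filter fun j => v ∈ vars (Φ j)).card :=
        Finset.card_pos.2 ⟨j, Finset.mem_filter.2 ⟨hj, hvj⟩⟩
      split_ifs <;> omega
    have hT : (highVars Φ ∩ varsOf Φ S).card ≤ T₁.card + T₂.card := by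
      refine le_trans (Finset.card_le_card fun v hv => ?_) (Finset.card_union_le _ _)
      by_cases h : (S.filter fun j => v ∈ vars (Φ j)).card ≤ 1
      · exact Finset.mem_union_left _ (Finset.mem_filter.2 ⟨hv, h⟩)
      · exact Finset.mem_union_right _ (Finset.mem_filter.2 ⟨(Finset.mem_inter.1 hv).2, h⟩)
    have hexpS := hexp S hSE
    have hT₁ : a * S.card ≤ T₁.card := by
      have e1 : (T₂.card : ℝ) + (varsOf Φ S).card ≤ k * S.card := by exact_mod_cast hT₂
      have e2 : ((highVars Φ ∩ varsOf Φ S).card : ℝ) ≤ T₁.card + T₂.card := by exact_mod_cast hT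
      have e3 : (a * S.card : ℝ) ≤ T₁.card := by
        have : (0 : ℝ) ≤ S.card := Nat.cast_nonneg _
        nlinarith
      exact_mod_cast e3
    obtain ⟨T, hTT, hTc⟩ := Finset.exists_subset_card_eq hT₁
    refine ⟨S.card, hSI, S, Finset.mem_powersetCard.2 ⟨Finset.subset_univ S, rfl⟩, R,
      Finset.mem_powersetCard.2 ⟨Finset.subset_univ R, hRc⟩, T,
      Finset.mem_powersetCard.2 ⟨fun v hv => hR ?_, hTc⟩, fun i hi v hv => ?_, fun v hv => ?_⟩
    · exact (Finset.mem_inter.1 (Finset.mem_filter.1 (hTT hv)).1).2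
    · exact hR (mem_varsOf.2 ⟨i, hi, hv⟩)
    · obtain ⟨h2, h3⟩ := Finset.mem_filter.1 (hTT hv)
      have h4 := succ_le_degree_of_mem_highVars hΔ (Finset.mem_inter.1 h2).1
      have h5 : (Finset.univ.filter fun j => v ∈ vars (Φ j)).card ≤
          (S.filter fun j => v ∈ vars (Φ j)).card +
          (Sᶜ.filter fun j => v ∈ vars (Φ j)).card := by
        refine le_trans (Finset.card_le_card fun j hj => ?_) (Finset.card_union_le _ _)
        have hvj := (Finset.mem_filter.1 hj).2
        by_cases hjS : j ∈ S
        · exact Finset.mem_union_left _ (Finset.mem_filter.2 ⟨hjS, hvj⟩)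
        · exact Finset.mem_union_right _ (Finset.mem_filter.2 ⟨Finset.mem_compl.2 hjS, hvj⟩)
      omega
  have h2 : ∀ l ∈ I, (m.choose l : ℝ) * (n.choose (r l) * (2 ^ (k * l) *
      ((((r l : ℕ) : ℝ) / n) ^ (k * l) * w ^ (a * l)))) ≤ 1 / n * (1 / 2) ^ l := by
    intro l hl
    have hl1 := hI1 l hl
    have hl' : (1 : ℝ) ≤ l := by exact_mod_cast hl1
    have hrl' := hrl l hl1
    set z : ℝ := (k * l : ℝ) / n with hz
    have hz0 : 0 < z := by positivity
    have h3 := choose_mul_choose_le (m := m) (k := k) (l := l) (r := r l) hn (by omega)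
    rw [← hz, show k * l - r l = l - 1 by omega] at h3
    have hzl : z ^ l = z ^ (l - 1) * z := by rw [← pow_succ, Nat.sub_add_cancel hl1]
    rw [hzl, ← mul_assoc, mul_right_comm] at h3
    have h4 := le_of_mul_le_mul_right h3 (by positivity)
    have hz1 : 1 / n ≤ z := by
      rw [hz]
      gcongr
      have : (1 : ℝ) ≤ k := by exact_mod_cast hk
      nlinarith
    have h5 : (m.choose l : ℝ) * n.choose (r l) * (((r l : ℕ) : ℝ) / n) ^ (k * l) ≤
        n * (Real.exp 1 * (m / n) * k * Real.exp 1 ^ k) ^ l := by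
      have h6 : (m.choose l : ℝ) * n.choose (r l) * (((r l : ℕ) : ℝ) / n) ^ (k * l) * (1 / n) ≤
          (Real.exp 1 * (m / n) * k * Real.exp 1 ^ k) ^ l :=
        le_trans (mul_le_mul_of_nonneg_left hz1 (by positivity)) h4
      rw [mul_one_div, div_le_iff₀ hn'] at h6
      linarith
    have hlog : Real.log n ≤ l := hL.trans (by
      exact_mod_cast (Finset.mem_Icc.1 (Finset.mem_filter.1 hl).1).1)
    -- Since `l ≥ log n`, the factor `exp (-2)` per clause gives `n⁻²`; one power of `n` offsets the
    -- factor `n` in `h5`.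
    have h7 : y ^ l ≤ (1 / 2) ^ l * (1 / n * (1 / n)) := by
      have hy0 : 0 ≤ y := le_trans (by positivity) hy
      calc y ^ l ≤ (1 / 2 * Real.exp (-2)) ^ l := pow_le_pow_left₀ hy0 hy1 l
        _ = (1 / 2) ^ l * Real.exp (l * (-2)) := by rw [mul_pow, ← Real.exp_nat_mul]
        _ ≤ (1 / 2) ^ l * Real.exp (-Real.log n + -Real.log n) := by
            gcongr; linarith
        _ = _ := by
            rw [Real.exp_add, Real.exp_neg, Real.exp_log hn', one_div (n : ℝ)]
    calc (m.choose l : ℝ) * (n.choose (r l) * (2 ^ (k * l) *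
          ((((r l : ℕ) : ℝ) / n) ^ (k * l) * w ^ (a * l))))
        = ((m.choose l : ℝ) * n.choose (r l) * (((r l : ℕ) : ℝ) / n) ^ (k * l)) *
          (2 ^ (k * l) * w ^ (a * l)) := by ring
      _ ≤ (n * (Real.exp 1 * (m / n) * k * Real.exp 1 ^ k) ^ l) *
          (2 ^ (k * l) * w ^ (a * l)) := by gcongr
      _ = n * (Real.exp 1 * (m / n) * k * Real.exp 1 ^ k * 2 ^ k * w ^ a) ^ l := by
          rw [pow_mul, pow_mul, mul_pow _ (w ^ a), mul_pow _ (2 ^ k : ℝ)]; ring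
      _ ≤ n * y ^ l := by gcongr
      _ ≤ n * ((1 / 2) ^ l * (1 / n * (1 / n))) := by gcongr
      _ = _ := by field_simp
  refine h1.trans ((formulaProb_exists_le I _).trans ?_)
  have h3 : ∀ l ∈ I, formulaProb k n m (fun Φ => ∃ S ∈ Finset.powersetCard l (Finset.univ),
        ∃ R ∈ Finset.powersetCard (r l) (Finset.univ), ∃ T ∈ Finset.powersetCard (a * l) R,
        (∀ i ∈ S, vars (Φ i) ⊆ R) ∧
        ∀ v ∈ T, d ≤ (Sᶜ.filter fun j => v ∈ vars (Φ j)).card) ≤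
      1 / n * (1 / 2) ^ l := by
    intro l hl
    have hl1 := hI1 l hl
    have hrl' := hrl l hl1
    refine le_trans ?_ (h2 l hl)
    refine (formulaProb_exists_le _ _).trans ((Finset.sum_le_card_nsmul _ _
      (n.choose (r l) * (2 ^ (k * l) * ((((r l : ℕ) : ℝ) / n) ^ (k * l) * w ^ (a * l))))
      fun S hS => ?_).trans (le_of_eq ?_))
    · refine (formulaProb_exists_le _ _).trans ((Finset.sum_le_card_nsmul _ _
        (2 ^ (k * l) * ((((r l : ℕ) : ℝ) / n) ^ (k * l) * w ^ (a * l)))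
        fun R hR => ?_).trans (le_of_eq ?_))
      · have hRc := (Finset.mem_powersetCard.1 hR).2
        refine (formulaProb_exists_le _ _).trans ((Finset.sum_le_card_nsmul _ _
          ((((r l : ℕ) : ℝ) / n) ^ (k * l) * w ^ (a * l)) fun T hT => ?_).trans ?_)
        · refine (formulaProb_subset_degree_le hkn S R T d).trans ?_
          rw [(Finset.mem_powersetCard.1 hS).2, hRc, (Finset.mem_powersetCard.1 hT).2]
          gcongr
          exact choose_mul_pow_degThreshold_le hk hn hΔ hk3
        · rw [nsmul_eq_mul, Finset.card_powersetCard, hRc]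
          gcongr
          have h4 : (r l).choose (a * l) ≤ 2 ^ (k * l) :=
            (Nat.choose_le_two_pow _ _).trans (Nat.pow_le_pow_right (by norm_num) (by omega))
          exact_mod_cast h4
      · rw [nsmul_eq_mul, Finset.card_powersetCard, Finset.card_univ, Fintype.card_fin]
    · rw [nsmul_eq_mul, Finset.card_powersetCard, Finset.card_univ, Fintype.card_fin]
  refine (Finset.sum_le_sum h3).trans ?_
  rw [← Finset.mul_sum]
  calc (1 : ℝ) / n * ∑ l ∈ I, (1 / 2 : ℝ) ^ l ≤ 1 / n * 2 := by gcongr; exact sum_half_pow_le I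
    _ = _ := by ring

/-- Random formulas have few connected sets of clauses. -/
theorem formulaProb_many_conn_le (hk : 0 < k) (hkn : k ≤ n) (hm : 0 < m) {L : ℕ} (hL : 1 ≤ L) :
    formulaProb k n m (fun Φ => (n : ℝ) ^ 2 * (Real.exp 1 * k ^ 2 * (m / n)) ^ L <
      (connSets Φ L).card) ≤ 1 / n := by
  have hn : 0 < n := hk.trans_le hkn
  have hn' : (0 : ℝ) < n := by exact_mod_cast hn
  have hk' : (1 : ℝ) ≤ k := by exact_mod_cast hk
  have hm' : (0 : ℝ) < m := by exact_mod_cast hm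
  have hN : (0 : ℝ) < (n : ℝ) ^ 2 * (Real.exp 1 * k ^ 2 * (m / n)) ^ L := by positivity
  refine (formulaProb_card_connSets_gt_le hkn L hN).trans ?_
  rw [div_le_div_iff₀ hN hn', one_mul]
  obtain ⟨l, rfl⟩ : ∃ l, L = l + 1 := ⟨L - 1, by omega⟩
  have h1 := choose_mul_pow_self_le m (l + 1)
  have hk2 : (1 : ℝ) ≤ (k : ℝ) ^ 2 := one_le_pow₀ hk'
  calc (m.choose (l + 1) : ℝ) * (((l + 1 : ℕ) : ℝ) ^ (l + 1) *
        ((k : ℝ) ^ 2 / n) ^ (l + 1 - 1)) * n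
      = ((m.choose (l + 1) : ℝ) * ((l + 1 : ℕ) : ℝ) ^ (l + 1)) * ((k : ℝ) ^ 2 / n) ^ l * n := by
        rw [Nat.add_sub_cancel]; ring
    _ ≤ (Real.exp 1 * m) ^ (l + 1) * ((k : ℝ) ^ 2 / n) ^ l * n := by gcongr
    _ ≤ (Real.exp 1 * m) ^ (l + 1) * ((k : ℝ) ^ 2 / n) ^ l * n * (k : ℝ) ^ 2 :=
        le_mul_of_one_le_right (by positivity) hk2
    _ = (n : ℝ) ^ 2 * (Real.exp 1 * k ^ 2 * (m / n)) ^ (l + 1) := by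
        rw [show Real.exp 1 * (k : ℝ) ^ 2 * (m / n) = (Real.exp 1 * m) * ((k : ℝ) ^ 2 / n) by ring,
          mul_pow (Real.exp 1 * m), pow_succ ((k : ℝ) ^ 2 / n)]
        field_simp

end HighDegree

/-! ### Numerical inequalities -/

section Numerics

lemma eventually_sq_mul_two_rpow_le {θ ε : ℝ} (hθ : 0 < θ) (hε : 0 < ε) :
    ∀ᶠ k : ℕ in atTop, (k : ℝ) ^ 2 * (2 : ℝ) ^ (-(θ * k)) ≤ ε := by
  have h1 : |(2 : ℝ) ^ (-θ)| < 1 := by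
    rw [abs_of_nonneg (by positivity)]
    exact Real.rpow_lt_one_of_one_lt_of_neg (by norm_num) (by linarith)
  have h2 := tendsto_pow_const_mul_const_pow_of_abs_lt_one 2 h1
  filter_upwards [h2.eventually_le_const hε] with k hk
  rwa [← neg_mul, Real.rpow_mul (by norm_num), Real.rpow_natCast]

/-- The fraction increases with `1 - 12ζ ≤ 1`, and equals `1/9` at 1. This is all that is used of
the exponent. -/
lemma exponent_le {ζ γ x : ℝ} (hζ0 : 0 < ζ) (hζ : ζ < 1 / 12) (hγ : 0 < γ) (hx : 0 ≤ x) :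
    (1 - ζ) * (1 - 12 * ζ) / (4 * (1 - 12 * ζ) + 5) * γ * x ≤ γ * (1 - ζ) * x / 9 := by
  have h1 : (1 - 12 * ζ) / (4 * (1 - 12 * ζ) + 5) ≤ 1 / 9 := by
    rw [div_le_div_iff₀ (by linarith) (by norm_num)]
    linarith
  have h2 : 0 ≤ γ * (1 - ζ) * x := by
    have : 0 < 1 - ζ := by linarith
    positivity
  calc (1 - ζ) * (1 - 12 * ζ) / (4 * (1 - 12 * ζ) + 5) * γ * x
      = (1 - 12 * ζ) / (4 * (1 - 12 * ζ) + 5) * (γ * (1 - ζ) * x) := by ring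
    _ ≤ 1 / 9 * (γ * (1 - ζ) * x) := by gcongr
    _ = _ := by ring

/-- The floor and the subtraction of 2 together lose at most 3 factors `exp (4/κ)`, hence the
`12/κ`. -/
lemma exp_pow_floor_sub_two_le {κ x : ℝ} (hκ : 0 < κ) :
    Real.exp (-(4 / κ)) ^ (⌊κ * x⌋₊ - 2) ≤ Real.exp (12 / κ - 4 * x) := by
  rw [← Real.exp_nat_mul]
  refine Real.exp_le_exp.2 ?_
  have h1 : κ * x < ⌊κ * x⌋₊ + 1 := Nat.lt_floor_add_one _
  have h2 : (⌊κ * x⌋₊ : ℝ) ≤ (⌊κ * x⌋₊ - 2 : ℕ) + 2 := by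
    have : ⌊κ * x⌋₊ ≤ (⌊κ * x⌋₊ - 2) + 2 := by omega
    exact_mod_cast this
  have h3 : κ * x - 3 ≤ (⌊κ * x⌋₊ - 2 : ℕ) := by linarith
  have h4 : (κ * x - 3) * (4 / κ) ≤ (⌊κ * x⌋₊ - 2 : ℕ) * (4 / κ) := by gcongr
  have h5 : (κ * x - 3) * (4 / κ) = 4 * x - 12 / κ := by
    field_simp
    ring
  linarith

lemma one_div_cube_mul_two_rpow_le {k s : ℝ} (hk : 1 ≤ k) (hs : s ≤ k) :
    k * (1 / k ^ 3 * (2 : ℝ) ^ (s / 9)) ≤ Real.exp k := by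
  have h1 : (2 : ℝ) ^ (s / 9) ≤ Real.exp k := by
    rw [Real.rpow_def_of_pos (by norm_num)]
    refine Real.exp_le_exp.2 ?_
    have := Real.log_two_lt_d9
    have := Real.log_two_gt_d9
    nlinarith
  have h2 : k * (1 / k ^ 3) ≤ 1 := by
    rw [mul_one_div, div_le_one (by positivity)]
    exact le_self_pow₀ hk (by norm_num)
  calc k * (1 / k ^ 3 * (2 : ℝ) ^ (s / 9)) = k * (1 / k ^ 3) * (2 : ℝ) ^ (s / 9) := by ring
    _ ≤ 1 * Real.exp k := by gcongr
    _ = _ := one_mul _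

/-- The estimate behind the first moment bounds for small sets of clauses. -/
lemma base_le {κ A s : ℝ} (hκ : 0 < κ) (hκk : 4 + 12 / κ ≤ k) (hs : s ≤ k)
    (hA : A ≤ 1 / (k : ℝ) ^ 3 * (2 : ℝ) ^ (s / 9)) :
    Real.exp 1 * A * k * Real.exp 1 ^ k * 2 ^ k *
      Real.exp (-(4 / κ)) ^ (⌊κ * k⌋₊ - 2) ≤ Real.exp (-3) := by
  have hk1 : (1 : ℝ) ≤ k := by
    have : 0 < 12 / κ := by positivity
    linarith
  have h1 : k * A ≤ Real.exp k :=
    (mul_le_mul_of_nonneg_left hA (by positivity)).trans (one_div_cube_mul_two_rpow_le hk1 hs)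
  have h2 : (2 : ℝ) ^ k ≤ Real.exp k := by
    rw [← mul_one (k : ℝ), Real.exp_nat_mul]
    have := Real.add_one_le_exp (1 : ℝ)
    gcongr
    linarith
  have h3 : Real.exp 1 ^ k = Real.exp k := by rw [← Real.exp_nat_mul, mul_one]
  calc _ = Real.exp 1 * (k * A) * Real.exp 1 ^ k * 2 ^ k *
        Real.exp (-(4 / κ)) ^ (⌊κ * k⌋₊ - 2) := by ring
    _ ≤ Real.exp 1 * Real.exp k * Real.exp k * Real.exp k * Real.exp (12 / κ - 4 * k) := by
        rw [h3]
        gcongr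
        exact exp_pow_floor_sub_two_le hκ
    _ = Real.exp (1 + k + k + k + (12 / κ - 4 * k)) := by simp only [Real.exp_add]
    _ ≤ _ := Real.exp_le_exp.2 (by linarith)

lemma half_rpow_mul_le {s Δ k : ℝ} (hΔ : Δ ≤ k * (2 : ℝ) ^ (s / 9)) :
    (1 / 2 : ℝ) ^ (s / 4) * Δ ≤ k * (2 : ℝ) ^ (-(5 * s / 36)) := by
  calc (1 / 2 : ℝ) ^ (s / 4) * Δ ≤ (1 / 2 : ℝ) ^ (s / 4) * (k * (2 : ℝ) ^ (s / 9)) := by gcongr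
    _ = k * ((2 : ℝ) ^ (-(s / 4)) * (2 : ℝ) ^ (s / 9)) := by
        rw [one_div, Real.inv_rpow (by norm_num), ← Real.rpow_neg (by norm_num)]; ring
    _ = _ := by rw [← Real.rpow_add (by norm_num)]; ring_nf

/-- With `x = 2^(-s/4) Δ`, the bias of the marginals costs at most `exp (x s) ≤ exp 1 ≤ 3` in the
second term. The exponent `5/36` is `1/4 - 1/9`. -/
lemma failure_le {s Δ k : ℝ} (hk : 1 ≤ k) (hs0 : 0 ≤ s) (hs : s ≤ k) (hΔ0 : 0 ≤ Δ)
    (hΔ : Δ ≤ k * (2 : ℝ) ^ (s / 9)) (hr : k ^ 2 * (2 : ℝ) ^ (-(5 * s / 36)) ≤ 1) :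
    k * (2 * (2 * (1 / 2 : ℝ) ^ (s / 4) * Δ)) +
      (1 / 2 + 2 * (1 / 2 : ℝ) ^ (s / 4) * Δ) ^ (s / 4) ≤
        7 * k ^ 2 * (2 : ℝ) ^ (-(5 * s / 36)) := by
  set x := (1 / 2 : ℝ) ^ (s / 4) * Δ with hx
  have hx0 : 0 ≤ x := by positivity
  have h1 : x ≤ k * (2 : ℝ) ^ (-(5 * s / 36)) := half_rpow_mul_le hΔ
  set b := (2 : ℝ) ^ (-(5 * s / 36)) with hb
  have hb0 : 0 < b := by positivity
  have h2 : (1 / 2 : ℝ) ^ (s / 4) ≤ b := by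
    rw [one_div, Real.inv_rpow (by norm_num), ← Real.rpow_neg (by norm_num)]
    exact Real.rpow_le_rpow_of_exponent_le (by norm_num) (by linarith)
  have h3 : (1 / 2 + 2 * x) ^ (s / 4) ≤ 3 * (k ^ 2 * b) := by
    have e1 : 1 / 2 + 2 * x ≤ 1 / 2 * Real.exp (4 * x) := by
      have := Real.add_one_le_exp (4 * x)
      linarith
    calc (1 / 2 + 2 * x) ^ (s / 4) ≤ (1 / 2 * Real.exp (4 * x)) ^ (s / 4) :=
          Real.rpow_le_rpow (by positivity) e1 (by positivity)
      _ = (1 / 2) ^ (s / 4) * Real.exp (x * s) := by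
          rw [Real.mul_rpow (by norm_num) (by positivity), ← Real.exp_mul]
          ring_nf
      _ ≤ b * Real.exp 1 := by
          gcongr
          calc x * s ≤ (k * b) * k := by gcongr
            _ = k ^ 2 * b := by ring
            _ ≤ 1 := hr
      _ ≤ b * 3 := by
          have := Real.exp_one_lt_d9
          gcongr
          linarith
      _ = 3 * (1 * b) := by ring
      _ ≤ 3 * (k ^ 2 * b) := by
          gcongr
          exact one_le_pow₀ hk
  calc k * (2 * (2 * (1 / 2 : ℝ) ^ (s / 4) * Δ)) +
        (1 / 2 + 2 * (1 / 2 : ℝ) ^ (s / 4) * Δ) ^ (s / 4)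
      = 4 * (k * x) + (1 / 2 + 2 * x) ^ (s / 4) := by rw [hx]; ring_nf
    _ ≤ 4 * (k * (k * b)) + 3 * (k ^ 2 * b) := by gcongr
    _ = _ := by ring

/-- The balance of one clause: the exponents of 2 add up to `s/9 - 0.99 · 5s/36 + s/200 ≤ -s/50`,
which absorbs the power of `k`. -/
lemma growth_le {s κ A k : ℝ} (hk : 1 ≤ k) (hs0 : 0 ≤ s) (hA0 : 0 ≤ A)
    (hA : A ≤ 1 / k ^ 3 * (2 : ℝ) ^ (s / 9)) (hκ : κ * k ≤ s / 400)
    (hr : 21 * (k ^ 2 * (2 : ℝ) ^ (-(s / 50))) ≤ Real.exp (-3)) :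
    Real.exp 1 * k ^ 2 * A *
      ((7 * k ^ 2 * (2 : ℝ) ^ (-(5 * s / 36))) ^ (1 - 1 / 100 : ℝ) * (2 : ℝ) ^ (2 * κ * k)) ≤
      Real.exp (-3) := by
  have hk0 : 0 < k := by linarith
  have h1 : (7 * k ^ 2) ^ (1 - 1 / 100 : ℝ) ≤ 7 * k ^ 2 := by
    have : 1 ≤ 7 * k ^ 2 := by nlinarith
    simpa using Real.rpow_le_rpow_of_exponent_le this (show (1 - 1 / 100 : ℝ) ≤ 1 by norm_num)
  have h2 : (2 : ℝ) ^ (2 * κ * k) ≤ (2 : ℝ) ^ (s / 200) :=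
    Real.rpow_le_rpow_of_exponent_le (by norm_num) (by linarith)
  have h3 : (2 : ℝ) ^ (s / 9 + -(5 * s / 36) * (1 - 1 / 100) + s / 200) ≤ 2 ^ (-(s / 50)) :=
    Real.rpow_le_rpow_of_exponent_le (by norm_num) (by linarith)
  have h4 := Real.exp_one_lt_d9
  rw [Real.mul_rpow (by positivity) (by positivity), ← Real.rpow_mul (by norm_num)]
  calc _ ≤ 3 * k ^ 2 * (1 / k ^ 3 * (2 : ℝ) ^ (s / 9)) *
        (7 * k ^ 2 * 2 ^ (-(5 * s / 36) * (1 - 1 / 100)) * 2 ^ (s / 200)) := by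
        gcongr
        linarith
    _ = 21 * (k * (2 : ℝ) ^ (s / 9 + -(5 * s / 36) * (1 - 1 / 100) + s / 200)) := by
        rw [Real.rpow_add (by norm_num), Real.rpow_add (by norm_num)]
        field_simp
        ring
    _ ≤ 21 * (k ^ 2 * 2 ^ (-(s / 50))) := by
        gcongr
        exact le_self_pow₀ hk (by norm_num)
    _ ≤ _ := hr

/-- The balance of one clause, raised to the power `L ≥ log n`, gives `n⁻³`, against `n²` from the
number of connected sets and `n` from the trivial bound on the discrepancy. -/
lemma total_le {A Q κ k δ : ℝ} {n L : ℕ} (hn : 0 < n) (hQ : 0 ≤ Q) (hA : 0 ≤ A)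
    (hL : Real.log n ≤ L)
    (hβ : Real.exp 1 * k ^ 2 * A * (Q ^ (1 - δ) * (2 : ℝ) ^ (2 * κ * k)) ≤ Real.exp (-3)) :
    n * ((n : ℝ) ^ 2 * (Real.exp 1 * k ^ 2 * A) ^ L *
      (Q ^ ((1 - δ) * L) * (2 : ℝ) ^ (2 * κ * k * L))) ≤ 1 := by
  have hn' : (0 : ℝ) < n := by exact_mod_cast hn
  calc n * ((n : ℝ) ^ 2 * (Real.exp 1 * k ^ 2 * A) ^ L *
        (Q ^ ((1 - δ) * L) * (2 : ℝ) ^ (2 * κ * k * L)))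
      = (n : ℝ) ^ 3 *
        (Real.exp 1 * k ^ 2 * A * (Q ^ (1 - δ) * (2 : ℝ) ^ (2 * κ * k))) ^ L := by
        rw [Real.rpow_mul hQ, Real.rpow_mul (by norm_num), Real.rpow_natCast, Real.rpow_natCast]
        ring
    _ ≤ (n : ℝ) ^ 3 * Real.exp (-3) ^ L := by gcongr
    _ ≤ (n : ℝ) ^ 3 * Real.exp (-(3 : ℕ) * Real.log n) := by
        rw [← Real.exp_nat_mul]
        refine mul_le_mul_of_nonneg_left (Real.exp_le_exp.2 ?_) (by positivity)
        push_cast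
        linarith
    _ = 1 := by
        rw [neg_mul, Real.exp_neg, Real.exp_nat_mul, Real.exp_log hn']
        field_simp

end Numerics

/-! ### Choice of parameters and conclusion -/

lemma IsSpectrallyIndependent.mono {Φ : Formula k n m} {M : Finset (Fin n)} {η η' : ℝ}
    (h : IsSpectrallyIndependent Φ M η) (hη : η ≤ η') : IsSpectrallyIndependent Φ M η' :=
  fun Λ hΛ τ lam hlam => (h Λ hΛ τ lam hlam).trans hη

/-- The conclusion of the main theorem for one formula. -/
def Conclusion (γ ζ η : ℝ) (Φ : Formula k n m) : Prop :=
  ∀ M : Finset (Fin n), IsGoodMarking γ ζ Φ M →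
    HasFullSupport Φ M ∧ IsSpectrallyIndependent Φ M η

/-- The requirements on `k`, for the expansion parameter `κ`. -/
structure LargeWidth (γ ζ κ : ℝ) (k : ℕ) : Prop where
  le_k : 4 + 12 / κ ≤ k
  sparse : 2 * Real.exp 1 / (k : ℝ) ^ 3 ≤ Real.exp (-(4 / κ))
  high : Real.exp 1 / ((ζ - κ) * Real.exp (-(4 / κ)) / 4) * (2 * Real.exp 1 / (k : ℝ) ^ 3) ≤ 1 / 2
  decay : 21 * ((k : ℝ) ^ 2 * (2 : ℝ) ^ (-(γ * (1 - ζ) * k / 50))) ≤ Real.exp (-3)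

lemma eventually_largeWidth {γ ζ κ : ℝ} (hγ : 0 < γ * (1 - ζ)) :
    ∀ᶠ k in atTop, LargeWidth γ ζ κ k := by
  have h1 : Tendsto (fun k : ℕ => 2 * Real.exp 1 / (k : ℝ) ^ 3) atTop (𝓝 0) :=
    tendsto_const_nhds.div_atTop ((tendsto_pow_atTop (by norm_num)).comp
      tendsto_natCast_atTop_atTop)
  have h2 := h1.const_mul (Real.exp 1 / ((ζ - κ) * Real.exp (-(4 / κ)) / 4))
  rw [mul_zero] at h2
  filter_upwards [tendsto_natCast_atTop_atTop.eventually_ge_atTop (4 + 12 / κ),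
    h1.eventually_le_const (Real.exp_pos (-(4 / κ))),
    h2.eventually_le_const (show (0 : ℝ) < 1 / 2 by norm_num),
    eventually_sq_mul_two_rpow_le (θ := γ * (1 - ζ) / 50) (ε := Real.exp (-3) / 21)
      (by positivity) (by positivity)] with k e1 e2 e3 e4
  refine ⟨e1, e2, e3, ?_⟩
  rw [show γ * (1 - ζ) * k / 50 = γ * (1 - ζ) / 50 * k by ring]
  linarith

/-- The requirements on `n`, for given width and density of expansion. -/
structure LargeSize (z₀ : ℝ) (k n : ℕ) : Prop where
  le_n : k ≤ n
  three_le : 3 ≤ n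
  log_le : Real.log n + 1 ≤ z₀ * n / k / 2
  four_le : 4 ≤ z₀ * n / k

lemma eventually_largeSize {z₀ : ℝ} (hz : 0 < z₀) (hk : 0 < k) :
    ∀ᶠ n in atTop, LargeSize z₀ k n := by
  have hk' : (0 : ℝ) < k := by exact_mod_cast hk
  have hc : 0 < z₀ / k := by positivity
  have h1 : Tendsto (fun n : ℕ => z₀ / k * (n : ℝ)) atTop atTop :=
    tendsto_natCast_atTop_atTop.const_mul_atTop hc
  have h2 := (Real.isLittleO_log_id_atTop.comp_tendsto tendsto_natCast_atTop_atTop).bound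
    (show 0 < z₀ / k / 4 by positivity)
  filter_upwards [eventually_ge_atTop k, eventually_ge_atTop 3, h2,
    h1.eventually_ge_atTop 4] with n e1 e2 e3 e4
  have e5 : z₀ * n / k = z₀ / k * n := by ring
  refine ⟨e1, e2, ?_, e5 ▸ e4⟩
  simp only [Function.comp, id, Real.norm_eq_abs, Nat.abs_cast] at e3
  have e6 := (le_abs_self _).trans e3
  rw [e5]
  linarith

lemma exp_neg_three_le : Real.exp (-3) ≤ 1 / 4 := by
  rw [Real.exp_neg, one_div]
  have := Real.add_one_le_exp (3 : ℝ)
  gcongr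
  linarith

lemma exp_neg_three_le_half_mul : Real.exp (-3) ≤ 1 / 2 * Real.exp (-2) := by
  rw [show (-3 : ℝ) = -1 + -2 by norm_num, Real.exp_add]
  gcongr
  rw [Real.exp_neg, one_div]
  have := Real.add_one_le_exp (1 : ℝ)
  gcongr
  linarith

lemma one_le_log_natCast (hn : 3 ≤ n) : 1 ≤ Real.log n := by
  have h : (3 : ℝ) ≤ n := by exact_mod_cast hn
  rw [Real.le_log_iff_exp_le (by linarith)]
  have := Real.exp_one_lt_d9
  linarith

/-- Formulas with the typical properties satisfy the conclusion. -/
theorem conclusion_of_large {γ ζ κ E : ℝ} {B : ℕ} (hζ : ζ < 1 / 12) (hγ : 0 < γ)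
    (hγζ : 3 * γ * (1 - ζ) ≤ 1) (hκ : 0 < κ) (hκζ : κ ≤ ζ / 400) (hκγ : κ ≤ γ * (1 - ζ) / 400)
    (hk4 : (4 : ℝ) ≤ k) (hr : 21 * ((k : ℝ) ^ 2 * (2 : ℝ) ^ (-(γ * (1 - ζ) * k / 50))) ≤
      Real.exp (-3)) (hn3 : 3 ≤ n)
    (hm : (m : ℝ) / n ≤ 1 / (k : ℝ) ^ 3 * (2 : ℝ) ^ (γ * (1 - ζ) * k / 9))
    (hΔ : 1 < degThreshold k n m) (hLB : (⌈Real.log n⌉₊ + B : ℝ) ≤ E) {Φ : Formula k n m}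
    (g1 : Expands Φ κ E) (g2 : ((highVars Φ).card : ℝ) < (ζ - κ) * k * B)
    (g3 : ∀ S, Conn Φ S → ⌈Real.log n⌉₊ ≤ S.card → (S.card : ℝ) ≤ E →
      ((highVars Φ ∩ varsOf Φ S).card : ℝ) ≤ 1 / 100 * (ζ - κ) * k * S.card)
    (g4 : ((connSets Φ ⌈Real.log n⌉₊).card : ℝ) ≤
      (n : ℝ) ^ 2 * (Real.exp 1 * k ^ 2 * (m / n)) ^ ⌈Real.log n⌉₊) :
    Conclusion γ ζ (4 * (degThreshold k n m * (k : ℝ) ^ 2 * Real.log n)) Φ := by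
  set s := γ * (1 - ζ) * k with hs
  set L := ⌈Real.log n⌉₊ with hLdef
  set η := 4 * (degThreshold k n m * (k : ℝ) ^ 2 * Real.log n) with hη
  have hk0' : (0 : ℝ) < k := by linarith
  have hn0 : 0 < n := by omega
  have hγ0 : 0 < γ * (1 - ζ) := mul_pos hγ (by linarith)
  have hs0 : 0 ≤ s := by positivity
  have hsk : s ≤ k := mul_le_of_le_one_left hk0'.le (by linarith)
  have hm0 : 0 ≤ (m : ℝ) / n := by positivity
  have hkκ : 1 ≤ (1 - κ) * k := by nlinarith
  have he3 := exp_neg_three_le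
  have hlog1 := one_le_log_natCast hn3
  have hΔ0 : 0 ≤ degThreshold k n m := degThreshold_nonneg k n m
  have hLlog : Real.log n ≤ L := Nat.le_ceil _
  have hLlt : (L : ℝ) < Real.log n + 1 := Nat.ceil_lt_add_one (by linarith)
  have hL0 : L ≠ 0 := fun h => by
    rw [h, Nat.cast_zero] at hLlog
    linarith
  have hΔs : degThreshold k n m ≤ k * (2 : ℝ) ^ (s / 9) := by
    calc degThreshold k n m ≤ (k : ℝ) ^ 4 * (1 / (k : ℝ) ^ 3 * (2 : ℝ) ^ (s / 9)) := by
          rw [degThreshold]; gcongr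
      _ = _ := by field_simp
  set Q := 7 * (k : ℝ) ^ 2 * (2 : ℝ) ^ (-(5 * s / 36)) with hQ
  have hdecay : ∀ x, s / 50 ≤ x → 21 * ((k : ℝ) ^ 2 * (2 : ℝ) ^ (-x)) ≤ 1 / 2 := by
    intro x hx
    have : (2 : ℝ) ^ (-x) ≤ (2 : ℝ) ^ (-(s / 50)) :=
      Real.rpow_le_rpow_of_exponent_le (by norm_num) (by linarith)
    have : 21 * ((k : ℝ) ^ 2 * (2 : ℝ) ^ (-x)) ≤
        21 * ((k : ℝ) ^ 2 * (2 : ℝ) ^ (-(s / 50))) := by gcongr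
    linarith [Real.exp_pos (-3)]
  have hq1 : 8 * (2 : ℝ) ^ (-(s / 6)) * (k * degThreshold k n m) ≤ 1 := by
    calc 8 * (2 : ℝ) ^ (-(s / 6)) * (k * degThreshold k n m)
        ≤ 8 * (2 : ℝ) ^ (-(s / 6)) * (k * (k * (2 : ℝ) ^ (s / 9))) := by gcongr
      _ = 8 * ((k : ℝ) ^ 2 * (2 : ℝ) ^ (-(s / 18))) := by
          rw [show -(s / 18) = -(s / 6) + s / 9 by ring, Real.rpow_add (by norm_num)]
          ring
      _ ≤ 1 := by
          have := hdecay (s / 18) (by linarith)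
          have : 0 ≤ (k : ℝ) ^ 2 * (2 : ℝ) ^ (-(s / 18)) := by positivity
          linarith
  have hq2 : 4 * (2 : ℝ) ^ (-(s / 6)) < 1 := by
    have h1 := hdecay (s / 6) (by linarith)
    have h2 : (2 : ℝ) ^ (-(s / 6)) ≤ (k : ℝ) ^ 2 * (2 : ℝ) ^ (-(s / 6)) :=
      le_mul_of_one_le_left (by positivity) (one_le_pow₀ (by linarith))
    linarith
  have hdQ := hdecay (5 * s / 36) (by linarith)
  have hQfail := failure_le (by linarith) hs0 hsk hΔ0 hΔs (by linarith)
  have hQ1 : Q ≤ 1 := by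
    have : 0 ≤ (k : ℝ) ^ 2 * (2 : ℝ) ^ (-(5 * s / 36)) := by positivity
    rw [hQ]
    linarith
  have hβ := growth_le (κ := κ) (by linarith) hs0 hm0 hm
    (show κ * k ≤ s / 400 by
      calc κ * k ≤ γ * (1 - ζ) / 400 * k := by gcongr
        _ = _ := by rw [hs]; ring) hr
  have htotal := total_le (L := L) hn0 (show 0 ≤ Q by positivity) hm0 hLlog hβ
  -- The potential term is at most 1 and `L ≤ 2 log n`, leaving `2 + 2k log n`; now `k log n ≥ 2`
  -- and `Δ > 1` suffice.
  have hbound : 1 + k * L + n * ((n : ℝ) ^ 2 * (Real.exp 1 * k ^ 2 * (m / n)) ^ L *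
      (Q ^ ((1 - 1 / 100 : ℝ) * L) * (2 : ℝ) ^ (2 * κ * k * L))) ≤ η := by
    have h1 : (k : ℝ) * L ≤ k * (2 * Real.log n) := by gcongr; linarith
    have h2 : (2 : ℝ) ≤ k * Real.log n := by nlinarith
    have h3 : k * Real.log n ≤ (k : ℝ) ^ 2 * Real.log n := by
      gcongr
      exact le_self_pow₀ (by linarith) (by norm_num)
    have h4 : (k : ℝ) ^ 2 * Real.log n ≤ degThreshold k n m * (k : ℝ) ^ 2 * Real.log n := by
      rw [mul_assoc]
      exact le_mul_of_one_le_left (by positivity) hΔ.le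
    rw [hη]
    linarith
  intro M hM
  obtain ⟨r1, r2⟩ := conclusion_of_typical (s := s) (L := L) (B := B) (δ := 1 / 100)
    (show κ < ζ by linarith) g1 hkκ hL0 hLB g2 g3 (by norm_num) g4 hM hs hs0 hq1 hq2 hQfail hQ1
  exact ⟨r1, r2.mono hbound⟩

/-- A random formula satisfies the conclusion except with probability `O (1 / n)`. -/
theorem formulaProb_not_conclusion_le {γ ζ κ : ℝ} (hζ : ζ < 1 / 12) (hγ : 0 < γ)
    (hγζ : 3 * γ * (1 - ζ) ≤ 1) (hκ : 0 < κ) (hκζ : κ ≤ ζ / 400) (hκγ : κ ≤ γ * (1 - ζ) / 400)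
    (hk : LargeWidth γ ζ κ k) (hn : LargeSize (Real.exp (-(4 / κ))) k n)
    (hm : (m : ℝ) / n ≤ 1 / (k : ℝ) ^ 3 * (2 : ℝ) ^ (γ * (1 - ζ) * k / 9)) :
    formulaProb k n m (fun Φ => ¬ Conclusion γ ζ
      (4 * (degThreshold k n m * (k : ℝ) ^ 2 * Real.log n)) Φ) ≤
      (2 * k + 1 / ((ζ - κ) * Real.exp (-(4 / κ)) / 4) + 3) / n := by
  obtain ⟨hk1, hw, hwc, hr⟩ := hk
  obtain ⟨hkn, hn3, hlog, hE4⟩ := hn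
  set z₀ := Real.exp (-(4 / κ)) with hz₀
  set s := γ * (1 - ζ) * k with hs
  set c := (ζ - κ) * z₀ / 4 with hc
  set w := 2 * Real.exp 1 / (k : ℝ) ^ 3 with hwdef
  set E := z₀ * n / k with hE
  set a := ⌊κ * k⌋₊ with ha
  have h12 : 0 < 12 / κ := by positivity
  have hk4 : (4 : ℝ) ≤ k := by linarith
  have hk0 : 0 < k := by
    have : (0 : ℝ) < k := by linarith
    exact_mod_cast this
  have hk0' : (0 : ℝ) < k := by linarith
  have hn0 : 0 < n := by omega
  have hn0' : (0 : ℝ) < n := by exact_mod_cast hn0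
  have hz0 : 0 < z₀ := Real.exp_pos _
  have hz1 : z₀ ≤ 1 := Real.exp_le_one_iff.2 (by
    have : 0 < 4 / κ := by positivity
    linarith)
  have hγ0 : 0 < γ * (1 - ζ) := mul_pos hγ (by linarith)
  have hs0 : 0 ≤ s := by positivity
  have hsk : s ≤ k := by
    have : γ * (1 - ζ) ≤ 1 := by linarith
    calc s ≤ 1 * k := by rw [hs]; gcongr
      _ = k := one_mul _
  have hκ1 : κ ≤ 1 := by linarith
  have hc0 : 0 < c := by
    have : 0 < ζ - κ := by linarith
    positivity
  have hm0 : 0 ≤ (m : ℝ) / n := by positivity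
  have hw0 : 0 ≤ w := by positivity
  have hkκ : 1 ≤ (1 - κ) * k := by nlinarith
  have ha2 : 2 ≤ a := by
    refine Nat.le_floor ?_
    have : 12 / κ * κ = 12 := by field_simp
    push_cast
    nlinarith
  have hak : (a : ℝ) ≤ κ * k := Nat.floor_le (by positivity)
  have hE0 : 0 ≤ E := by linarith
  have hkE : k * E = z₀ * n := by rw [hE]; field_simp
  have hbase := base_le hκ hk1 hsk hm
  rw [← hz₀, ← ha] at hbase
  set η := 4 * (degThreshold k n m * (k : ℝ) ^ 2 * Real.log n) with hη
  have hlog1 : 1 ≤ Real.log n := one_le_log_natCast hn3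
  have hexp : formulaProb k n m (fun Φ => ¬ Expands Φ κ E) ≤ 2 * k / n := by
    refine formulaProb_not_expands_le hk0 hkn hκ1 hz0 hz1 hak ?_ ha2
    have h2 : (1 : ℝ) ≤ 2 ^ k := one_le_pow₀ (by norm_num)
    calc Real.exp 1 * (m / n) * k * Real.exp 1 ^ k * z₀ ^ (a - 2)
        ≤ Real.exp 1 * (m / n) * k * Real.exp 1 ^ k * z₀ ^ (a - 2) * 2 ^ k :=
          le_mul_of_one_le_right (by positivity) h2
      _ = Real.exp 1 * (m / n) * k * Real.exp 1 ^ k * 2 ^ k * z₀ ^ (a - 2) := by ring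
      _ ≤ Real.exp (-3) := hbase
      _ ≤ 1 / 4 := exp_neg_three_le
  have hΔ0 : 0 ≤ degThreshold k n m := degThreshold_nonneg k n m
  -- For `Δ ≤ 1` all `m` clauses are bad, and `m ≤ E` lets expansion provide Hall's condition for
  -- all of them.
  rcases le_or_gt (degThreshold k n m) 1 with hΔ | hΔ
  · have hmE : (m : ℝ) ≤ E := by
      have h1 : (k : ℝ) ^ 4 * m ≤ n := by
        rw [degThreshold, ← mul_div_assoc, div_le_one hn0'] at hΔ
        exact hΔ
      have h2 : 1 ≤ z₀ * (k : ℝ) ^ 3 := by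
        rw [hwdef, div_le_iff₀ (by positivity)] at hw
        have := Real.add_one_le_exp (1 : ℝ)
        linarith
      rw [hE, le_div_iff₀ hk0']
      calc (m : ℝ) * k ≤ m * k * (z₀ * (k : ℝ) ^ 3) := le_mul_of_one_le_right (by positivity) h2
        _ = z₀ * ((k : ℝ) ^ 4 * m) := by ring
        _ ≤ z₀ * n := by gcongr
    refine le_trans (b := formulaProb k n m fun Φ => ¬ Expands Φ κ E)
      (formulaProb_mono fun Φ hΦ hex => hΦ fun M hM => ?_) (hexp.trans ?_)
    · exact conclusion_of_degThreshold_le_one (by linarith) hΔ hex hmE hkκ (by positivity) hM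
    · gcongr
      have : 0 < 1 / c := by positivity
      linarith
  · set L := ⌈Real.log n⌉₊ with hLdef
    -- Half of the expansion range is left for bad clauses; `LargeSize` makes the other half exceed
    -- `L`.
    set B := ⌊E / 2⌋₊ with hBdef
    have hLlog : Real.log n ≤ L := Nat.le_ceil _
    have hLlt : (L : ℝ) < Real.log n + 1 := Nat.ceil_lt_add_one (by linarith)
    have hL1 : 1 ≤ L := Nat.one_le_iff_ne_zero.2 fun h => by
      rw [h, Nat.cast_zero] at hLlog
      linarith
    have hB : (B : ℝ) ≤ E / 2 := Nat.floor_le (by positivity)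
    have hB' : E / 2 < B + 1 := Nat.lt_floor_add_one _
    have hm' : 0 < m := by
      rw [Nat.pos_iff_ne_zero]
      rintro rfl
      simp [degThreshold] at hΔ
      linarith
    have hw1 : w ≤ 1 := hw.trans hz1
    have hhigh := formulaProb_card_highVars_ge_le hk0 hkn hΔ hc0 hw1 hwc
    have hconn := formulaProb_conn_highVars_le (κ := κ) (c := 1 / 100 * (ζ - κ)) (E := E)
      (y := Real.exp (-3)) (a := a) (L := L) hk0 hkn hΔ
      (by rw [hkE]; exact mul_le_of_le_one_left hn0'.le hz1)
      (hak.trans (mul_le_mul_of_nonneg_right (by linarith) hk0'.le)) hw1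
      (by
        refine le_trans ?_ hbase
        gcongr
        calc w ^ a ≤ z₀ ^ a := by gcongr
          _ ≤ z₀ ^ (a - 2) := pow_le_pow_of_le_one hz0.le hz1 (by omega)) exp_neg_three_le_half_mul hLlog hL1
    have hmany := formulaProb_many_conn_le hk0 hkn hm' hL1
    -- The choice of `c` is dictated here: `k E = z₀ n` and `B ≥ E / 4`.
    have hcB : c * n ≤ (ζ - κ) * k * B := by
      have h1 : E / 4 ≤ B := by linarith
      calc c * n = (ζ - κ) * (k * E) / 4 := by rw [hkE, hc]; ring
        _ = (ζ - κ) * k * (E / 4) := by ring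
        _ ≤ _ := by
          have : 0 ≤ ζ - κ := by linarith
          gcongr
    have hall := formulaProb_or_le (fun Φ : Formula k n m => ¬ Expands Φ κ E) fun Φ =>
      c * n ≤ (highVars Φ).card ∨ ((Expands Φ κ E ∧ ∃ S, Conn Φ S ∧ L ≤ S.card ∧
        (S.card : ℝ) ≤ E ∧ 1 / 100 * (ζ - κ) * k * S.card < (highVars Φ ∩ varsOf Φ S).card) ∨
        (n : ℝ) ^ 2 * (Real.exp 1 * k ^ 2 * (m / n)) ^ L < (connSets Φ L).card)
    have hall₂ := formulaProb_or_le (fun Φ : Formula k n m => c * n ≤ (highVars Φ).card) fun Φ =>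
      (Expands Φ κ E ∧ ∃ S, Conn Φ S ∧ L ≤ S.card ∧
        (S.card : ℝ) ≤ E ∧ 1 / 100 * (ζ - κ) * k * S.card < (highVars Φ ∩ varsOf Φ S).card) ∨
        (n : ℝ) ^ 2 * (Real.exp 1 * k ^ 2 * (m / n)) ^ L < (connSets Φ L).card
    have hall₃ := formulaProb_or_le (fun Φ : Formula k n m =>
      (Expands Φ κ E ∧ ∃ S, Conn Φ S ∧ L ≤ S.card ∧
        (S.card : ℝ) ≤ E ∧ 1 / 100 * (ζ - κ) * k * S.card < (highVars Φ ∩ varsOf Φ S).card))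
        fun Φ => (n : ℝ) ^ 2 * (Real.exp 1 * k ^ 2 * (m / n)) ^ L < (connSets Φ L).card
    refine (formulaProb_mono fun Φ hΦ => ?_).trans (hall.trans ?_)
    · by_contra hcon
      simp only [not_or, not_and, not_not, not_exists, not_lt, not_le] at hcon
      obtain ⟨g1, g2, g3, g4⟩ := hcon
      exact hΦ (conclusion_of_large hζ hγ hγζ hκ hκζ hκγ hk4 hr hn3 hm hΔ (by linarith) g1
        (g2.trans_le hcB) (fun S h1 h2 h3 => g3 g1 S h1 h2 h3) g4)
    · have h5 : (2 * k + 1 / c + 3) / n = 2 * k / n + (1 / (c * n) + (2 / n + 1 / n)) := by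
        field_simp
        ring
      rw [h5]
      linarith

theorem tendsto_formulaProb_conclusion {γ ζ κ : ℝ} (hζ : ζ < 1 / 12) (hγ : 0 < γ)
    (hγζ : 3 * γ * (1 - ζ) ≤ 1) (hκ : 0 < κ) (hκζ : κ ≤ ζ / 400) (hκγ : κ ≤ γ * (1 - ζ) / 400)
    (hk : LargeWidth γ ζ κ k) (m : ℕ → ℕ)
    (hm : ∀ n : ℕ, (m n : ℝ) / n ≤ 1 / (k : ℝ) ^ 3 * (2 : ℝ) ^ (γ * (1 - ζ) * k / 9)) :
    Tendsto (fun n : ℕ => formulaProb k n (m n) (Conclusion γ ζ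
      (4 * (degThreshold k n (m n) * (k : ℝ) ^ 2 * Real.log n)))) atTop (𝓝 1) := by
  have hk0 : 0 < k := by
    have h1 := hk.le_k
    have h2 : 0 < 12 / κ := by positivity
    have h3 : (0 : ℝ) < k := by linarith
    exact_mod_cast h3
  set K := 2 * k + 1 / ((ζ - κ) * Real.exp (-(4 / κ)) / 4) + 3 with hK
  have hlim : Tendsto (fun n : ℕ => 1 - K / n) atTop (𝓝 1) := by
    simpa using (tendsto_const_div_atTop_nhds_zero_nat K).const_sub 1
  refine tendsto_of_tendsto_of_tendsto_of_le_of_le' hlim tendsto_const_nhds ?_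
    (Eventually.of_forall fun n => formulaProb_le_one _)
  filter_upwards [eventually_largeSize (Real.exp_pos (-(4 / κ))) hk0] with n hn
  have h1 := formulaProb_not_conclusion_le hζ hγ hγζ hκ hκζ hκγ hk hn (hm n)
  have h2 := formulaProb_add_not hn.le_n (Conclusion (m := m n) γ ζ
    (4 * (degThreshold k n (m n) * (k : ℝ) ^ 2 * Real.log n)))
  rw [← hK] at h1
  linarith

end RandomCNF

theorem mainTheorem7 :
    ∀ ζ : ℝ, 0 < ζ → ζ < 1 / 12 →
    ∃ C : ℝ, 0 < C ∧
    ∀ γ : ℝ, 0 < γ → 3 * γ * (1 - ζ) ≤ 1 →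
    ∃ k₀ : ℕ, ∀ k : ℕ, k₀ ≤ k →
    ∀ m : ℕ → ℕ,
      (∀ n : ℕ, (m n : ℝ) / (n : ℝ) ≤
        1 / (k : ℝ) ^ 3 *
          (2 : ℝ) ^ ((1 - ζ) * (1 - 12 * ζ) / (4 * (1 - 12 * ζ) + 5) * γ * (k : ℝ))) →
      Tendsto
        (fun n : ℕ => RandomCNF.formulaProb k n (m n) fun Φ =>
          ∀ M : Finset (Fin n), RandomCNF.IsGoodMarking γ ζ Φ M →
            RandomCNF.HasFullSupport Φ M ∧
            RandomCNF.IsSpectrallyIndependent Φ M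
              (C * (RandomCNF.degThreshold k n (m n) * (k : ℝ) ^ 2 * Real.log (n : ℝ))))
        atTop (𝓝 1) := by
  intro ζ hζ0 hζ
  -- The constant 4 serves every `ζ`.
  refine ⟨4, by norm_num, fun γ hγ hγζ => ?_⟩
  have hγ0 : 0 < γ * (1 - ζ) := mul_pos hγ (by linarith)
  -- The bound `ζ / 400` on `κ` keeps bad clauses below 1% of a connected set; the bound `γ(1-ζ) /
  -- 400` makes the overlap loss `2^(2κk)` at most `2^(s/200)`.
  obtain ⟨k₀, hk₀⟩ := eventually_atTop.1
    (RandomCNF.eventually_largeWidth (κ := min (ζ / 400) (γ * (1 - ζ) / 400)) hγ0)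
  refine ⟨k₀, fun k hk m hm => ?_⟩
  refine RandomCNF.tendsto_formulaProb_conclusion hζ hγ hγζ
    (lt_min (by positivity) (by positivity)) (min_le_left _ _) (min_le_right _ _) (hk₀ k hk) m
    fun n => (hm n).trans ?_
  gcongr
  · norm_num
  · exact RandomCNF.exponent_le hζ0 hζ hγ (Nat.cast_nonneg k)
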